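/- For real parameters $(s,\chi,a,\ell)$ with $s>0$ and $(a,\chi)\neq(0,0)$ consider the linear systems on the Riemann sphere $$Y'=\left(-s\frac{\mathbf K}{z^2}+\frac{\mathbf R}z+s\mathbf N\right)Y,\qquad \mathbf K=\begin{pmatrix}\frac12&\chi\\0&0\end{pmatrix},\quad \mathbf R=\begin{pmatrix}-b&-\frac a2\\ \frac a2&\chi a\end{pmatrix},\quad \mathbf N=\begin{pmatrix}-\frac12&0\\ \chi&0\end{pmatrix},\quad b=\ell+\chi a. \tag{1}$$ A family of systems $Y'=(\frac{K}{z^2}+\frac Rz+N)Y$, each of $K$, $N$ having distinct eigenvalues, is called isomonodromic if the residue matrices of the formal normal forms at the singular points $0$ and $\infty$ and the monodromy–Stokes data are constant in the family. (The monodromy–Stokes data is the tuple $(q_{10},q_{20},q_{1\infty},q_{2\infty};M)\in(\mathbb{CP}^1)^4\times \mathrm{GL}_2(\mathbb C)$, up to the action of $\mathrm{GL}_2(\mathbb C)$, formed by the projections to $\mathbb{CP}^1$ of the values at a base point of the canonical sectorial basic solutions at $0$ and at $\infty$, continued from good sectors along fixed paths, and by the monodromy operator of the counterclockwise circuit around $0$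 acting on the initial conditions at the base point; the base point, sectors and paths are the same for all systems of the family.) Theorem. The parameters $(s,\chi,a,\ell)$ are determined by the system (1), so that the family (1) is four-dimensional, and it is analytically foliated by one-dimensional isomonodromic families: the leaves are the graphs of the maximal solutions of the non-autonomous system of differential equations $$\begin{cases}\chi'_s=\dfrac{a-2\chi(\ell+2\chi a)}{2s}\\[2mm] a'_s=-2s\chi+\dfrac as(\ell+2\chi a)\\[2mm] \ell'_s=0.\end{cases}\tag{2}$$ Along every solution of (2) with $(a,\chi)\neq(0,0)$ the zeros of $\chi$ are isolated, and for every $\ell\in\mathbb R$ the function $$w(s)=\frac{a(s)}{2s\chi(s)}=\frac{a(s)}{\psi(s)},\qquad \psi=2s\chi,$$ satisfies, wherever $\chi(s)\ne0$, the Painlevé III equation $$w''=\frac{(w')^2}w-\frac{w'}{s}-2\ell\frac{w^2}{s}+(2\ell-2)\frac1s+w^3-\frac1w,$$ which at the zeros of $w$ is understood after multiplication by $w$. -/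

import Mathlib

open Set Filter Topology
open scoped ContDiff

noncomputable section

/-- A two-dimensional linear system `dY/dz = (K / z ^ 2 + R / z + N) Y` on the Riemann sphere. -/
structure LinSystem where
  K : Matrix (Fin 2) (Fin 2) ℂ
  R : Matrix (Fin 2) (Fin 2) ℂ
  N : Matrix (Fin 2) (Fin 2) ℂ

namespace LinSystem

/-- The coefficient matrix `K / z ^ 2 + R / z + N`. -/
def coeff (L : LinSystem) (z : ℂ) : Matrix (Fin 2) (Fin 2) ℂ :=
  (z ^ 2)⁻¹ • L.K + z⁻¹ • L.R + L.N

/-- The same system written in the coordinate `1 / z`, in which the singular point at infinity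
becomes the singular point at zero and conversely. -/
def invert (L : LinSystem) : LinSystem := ⟨-L.N, -L.R, -L.K⟩

/-- A (multivalued) solution of the system on `ℂ \ {0}`. It is written on the universal cover of
`ℂ \ {0}`, with coordinate `x` and covering map `z = exp x`, where every local solution extends to
an entire function and where `dY/dx = z * dY/dz`. Analytic extension of a germ along a path in
`ℂ \ {0}` is evaluation along the lifted path; the counterclockwise circuit around zero is
`x ↦ x + 2 π i`. -/
def IsSolution (L : LinSystem) (Y : ℂ → Fin 2 → ℂ) : Prop :=
  ∀ x : ℂ, HasDerivAt Y (Complex.exp x • (L.coeff (Complex.exp x)).mulVec (Y x)) x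

/-- `dY/dz = (diag ev / z ^ 2 + diag res / z) Y` is the formal normal form of `L` at the irregular
nonresonant singular point `z = 0`: the eigenvalues `ev 0`, `ev 1` are distinct and there is a
formal power series `∑ H m * z ^ m` with invertible free term such that `Y = H(z) Z` sends one
system to the other, i.e. (comparing the coefficients at each power of `z`)
`H' + H * (diag ev / z ^ 2 + diag res / z) = (K / z ^ 2 + R / z + N) * H`.
The matrix `diag res` is the residue matrix of the formal normal form. -/
def IsFormalNormalFormAtZero (L : LinSystem) (ev res : Fin 2 → ℂ) : Prop :=
  ev 0 ≠ ev 1 ∧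
  ∃ H : ℕ → Matrix (Fin 2) (Fin 2) ℂ, IsUnit (H 0).det ∧
    H 0 * Matrix.diagonal ev = L.K * H 0 ∧
    H 1 * Matrix.diagonal ev + H 0 * Matrix.diagonal res = L.K * H 1 + L.R * H 0 ∧
    ∀ m : ℕ, ((m : ℂ) + 1) • H (m + 1) + H (m + 2) * Matrix.diagonal ev
        + H (m + 1) * Matrix.diagonal res
      = L.K * H (m + 2) + L.R * H (m + 1) + L.N * H m

/-- `dY/dz = (diag ev + diag res / z) Y` is the formal normal form of `L` at infinity. -/
def IsFormalNormalFormAtInfinity (L : LinSystem) (ev res : Fin 2 → ℂ) : Prop :=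
  L.invert.IsFormalNormalFormAtZero (-ev) (-res)

end LinSystem

/-- The sector with vertex zero that is the image of the strip `α < Im x < β` under `exp`. The
strip itself is a choice of a lift of the sector to the universal cover of `ℂ \ {0}`. -/
def sector (α β : ℝ) : Set ℂ := Complex.exp '' {x : ℂ | α < x.im ∧ x.im < β}

/-- The sector `α < arg z < β` is good at `z = 0` for the main term matrix with eigenvalues `ev`:
it contains one of the two imaginary dividing rays, which form the set
`Re ((ev 0 - ev 1) / z) = 0`, and its closure does not contain the other one. -/
def IsGoodSectorAtZero (ev : Fin 2 → ℂ) (α β : ℝ) : Prop :=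
  ∃ θ ∈ Ioo α β, ∀ φ ∈ Icc α β,
    (((ev 0 - ev 1) / Complex.exp (φ * Complex.I)).re = 0 ↔ φ = θ)

/-- The analogous notion at infinity: the imaginary dividing rays form the set
`Re ((ev 0 - ev 1) * z) = 0`. -/
def IsGoodSectorAtInfinity (ev : Fin 2 → ℂ) (α β : ℝ) : Prop :=
  ∃ θ ∈ Ioo α β, ∀ φ ∈ Icc α β,
    (((ev 0 - ev 1) * Complex.exp (φ * Complex.I)).re = 0 ↔ φ = θ)

namespace LinSystem

/-- `f 0, f 1` is a canonical sectorial solution basis of `L` at zero in the good sector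
`α < arg z < β`: the matrix with columns `f 0, f 1` is `H(z) W(z)` there, where `W` is the diagonal
fundamental matrix of the formal normal form, with entries `exp (-ev k / z) * z ^ (res k)`, and `H`
is holomorphic on the sector, and smooth and nondegenerate up to the boundary (the vertex
included) near zero. -/
def IsCanonicalBasisAtZero (L : LinSystem) (ev res : Fin 2 → ℂ) (α β : ℝ)
    (f : Fin 2 → ℂ → Fin 2 → ℂ) : Prop :=
  (∀ k, L.IsSolution (f k)) ∧
  ∃ H : ℂ → Matrix (Fin 2) (Fin 2) ℂ,
    (∀ i k, DifferentiableOn ℂ (fun z => H z i k) (sector α β)) ∧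
    (∃ r : ℝ, 0 < r ∧
      (∀ i k, ContDiffOn ℝ ∞ (fun z => H z i k) (closure (sector α β) ∩ Metric.ball 0 r)) ∧
      ∀ z ∈ closure (sector α β) ∩ Metric.ball 0 r, (H z).det ≠ 0) ∧
    ∀ x : ℂ, α < x.im → x.im < β → ∀ k i,
      f k x i = H (Complex.exp x) i k
        * Complex.exp (-(ev k) * Complex.exp (-x) + res k * x)

/-- The analogous notion at infinity: the same in the coordinate `1 / z = exp (-x)`, in which the
sector `α < arg z < β` becomes the sector `-β < arg (1 / z) < -α`. -/
def IsCanonicalBasisAtInfinity (L : LinSystem) (ev res : Fin 2 → ℂ) (α β : ℝ)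
    (f : Fin 2 → ℂ → Fin 2 → ℂ) : Prop :=
  L.invert.IsCanonicalBasisAtZero (-ev) (-res) (-β) (-α) (fun k x => f k (-x))

end LinSystem

/-- The auxiliary choices for monodromy–Stokes data: a base point `z₀ = exp base`, a sector at zero
and a sector at infinity, and (homotopy classes of) paths from `z₀` to these sectors. The paths are
encoded by lifting everything to the universal cover: the path to a sector is the image under `exp`
of a path from `base` to the strip which represents the sector. -/
structure StokesConfig where
  base : ℂ
  α₀ : ℝ
  β₀ : ℝ
  αInf : ℝ
  βInf : ℝ

/-- Tuples `(q₁₀, q₂₀, q₁∞, q₂∞; M)` in `(ℂℙ¹)⁴ × GL₂(ℂ)`. -/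
structure MSTuple where
  q₀ : Fin 2 → Projectivization ℂ (Fin 2 → ℂ)
  qInf : Fin 2 → Projectivization ℂ (Fin 2 → ℂ)
  M : (Fin 2 → ℂ) ≃ₗ[ℂ] (Fin 2 → ℂ)

/-- Equivalence of tuples: some linear automorphism of `ℂ²` sends one tuple to the other. -/
def MSTuple.Equivalent (d e : MSTuple) : Prop :=
  ∃ H : (Fin 2 → ℂ) ≃ₗ[ℂ] (Fin 2 → ℂ),
    (∀ k, Projectivization.map H.toLinearMap H.injective (d.q₀ k) = e.q₀ k) ∧
    (∀ k, Projectivization.map H.toLinearMap H.injective (d.qInf k) = e.qInf k) ∧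
    ∀ v, H (d.M v) = e.M (H v)

/-- `d` represents the monodromy–Stokes data of `L` (with formal normal forms given by
`ev₀, res₀` at zero and `evInf, resInf` at infinity): `d.q₀ k` and `d.qInf k` are the projections
to `ℂℙ¹` of the values at the base point of canonical sectorial basic solutions, and `d.M` is the
monodromy operator acting on the initial conditions at the base point. -/
def LinSystem.IsMonodromyStokesData (L : LinSystem) (ev₀ res₀ evInf resInf : Fin 2 → ℂ)
    (c : StokesConfig) (d : MSTuple) : Prop :=
  ∃ f g : Fin 2 → ℂ → Fin 2 → ℂ,
    L.IsCanonicalBasisAtZero ev₀ res₀ c.α₀ c.β₀ f ∧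
    L.IsCanonicalBasisAtInfinity evInf resInf c.αInf c.βInf g ∧
    (∀ k, ∃ h : f k c.base ≠ 0, d.q₀ k = Projectivization.mk ℂ (f k c.base) h) ∧
    (∀ k, ∃ h : g k c.base ≠ 0, d.qInf k = Projectivization.mk ℂ (g k c.base) h) ∧
    ∀ Y, L.IsSolution Y → d.M (Y c.base) = Y (c.base + 2 * Real.pi * Complex.I)

/-- A family of linear systems is isomonodromic: all its members have irregular nonresonant
singular points of Poincaré rank one at zero and at infinity, and the residue matrices of the formal
normal forms and the monodromy–Stokes data, taken up to equivalence and with respect to common base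
point, sectors and paths, do not depend on the member. The definition is for families in which
the difference `ev 0 - ev 1` of the eigenvalues, at zero and at infinity, keeps a constant argument;
then a numeration of the eigenvalues is fixed through the family, the imaginary dividing rays are
the same for all members, and so are the good sectors. -/
def IsIsomonodromic {ι : Type*} (L : ι → LinSystem) : Prop :=
  ∃ (ev₀ evInf : ι → Fin 2 → ℂ) (res₀ resInf : Fin 2 → ℂ),
    (∀ i, (L i).IsFormalNormalFormAtZero (ev₀ i) res₀) ∧
    (∀ i, (L i).IsFormalNormalFormAtInfinity (evInf i) resInf) ∧
    (∀ i j, ∃ t : ℝ, 0 < t ∧ ev₀ i 0 - ev₀ i 1 = t * (ev₀ j 0 - ev₀ j 1)) ∧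
    (∀ i j, ∃ t : ℝ, 0 < t ∧ evInf i 0 - evInf i 1 = t * (evInf j 0 - evInf j 1)) ∧
    ∀ c : StokesConfig,
      (∀ i, IsGoodSectorAtZero (ev₀ i) c.α₀ c.β₀) →
      (∀ i, IsGoodSectorAtInfinity (evInf i) c.αInf c.βInf) →
      ∃ d : MSTuple, ∀ i,
        (∃ e, (L i).IsMonodromyStokesData (ev₀ i) res₀ (evInf i) resInf c e) ∧
        ∀ e, (L i).IsMonodromyStokesData (ev₀ i) res₀ (evInf i) resInf c e → d.Equivalent e

/-- `leaves` is an analytic foliation by curves of the open subset `P` of the space `E`: a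
decomposition of `P` into disjoint connected subsets such that every point of `P` has a neighborhood
in `P` with analytic coordinates in `ℝ × F` in which the connected components of the intersections
of the leaves with the neighborhood are given by equations `(coordinate in F) = const`. -/
def IsAnalyticFoliationByCurves {E : Type*} [NormedAddCommGroup E] [NormedSpace ℝ E]
    (F : Type*) [NormedAddCommGroup F] [NormedSpace ℝ F] (P : Set E) (leaves : Set (Set E)) :
    Prop :=
  IsOpen P ∧ ⋃₀ leaves = P ∧ (∀ A ∈ leaves, IsConnected A) ∧ leaves.PairwiseDisjoint id ∧
  ∀ p ∈ P, ∃ φ : OpenPartialHomeomorph E (ℝ × F),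
    p ∈ φ.source ∧ φ.source ⊆ P ∧
    AnalyticOnNhd ℝ φ φ.source ∧ AnalyticOnNhd ℝ φ.symm φ.target ∧
    ∀ A ∈ leaves, ∀ q ∈ A ∩ φ.source,
      connectedComponentIn (A ∩ φ.source) q = {q₁ ∈ φ.source | (φ q₁).2 = (φ q).2}

/-- The parameter space of the four-dimensional family: quadruples `(s, χ, a, ℓ)` of real numbers
with `s > 0` and `(a, χ) ≠ (0, 0)`. -/
def paramSpace : Set (ℝ × ℝ × ℝ × ℝ) := {p | 0 < p.1 ∧ (p.2.2.1, p.2.1) ≠ (0, 0)}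

/-- The linear system `Y' = (-s K / z ^ 2 + R / z + s N) Y` with parameters `(s, χ, a, ℓ)`, where
`K = (1/2, χ; 0, 0)`, `R = (-b, -a/2; a/2, χ a)`, `N = (-1/2, 0; χ, 0)`, `b = ℓ + χ a`. -/
def torusSystem (p : ℝ × ℝ × ℝ × ℝ) : LinSystem :=
  let s : ℂ := p.1
  let χ : ℂ := p.2.1
  let a : ℂ := p.2.2.1
  let ℓ : ℂ := p.2.2.2
  let b : ℂ := ℓ + χ * a
  { K := -s • !![1 / 2, χ; 0, 0]
    R := !![-b, -a / 2; a / 2, χ * a]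
    N := s • !![-1 / 2, 0; χ, 0] }

/-- `(χ, a, ℓ)` is a solution, with values in the parameter space, on the nonempty open interval
`J ⊆ (0, ∞)`, of the system `χ' = (a - 2 χ (ℓ + 2 χ a)) / (2 s)`,
`a' = -2 s χ + (a / s) (ℓ + 2 χ a)`, `ℓ' = 0`. -/
structure IsIsomSolution (J : Set ℝ) (χ a ℓ : ℝ → ℝ) : Prop where
  isOpen : IsOpen J
  isConnected : IsConnected J
  mem_paramSpace : ∀ s ∈ J, (s, χ s, a s, ℓ s) ∈ paramSpace
  deriv_χ : ∀ s ∈ J, HasDerivAt χ ((a s - 2 * χ s * (ℓ s + 2 * χ s * a s)) / (2 * s)) s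
  deriv_a : ∀ s ∈ J, HasDerivAt a (-2 * s * χ s + a s / s * (ℓ s + 2 * χ s * a s)) s
  deriv_ℓ : ∀ s ∈ J, HasDerivAt ℓ 0 s

/-- A solution that cannot be extended to a larger interval. -/
def IsMaximalIsomSolution (J : Set ℝ) (χ a ℓ : ℝ → ℝ) : Prop :=
  IsIsomSolution J χ a ℓ ∧
  ∀ (J₁ : Set ℝ) (χ₁ a₁ ℓ₁ : ℝ → ℝ), IsIsomSolution J₁ χ₁ a₁ ℓ₁ → J ⊆ J₁ →
    EqOn χ χ₁ J → EqOn a a₁ J → EqOn ℓ ℓ₁ J → J₁ = J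

/-- The graphs of the maximal solutions. -/
def isomLeaves : Set (Set (ℝ × ℝ × ℝ × ℝ)) :=
  {A | ∃ (J : Set ℝ) (χ a ℓ : ℝ → ℝ), IsMaximalIsomSolution J χ a ℓ ∧
    A = (fun s => (s, χ s, a s, ℓ s)) '' J}

/-- `w` satisfies at `s` the Painlevé III equation
`w'' = w' ^ 2 / w - w' / s - 2 ℓ w ^ 2 / s + (2 ℓ - 2) / s + w ^ 3 - 1 / w`.
At the zeros of `w` the equation is understood after multiplication by `w`. -/
structure SatisfiesPainleveIIIAt (ℓ : ℝ) (w : ℝ → ℝ) (s : ℝ) : Prop where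
  contDiffAt : ContDiffAt ℝ 2 w s
  eq_of_ne_zero : w s ≠ 0 →
    deriv (deriv w) s = deriv w s ^ 2 / w s - deriv w s / s - 2 * ℓ * (w s ^ 2 / s)
      + (2 * ℓ - 2) * (1 / s) + w s ^ 3 - 1 / w s
  mul_eq :
    w s * deriv (deriv w) s = deriv w s ^ 2 - w s * deriv w s / s - 2 * ℓ * (w s ^ 3 / s)
      + (2 * ℓ - 2) * (w s / s) + w s ^ 4 - 1

end

/-! Isomonodromy. With `z = exp x`, system (1) reads `∂_x Y = A Y`, where `A` is entire and
`2πi`-periodic in `x`. Along solutions of (2) the zero-curvature equation `∂_s A = ∂_x Λ + [Λ, A]`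
holds for an explicit `Λ` with simple poles at `z = 0` and `z = ∞`
(`IsIsomSolution.hasDerivAt_logCoeff`). Therefore parallel transport for `∂_s - Λ` sends solutions
of one system of a leaf to solutions of another (`hasDerivAt_transport_of_flat`). It depends on `x`
only through `exp x`, so it commutes with the monodromy. Over a short time it is bounded by `exp (ε
(1/|z| + |z|))` with small `ε` (`IsIsomSolution.exists_gauge`). This is too weak to upset the
comparison of the two exponentials on a ray where one of them is recessive, so the transport carries
each canonical solution to a multiple of a canonical solution
(`IsGoodSectorAtZero.exists_gauge_bound`). The data are thus locally constant on a leaf, hence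
constant by connectedness. The residue matrices are `diag (-ℓ, 0)`, constant because `ℓ' = 0`.

Constancy has content only if the data exist, so canonical sectorial bases are constructed. A formal
normalizing series is found recursively (`formalSeries_spec`). Each of its columns is realized by a
solution recessive along a ray of the sector, obtained from an integral equation along half-lines
(`exists_solution_with_asymptotics`). Cauchy estimates turn its asymptotic expansion into smoothness
up to the vertex (`contDiffOn_of_asymptotics`).

Foliation. The integral equation of (2) is solved by the analytic implicit function theorem in a
space of continuous functions, so the local flow is analytic (`contDiffAt_isomFlow`), and its
inverse is a rectifying chart (`exists_isomChart`). Leaves are graphs over `s`, so a leaf meets a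
chart in at most one slice.

Painlevé III. The function `w` satisfies a Riccati equation with the additional term `2 a² / s²`;
differentiating it and eliminating `a²` gives the claim. A zero of `χ` is simple, since there `χ' =
a / (2 s) ≠ 0`. -/

noncomputable section

/-! ### Linear differential equations on an interval -/

section LinearODE

variable {E : Type*} [NormedAddCommGroup E] [NormedSpace ℝ E]

/-- The Picard iterates for the linear equation `u' = A t u`, `u 0 = x₀`. -/
def linearPicard (A : ℝ → E →L[ℝ] E) (x₀ : E) : ℕ → ℝ → E
  | 0 => fun _ => x₀
  | n + 1 => fun t => ∫ s in (0 : ℝ)..t, A s (linearPicard A x₀ n s)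

theorem continuous_linearPicard {A : ℝ → E →L[ℝ] E} (hA : Continuous A) (x₀ : E) (n : ℕ) :
    Continuous (linearPicard A x₀ n) := by
  induction n with
  | zero => exact continuous_const
  | succ n ih =>
    exact intervalIntegral.continuous_primitive
      (fun a b => (hA.clm_apply ih).intervalIntegrable a b) 0

/-- Each integration raises the power of `|t|` by one, which produces the factorial. -/
theorem norm_linearPicard_le {A : ℝ → E →L[ℝ] E} (hA : Continuous A) {C : ℝ}
    (hC : ∀ t, ‖A t‖ ≤ C) (x₀ : E) (n : ℕ) (t : ℝ) :
    ‖linearPicard A x₀ n t‖ ≤ ‖x₀‖ * ((C * |t|) ^ n / n.factorial) := by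
  have hC0 : 0 ≤ C := (norm_nonneg _).trans (hC 0)
  induction n generalizing t with
  | zero => simp [linearPicard]
  | succ n ih =>
    have hc := hA.clm_apply (continuous_linearPicard hA x₀ n)
    calc ‖linearPicard A x₀ (n + 1) t‖
        ≤ ∫ s in Set.uIoc 0 t, ‖A s (linearPicard A x₀ n s)‖ :=
          intervalIntegral.norm_integral_le_integral_norm_uIoc
      _ ≤ ∫ s in Set.uIoc 0 t, ‖x₀‖ * C ^ (n + 1) / n.factorial * |s - 0| ^ n := by
          refine MeasureTheory.setIntegral_mono_on ?_ ?_ measurableSet_uIoc fun s _ => ?_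
          · exact (intervalIntegrable_iff.1 (hc.norm.intervalIntegrable 0 t))
          · exact (intervalIntegrable_iff.1
              ((continuous_const.mul ((continuous_id.sub continuous_const).abs.pow n)).intervalIntegrable 0 t))
          · calc ‖A s (linearPicard A x₀ n s)‖ ≤ ‖A s‖ * ‖linearPicard A x₀ n s‖ :=
                (A s).le_opNorm _
              _ ≤ C * (‖x₀‖ * ((C * |s|) ^ n / n.factorial)) := by
                gcongr
                · exact hC s
                · exact ih s
              _ = _ := by rw [sub_zero, mul_pow, pow_succ]; ring
      _ = ‖x₀‖ * C ^ (n + 1) / n.factorial * (|t - 0| ^ (n + 1) / (n + 1)) := by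
          rw [MeasureTheory.integral_const_mul, integral_pow_abs_sub_uIoc]
      _ = _ := by
          rw [sub_zero, mul_pow, Nat.factorial_succ]; push_cast; field_simp

/-- The functions `linearPicard A x₀ n` are the successive terms of a Neumann series, and the
solution is their sum. The interval `(-2, 2)` only serves to contain `[0, 1]` in its interior. -/
theorem exists_linearODE_solution_of_bounded [CompleteSpace E] {A : ℝ → E →L[ℝ] E}
    (hA : Continuous A) {C : ℝ} (hC : ∀ t, ‖A t‖ ≤ C) (x₀ : E) :
    ∃ u : ℝ → E, u 0 = x₀ ∧ ∀ t ∈ Ioo (-2 : ℝ) 2, HasDerivAt u (A t (u t)) t := by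
  have hC0 : 0 ≤ C := (norm_nonneg _).trans (hC 0)
  set v := linearPicard A x₀
  have hb : ∀ n, ∀ t ∈ Ioo (-2 : ℝ) 2, ‖v n t‖ ≤ ‖x₀‖ * ((C * 2) ^ n / n.factorial) := by
    intro n t ht
    refine (norm_linearPicard_le hA hC x₀ n t).trans ?_
    have : |t| ≤ 2 := abs_le.2 ⟨ht.1.le, ht.2.le⟩
    gcongr
  have hs : Summable fun n : ℕ => ‖x₀‖ * ((C * 2) ^ n / (n.factorial : ℝ)) :=
    (Real.summable_pow_div_factorial (C * 2)).mul_left ‖x₀‖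
  have hv : ∀ t ∈ Ioo (-2 : ℝ) 2, Summable fun n => v n t := fun t ht =>
    Summable.of_norm_bounded hs fun n => hb n t ht
  refine ⟨fun t => x₀ + ∑' n, v (n + 1) t, ?_, fun t ht => ?_⟩
  · have : ∀ n, v (n + 1) 0 = 0 := fun n => by simp [v, linearPicard]
    simp [this]
  · have hd : HasDerivAt (fun t => ∑' n, v (n + 1) t) (∑' n, A t (v n t)) t := by
      refine hasDerivAt_tsum_of_isPreconnected (𝕜 := ℝ) (F := E)
        (g := fun n t => v (n + 1) t) (g' := fun n t => A t (v n t)) (hs.mul_left C) isOpen_Ioo isPreconnected_Ioo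
        (y₀ := 0) (fun n y _ => ?_) (fun n y hy => ?_) (by norm_num) ?_ ht
      · exact ((hA.clm_apply (continuous_linearPicard hA x₀ n)).integral_hasStrictDerivAt
          0 y).hasDerivAt
      · exact ((A y).le_opNorm _).trans (mul_le_mul (hC y) (hb n y hy) (norm_nonneg _) hC0)
      · have : ∀ n, v (n + 1) 0 = 0 := fun n => by simp [v, linearPicard]
        simp [this, summable_zero]
    convert hd.const_add x₀ using 1
    rw [← (A t).map_tsum (hv t ht), (hv t ht).tsum_eq_zero_add]
    rfl

theorem exists_linearODE_solution [CompleteSpace E] {A : ℝ → E →L[ℝ] E}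
    (hA : ContinuousOn A (Icc 0 1)) (x₀ : E) :
    ∃ u : ℝ → E, u 0 = x₀ ∧
      ∀ t ∈ Icc (0 : ℝ) 1, HasDerivWithinAt u (A t (u t)) (Icc 0 1) t := by
  obtain ⟨C, hC⟩ := isCompact_Icc.exists_bound_of_continuousOn hA
  -- Extending the coefficient by its end values makes it continuous and bounded on the whole line.
  have hc : Continuous (IccExtend zero_le_one ((Icc (0 : ℝ) 1).domRestrict A)) :=
    hA.domRestrict.Icc_extend'
  obtain ⟨u, hu0, hu⟩ := exists_linearODE_solution_of_bounded hc (C := C)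
    (fun t => hC _ (projIcc 0 1 zero_le_one t).2) x₀
  refine ⟨u, hu0, fun t ht => ?_⟩
  have := (hu t ⟨by linarith [ht.1], by linarith [ht.2]⟩).hasDerivWithinAt (s := Icc 0 1)
  rwa [IccExtend_of_mem _ _ ht] at this

theorem norm_le_gronwallBound_Icc {f f' : ℝ → E} {δ K ε : ℝ}
    (hf : ∀ t ∈ Icc (0 : ℝ) 1, HasDerivWithinAt f (f' t) (Icc 0 1) t) (h0 : ‖f 0‖ ≤ δ)
    (hb : ∀ t ∈ Icc (0 : ℝ) 1, ‖f' t‖ ≤ K * ‖f t‖ + ε) :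
    ∀ t ∈ Icc (0 : ℝ) 1, ‖f t‖ ≤ gronwallBound δ K ε t := by
  intro t ht
  have := norm_le_gronwallBound_of_norm_deriv_right_le (f := f) (f' := f') (a := 0) (b := 1)
    (fun t ht => (hf t ht).continuousWithinAt)
    (fun t ht => ((hf t (Ico_subset_Icc_self ht)).mono_of_mem_nhdsWithin
      (Icc_mem_nhdsGE_of_mem ht))) h0
    (fun t ht => hb t (Ico_subset_Icc_self ht)) t ht
  simpa using this

end LinearODE

/-! ### Flat connections and parallel transport -/

section FlatConnection

variable {𝔸 : Type*} [NormedRing 𝔸] [NormedAlgebra ℂ 𝔸] [CompleteSpace 𝔸]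

/-- With zero initial value the Grönwall bound is linear in the inhomogeneity; this is how the
factors `‖y - x‖` and `‖y - x‖ ^ 2` are extracted below. -/
theorem gronwallBound_zero_mul (K c ε t : ℝ) :
    gronwallBound 0 K (c * ε) t = c * gronwallBound 0 K ε t := by
  unfold gronwallBound
  split_ifs <;> ring

/-- Two Cauchy estimates: a bound on the disc of radius 2 controls `f'` on radius 1, and then `f''`
on radius 1/2. The constants depend on `B` only, so they are uniform over a family of functions. -/
theorem taylor_two_bound {f : ℂ → 𝔸} (hf : Differentiable ℂ f) {x : ℂ} {B : ℝ}
    (hB : ∀ y, ‖y - x‖ ≤ 2 → ‖f y‖ ≤ B) {y : ℂ} (hy : ‖y - x‖ ≤ 1 / 2) :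
    ‖deriv f x‖ ≤ B ∧ ‖f y - f x‖ ≤ B * ‖y - x‖ ∧
      ‖f y - f x - (y - x) • deriv f x‖ ≤ 2 * B * ‖y - x‖ ^ 2 := by
  have h1 : ∀ z, ‖z - x‖ ≤ 1 → ‖deriv f z‖ ≤ B := by
    intro z hz
    have := Complex.norm_deriv_le_of_forall_mem_sphere_norm_le (c := z) (R := 1) (C := B) (f := f)
      one_pos hf.diffContOnCl (fun w hw => hB w ?_)
    · simpa using this
    · rw [mem_sphere_iff_norm] at hw
      calc ‖w - x‖ = ‖(w - z) + (z - x)‖ := by congr 1; ring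
        _ ≤ ‖w - z‖ + ‖z - x‖ := norm_add_le _ _
        _ ≤ 2 := by linarith
  have hd : Differentiable ℂ (deriv f) := fun z => (hf.analyticAt z).deriv.differentiableAt
  have h2 : ∀ z, ‖z - x‖ ≤ 1 / 2 → ‖deriv (deriv f) z‖ ≤ 2 * B := by
    intro z hz
    have := Complex.norm_deriv_le_of_forall_mem_sphere_norm_le (c := z) (R := 1 / 2) (C := B)
      (f := deriv f) (by norm_num) hd.diffContOnCl (fun w hw => h1 w ?_)
    · linarith
    · rw [mem_sphere_iff_norm] at hw
      calc ‖w - x‖ = ‖(w - z) + (z - x)‖ := by congr 1; ring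
        _ ≤ ‖w - z‖ + ‖z - x‖ := norm_add_le _ _
        _ ≤ 1 := by linarith
  have hseg : ∀ z ∈ segment ℝ x y, ‖z - x‖ ≤ ‖y - x‖ := by
    rintro z ⟨a, b, ha, hb, hab, rfl⟩
    have : a • x + b • y - x = b • (y - x) := by
      rw [← eq_sub_iff_add_eq] at hab; subst hab; module
    rw [this, norm_smul, Real.norm_of_nonneg hb]
    exact mul_le_of_le_one_left (norm_nonneg _) (by linarith)
  refine ⟨h1 x (by simp), ?_, ?_⟩
  · exact (convex_segment x y).norm_image_sub_le_of_norm_deriv_le (𝕜 := ℂ)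
      (fun z _ => hf z) (fun z hz => h1 z ((hseg z hz).trans (by linarith)))
      (left_mem_segment ℝ x y) (right_mem_segment ℝ x y)
  · have h3 : ∀ z ∈ segment ℝ x y, ‖deriv f z - deriv f x‖ ≤ 2 * B * ‖y - x‖ := by
      intro z hz
      have := (convex_segment x y).norm_image_sub_le_of_norm_deriv_le (𝕜 := ℂ)
        (fun z _ => hd z) (fun z hz => h2 z ((hseg z hz).trans hy))
        (left_mem_segment ℝ x y) hz
      have hB0 : 0 ≤ B := (norm_nonneg _).trans (h1 x (by simp))
      exact this.trans (by gcongr; exact hseg z hz)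
    have := (convex_segment x y).norm_image_sub_le_of_norm_hasDerivWithin_le (𝕜 := ℂ)
      (f := fun z => f z - z • deriv f x) (f' := fun z => deriv f z - (1 : ℂ) • deriv f x)
      (fun z _ => ((hf z).hasDerivAt.sub
        ((hasDerivAt_id z).smul_const (deriv f x))).hasDerivWithinAt)
      (fun z hz => by simpa using h3 z hz)
      (left_mem_segment ℝ x y) (right_mem_segment ℝ x y)
    calc _ = ‖f y - y • deriv f x - (f x - x • deriv f x)‖ := by congr 1; module
      _ ≤ _ := this
      _ = _ := by ring

/-- A flat connection `∂_τ - U`, `∂_x - A`: the parallel transport `P τ x` along `[0, τ] × {x}`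
satisfies the equation in the transversal direction. -/
theorem hasDerivAt_transport_of_flat {U A : ℝ → ℂ → 𝔸} {P : ℂ → ℝ → 𝔸}
    (hUc : ContinuousOn (Function.uncurry U) (Icc 0 1 ×ˢ univ))
    (hU : ∀ τ ∈ Icc (0 : ℝ) 1, Differentiable ℂ (U τ))
    (hA : ∀ x, ∀ τ ∈ Icc (0 : ℝ) 1, HasDerivWithinAt (fun τ => A τ x)
      (deriv (U τ) x + U τ x * A τ x - A τ x * U τ x) (Icc 0 1) τ)
    (hP0 : ∀ x, P x 0 = 1)
    (hP : ∀ x, ∀ τ ∈ Icc (0 : ℝ) 1, HasDerivWithinAt (P x) (U τ x * P x τ) (Icc 0 1) τ)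
    (x : ℂ) {τ : ℝ} (hτ : τ ∈ Icc (0 : ℝ) 1) :
    HasDerivAt (fun y => P y τ) (A τ x * P x τ - P x τ * A 0 x) x := by
  obtain ⟨B, hB⟩ : ∃ B, ∀ τ ∈ Icc (0 : ℝ) 1, ∀ y, ‖y - x‖ ≤ 2 → ‖U τ y‖ ≤ B := by
    obtain ⟨B, hB⟩ := (isCompact_Icc.prod (isCompact_closedBall x 2)).exists_bound_of_continuousOn
      (hUc.mono (prod_mono_right (subset_univ _)))
    exact ⟨B, fun τ hτ y hy => hB (τ, y) ⟨hτ, by simpa [dist_eq_norm] using hy⟩⟩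
  have hB0 : 0 ≤ B := (norm_nonneg _).trans (hB 0 (by simp) x (by simp))
  set M : ℝ := gronwallBound ‖(1 : 𝔸)‖ B 0 1
  set G : ℝ := gronwallBound 0 B 1 1
  have hG0 : 0 ≤ G := by
    have := gronwallBound_mono (δ := 0) (K := B) (ε := 1) le_rfl zero_le_one hB0
      (zero_le_one (α := ℝ))
    simpa [gronwallBound_x0] using this
  have hM : ∀ y, ‖y - x‖ ≤ 2 → ∀ τ ∈ Icc (0 : ℝ) 1, ‖P y τ‖ ≤ M := by
    intro y hy τ hτ
    refine (norm_le_gronwallBound_Icc (hP y) (by rw [hP0]) (K := B) (ε := 0)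
      (fun t ht => ?_) τ hτ).trans
        (gronwallBound_mono (norm_nonneg _) le_rfl hB0 hτ.2)
    rw [add_zero]
    exact (norm_mul_le _ _).trans (by gcongr; exact hB t ht y hy)
  have hM0 : 0 ≤ M := (norm_nonneg _).trans (hM x (by simp) 0 (by simp))
  -- Lipschitz dependence on `x` is needed before differentiability: it makes the cross term in
  -- `hmain` quadratic.
  have hL : ∀ y, ‖y - x‖ ≤ 1 / 2 → ∀ τ ∈ Icc (0 : ℝ) 1,
      ‖P y τ - P x τ‖ ≤ B * ‖y - x‖ * M * G := by
    intro y hy τ hτ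
    have := norm_le_gronwallBound_Icc (f := fun τ => P y τ - P x τ) (δ := 0) (K := B)
      (ε := B * ‖y - x‖ * M * 1)
      (fun t ht => (hP y t ht).sub (hP x t ht)) (by simp [hP0]) (fun t ht => ?_) τ hτ
    · refine this.trans ?_
      rw [gronwallBound_zero_mul]
      gcongr
      exact gronwallBound_mono le_rfl zero_le_one hB0 hτ.2
    · have e : U t y * P y t - U t x * P x t
          = U t x * (P y t - P x t) + (U t y - U t x) * P y t := by noncomm_ring
      rw [e]
      refine (norm_add_le _ _).trans (add_le_add ((norm_mul_le _ _).trans ?_)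
        ((norm_mul_le _ _).trans ?_))
      · gcongr; exact hB t ht x (by simp)
      · rw [mul_one]
        gcongr
        · exact (taylor_two_bound (hU t ht) (hB t ht) hy).2.1
        · exact hM y (by linarith) t ht
  -- `D` is the candidate for the `x`-derivative of `P`. Flatness says that it solves the
  -- variational equation obtained by differentiating `P' = U P` in `x`, and it vanishes at `τ = 0`.
  set D : ℝ → 𝔸 := fun τ => A τ x * P x τ - P x τ * A 0 x
  have hD : ∀ τ ∈ Icc (0 : ℝ) 1, HasDerivWithinAt D
      (deriv (U τ) x * P x τ + U τ x * D τ) (Icc 0 1) τ := by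
    intro t ht
    have h := ((hA x t ht).mul (hP x t ht)).sub ((hP x t ht).mul_const (A 0 x))
    refine h.congr_deriv ?_
    simp only [D]
    noncomm_ring
  -- Grönwall applied to the first-order Taylor remainder of `P` in `x`, whose equation has an
  -- inhomogeneity of order `‖y - x‖ ^ 2`.
  have hmain : ∀ y, ‖y - x‖ ≤ 1 / 2 →
      ‖P y τ - P x τ - (y - x) • D τ‖ ≤ ‖y - x‖ ^ 2 * ((2 * B * M + B * (B * M * G)) * G) := by
    intro y hy
    have := norm_le_gronwallBound_Icc (f := fun τ => P y τ - P x τ - (y - x) • D τ) (δ := 0)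
      (K := B) (ε := ‖y - x‖ ^ 2 * (2 * B * M + B * (B * M * G)) * 1)
      (fun t ht => ((hP y t ht).sub (hP x t ht)).sub ((hD t ht).const_smul (y - x)))
      (by simp [hP0, D]) (fun t ht => ?_) τ hτ
    · refine this.trans ?_
      rw [gronwallBound_zero_mul, mul_assoc]
      gcongr
      exact gronwallBound_mono le_rfl zero_le_one hB0 hτ.2
    · have e : U t y * P y t - U t x * P x t - (y - x) • (deriv (U t) x * P x t + U t x * D t)
          = U t x * (P y t - P x t - (y - x) • D t)
            + ((U t y - U t x - (y - x) • deriv (U t) x) * P y t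
              + (y - x) • (deriv (U t) x * (P y t - P x t))) := by
        simp only [mul_sub, sub_mul, smul_add, smul_sub, mul_smul_comm, smul_mul_assoc]
        abel
      obtain ⟨hd1, -, hd2⟩ := taylor_two_bound (hU t ht) (hB t ht) hy
      rw [e, mul_one]
      refine (norm_add_le _ _).trans (add_le_add ((norm_mul_le _ _).trans ?_)
        ((norm_add_le _ _).trans ?_))
      · gcongr; exact hB t ht x (by simp)
      · calc _ ≤ 2 * B * ‖y - x‖ ^ 2 * M + ‖y - x‖ * (B * (B * ‖y - x‖ * M * G)) := by
              refine add_le_add ((norm_mul_le _ _).trans ?_) ?_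
              · gcongr
                exact hM y (by linarith) t ht
              · rw [norm_smul]
                gcongr
                exact (norm_mul_le _ _).trans (by gcongr; exact hL y hy t ht)
          _ = _ := by ring
  rw [hasDerivAt_iff_isLittleO]
  have hO : (fun y => P y τ - P x τ - (y - x) • D τ) =O[𝓝 x] fun y => ‖y - x‖ ^ 2 := by
    refine Asymptotics.IsBigO.of_bound ((2 * B * M + B * (B * M * G)) * G) ?_
    filter_upwards [Metric.closedBall_mem_nhds x (show (0 : ℝ) < 1 / 2 by norm_num)] with y hy
    rw [Metric.mem_closedBall, dist_eq_norm] at hy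
    rw [norm_pow, norm_norm, mul_comm]
    exact hmain y hy
  refine hO.trans_isLittleO ?_
  have : (fun y => ‖y - x‖ ^ 2) =o[𝓝 x] fun y => ‖y - x‖ ^ 1 :=
    (Asymptotics.isLittleO_pow_pow one_lt_two).comp_tendsto (by
      simpa using (continuous_norm.comp (continuous_id.sub continuous_const)).tendsto
        (x := x) (f := fun y => ‖y - x‖))
  simpa [Asymptotics.isLittleO_norm_right] using this

/-- Existence of the parallel transport, together with its inverse and a bound. -/
theorem exists_transport {U : ℝ → 𝔸} (hU : ContinuousOn U (Icc 0 1)) :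
    ∃ P Q : ℝ → 𝔸, P 0 = 1 ∧
      (∀ τ ∈ Icc (0 : ℝ) 1, HasDerivWithinAt P (U τ * P τ) (Icc 0 1) τ) ∧
      (∀ τ ∈ Icc (0 : ℝ) 1, Q τ * P τ = 1) ∧
      ∀ K, (∀ τ ∈ Icc (0 : ℝ) 1, ‖U τ‖ ≤ K) → ∀ τ ∈ Icc (0 : ℝ) 1,
        ‖P τ‖ ≤ ‖(1 : 𝔸)‖ * Real.exp (K * τ) := by
  let L : 𝔸 →L[ℝ] 𝔸 →L[ℝ] 𝔸 := ContinuousLinearMap.mul ℝ 𝔸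
  obtain ⟨P, hP0, hP⟩ := exists_linearODE_solution (A := fun τ => L (U τ))
    (L.continuous.comp_continuousOn hU) (1 : 𝔸)
  obtain ⟨Q, hQ0, hQ⟩ := exists_linearODE_solution (A := fun τ => L.flip (-(U τ)))
    (L.flip.continuous.comp_continuousOn hU.neg) (1 : 𝔸)
  have hP' : ∀ τ ∈ Icc (0 : ℝ) 1, HasDerivWithinAt P (U τ * P τ) (Icc 0 1) τ := hP
  have hQ' : ∀ τ ∈ Icc (0 : ℝ) 1, HasDerivWithinAt Q (Q τ * -U τ) (Icc 0 1) τ := hQ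
  refine ⟨P, Q, hP0, hP', fun τ hτ => ?_, fun K hK τ hτ => ?_⟩
  -- Since `Q' = -Q U` and `P' = U P`, the product `Q P` is constant.
  · have hd : ∀ t ∈ Icc (0 : ℝ) 1,
        HasDerivWithinAt (fun t => Q t * P t - 1) 0 (Icc 0 1) t := by
      intro t ht
      refine (((hQ' t ht).mul (hP' t ht)).sub_const 1).congr_deriv ?_
      noncomm_ring
    have := norm_le_gronwallBound_Icc hd (δ := 0) (K := 0) (ε := 0) (by simp [hP0, hQ0])
      (by simp) τ hτ
    rw [gronwallBound_ε0_δ0, norm_le_zero_iff, sub_eq_zero] at this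
    exact this
  · have := norm_le_gronwallBound_Icc hP' (δ := ‖(1 : 𝔸)‖) (K := K) (ε := 0) (by rw [hP0])
      (fun t ht => by
        rw [add_zero]
        exact (norm_mul_le _ _).trans (by gcongr; exact hK t ht)) τ hτ
    rwa [gronwallBound_ε0] at this

/-- A linear differential equation with entire coefficients has an entire fundamental solution. -/
theorem exists_entire_fundamental {M : ℂ → 𝔸} (hM : Differentiable ℂ M) :
    ∃ Φ Ψ : ℂ → 𝔸, Φ 0 = 1 ∧ (∀ x, HasDerivAt Φ (M x * Φ x) x) ∧ ∀ x, Ψ x * Φ x = 1 := by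
  -- The equation is integrated along the segments `τ ↦ τ x`. The pullback of `M dx` under `(τ, x) ↦
  -- τ x` is a flat connection with components `x M(τ x)` and `τ M(τ x)`; the latter vanishes at `τ
  -- = 0` and equals `M x` at `τ = 1`.
  have hc : Continuous fun p : ℝ × ℂ => p.2 • M (p.1 * p.2) :=
    continuous_snd.smul (hM.continuous.comp (by fun_prop))
  choose P Q hP0 hP hQP hPb using fun x : ℂ =>
    exists_transport (U := fun τ : ℝ => x • M (τ * x))
      ((hc.comp (by fun_prop : Continuous fun τ : ℝ => (τ, x))).continuousOn)
  have h1 : (1 : ℝ) ∈ Icc (0 : ℝ) 1 := by simp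
  have hder : ∀ (τ : ℝ) (x : ℂ), HasDerivAt (fun y : ℂ => M (τ * y)) ((τ : ℂ) • deriv M (τ * x)) x := by
    intro τ x
    have := (hM (τ * x)).hasDerivAt.scomp x ((hasDerivAt_id x).const_mul (τ : ℂ))
    exact this.congr_deriv (by rw [mul_one])
  refine ⟨fun x => P x 1, fun x => Q x 1, ?_, fun x => ?_, fun x => hQP x 1 h1⟩
  · have := norm_le_gronwallBound_Icc (f := fun τ => P 0 τ - 1) (f' := fun τ => 0) (δ := 0) (K := 0)
      (ε := 0) (fun t ht => by simpa using (hP 0 t ht).sub_const 1) (by simp [hP0]) (by simp) 1 h1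
    rw [gronwallBound_ε0_δ0, norm_le_zero_iff, sub_eq_zero] at this
    exact this
  · have := hasDerivAt_transport_of_flat (U := fun τ x => x • M (τ * x))
      (A := fun τ x => (τ : ℂ) • M (τ * x)) (P := P) hc.continuousOn
      (fun τ _ x => (differentiableAt_id.smul (hder τ x).differentiableAt)) (fun x τ _ => ?_)
      hP0 hP x h1
    · simpa using this
    · have e1 : HasDerivAt (fun y : ℂ => y • M (τ * y))
          (x • ((τ : ℂ) • deriv M (τ * x)) + (1 : ℂ) • M (τ * x)) x :=
        (hasDerivAt_id x).smul (hder τ x)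
      have e2 : HasDerivAt (fun τ : ℝ => M (τ * x)) (x • deriv M (τ * x)) τ := by
        have h3 : HasDerivAt (fun τ : ℝ => (τ : ℂ) * x) x τ := by
          simpa using (Complex.ofRealCLM.hasDerivAt (x := τ)).mul_const x
        exact (hM (τ * x)).hasDerivAt.scomp τ h3
      have e3 : HasDerivAt (fun τ : ℝ => (τ : ℂ) • M (τ * x))
          ((τ : ℂ) • (x • deriv M (τ * x)) + (1 : ℂ) • M (τ * x)) τ :=
        (Complex.ofRealCLM.hasDerivAt (x := τ)).smul e2
      refine (e3.congr_deriv ?_).hasDerivWithinAt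
      rw [e1.deriv]
      simp only [smul_mul_smul_comm, mul_comm (τ : ℂ) x, add_sub_cancel_right, smul_smul]

end FlatConnection

/-! ### Integrals along half-lines in a sectorial domain -/

section HalfLineIntegral

open MeasureTheory

/-- For `0 ≤ κ < 1` the superlevel sets of this function are sectorial neighborhoods of infinity
that are invariant under translations by nonnegative numbers. -/
def sectorGauge (κ : ℝ) (t : ℂ) : ℝ := t.re + κ * ‖t‖

theorem continuous_sectorGauge (κ : ℝ) : Continuous (sectorGauge κ) := by
  unfold sectorGauge; fun_prop

theorem isOpen_sectorGauge (κ T : ℝ) : IsOpen {t | T < sectorGauge κ t} :=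
  isOpen_lt continuous_const (continuous_sectorGauge κ)

/-- Translation by `σ` adds `σ` to the real part and lowers the norm by at most `σ`. The growth rate
`1 - κ > 0` is what makes the half-line integrals converge. -/
theorem sectorGauge_add {κ : ℝ} (h0 : 0 ≤ κ) (t : ℂ) {σ : ℝ} (hσ : 0 ≤ σ) :
    sectorGauge κ t + (1 - κ) * σ ≤ sectorGauge κ (t + σ) := by
  have h : ‖t‖ ≤ ‖t + σ‖ + σ := by
    have := norm_sub_le (t + σ) (σ : ℂ)
    rwa [add_sub_cancel_right, Complex.norm_real, Real.norm_of_nonneg hσ] at this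
  simp only [sectorGauge, Complex.add_re, Complex.ofReal_re]
  nlinarith

theorem sectorGauge_le {κ : ℝ} (h1 : κ < 1) (t : ℂ) : sectorGauge κ t ≤ 2 * ‖t‖ := by
  have := Complex.re_le_norm t
  unfold sectorGauge
  nlinarith [norm_nonneg t]

/-- The factor `1 / m` is the source of contraction: for decay of high order `m` the half-line
integral has small norm. -/
theorem integral_inv_pow_Ioi {c g : ℝ} (hc : 0 < c) (hg : 0 < g) {m : ℕ} (hm : 1 ≤ m) :
    IntegrableOn (fun σ : ℝ => 1 / (g + c * σ) ^ (m + 1)) (Ioi 0) ∧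
      ∫ σ in Ioi (0 : ℝ), 1 / (g + c * σ) ^ (m + 1) = 1 / (c * m * g ^ m) := by
  have hm' : (0 : ℝ) < m := by exact_mod_cast hm
  have hpos : ∀ σ ∈ Ici (0 : ℝ), 0 < g + c * σ := fun σ hσ => by
    have : 0 ≤ c * σ := mul_nonneg hc.le hσ
    linarith
  have hd : ∀ σ ∈ Ici (0 : ℝ), HasDerivAt (fun σ => -(1 / (c * m)) * ((g + c * σ) ^ m)⁻¹)
      (1 / (g + c * σ) ^ (m + 1)) σ := by
    intro σ hσ
    have hp := hpos σ hσ
    have h1 : HasDerivAt (fun σ => g + c * σ) c σ := by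
      simpa using ((hasDerivAt_id σ).const_mul c).const_add g
    have h2 := ((h1.pow m).inv (pow_ne_zero _ hp.ne')).const_mul (-(1 / (c * m)))
    refine h2.congr_deriv ?_
    obtain ⟨k, rfl⟩ : ∃ k, m = k + 1 := ⟨m - 1, by omega⟩
    simp only [Pi.pow_apply, Nat.add_sub_cancel]
    push_cast at hm' ⊢
    field_simp
    ring
  have ht : Tendsto (fun σ => -(1 / (c * m)) * ((g + c * σ) ^ m)⁻¹) atTop (𝓝 0) := by
    have h1 : Tendsto (fun σ : ℝ => (g + c * σ) ^ m) atTop atTop :=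
      (tendsto_pow_atTop (by omega)).comp
        (tendsto_atTop_add_const_left _ _ (tendsto_id.const_mul_atTop hc))
    simpa using (h1.inv_tendsto_atTop).const_mul (-(1 / (c * m)))
  have hi := integrableOn_Ioi_deriv_of_nonneg' hd
    (fun σ hσ => (one_div_pos.2 (pow_pos (hpos σ (mem_Ici.2 (le_of_lt hσ))) _)).le) ht
  refine ⟨hi, ?_⟩
  rw [integral_Ioi_of_hasDerivAt_of_tendsto' hd hi ht]
  simp
  ring

variable {κ T : ℝ}

theorem norm_exp_mul_le_one {μ : ℂ} (hμ : μ.re ≤ 0) {σ : ℝ} (hσ : 0 ≤ σ) :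
    ‖Complex.exp (μ * σ)‖ ≤ 1 := by
  rw [Complex.norm_exp, Real.exp_le_one_iff]
  simpa using mul_nonpos_of_nonpos_of_nonneg hμ hσ

theorem norm_translate_le (h0 : 0 ≤ κ) (h1 : κ < 1) (hT : 0 < T) {v : ℂ → ℂ} {C : ℝ} {k : ℕ}
    (hv : ∀ t, T < sectorGauge κ t → ‖v t‖ ≤ C / sectorGauge κ t ^ k)
    {t : ℂ} {g : ℝ} (hg : T ≤ g) (ht : g < sectorGauge κ t) {σ : ℝ} (hσ : 0 ≤ σ) :
    ‖v (t + σ)‖ ≤ C * (1 / (g + (1 - κ) * σ) ^ k) := by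
  have h2 := sectorGauge_add h0 t hσ
  have h3 : 0 ≤ (1 - κ) * σ := mul_nonneg (by linarith) hσ
  have hgt : T < sectorGauge κ (t + σ) := by linarith
  have hC : 0 ≤ C := by
    have := (norm_nonneg _).trans (hv _ hgt)
    by_contra h
    have : C / sectorGauge κ (t + σ) ^ k < 0 :=
      div_neg_of_neg_of_pos (by linarith) (pow_pos (by linarith) _)
    linarith
  refine (hv _ hgt).trans ?_
  rw [div_eq_mul_one_div]
  have hp : 0 < g + (1 - κ) * σ := by linarith
  gcongr
  linarith

theorem integrableOn_exp_mul_translate (h0 : 0 ≤ κ) (h1 : κ < 1) (hT : 0 < T) {μ : ℂ}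
    (hμ : μ.re ≤ 0) {v : ℂ → ℂ} (hvc : ContinuousOn v {t | T < sectorGauge κ t}) {C : ℝ} {m : ℕ}
    (hm : 1 ≤ m) (hv : ∀ t, T < sectorGauge κ t → ‖v t‖ ≤ C / sectorGauge κ t ^ (m + 1))
    {t : ℂ} (ht : T < sectorGauge κ t) :
    IntegrableOn (fun σ : ℝ => Complex.exp (μ * σ) * v (t + σ)) (Ioi 0) := by
  refine Integrable.mono' ((integral_inv_pow_Ioi (c := 1 - κ) (by linarith) hT hm).1.const_mul C)
    (ContinuousOn.aestronglyMeasurable ?_ measurableSet_Ioi) ?_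
  · refine ContinuousOn.mul (by fun_prop) (hvc.comp (by fun_prop) fun σ hσ => ?_)
    have := sectorGauge_add h0 t (le_of_lt hσ)
    have h3 : 0 ≤ (1 - κ) * σ := mul_nonneg (by linarith) (le_of_lt hσ)
    exact lt_of_lt_of_le (by linarith) this
  · refine (ae_restrict_mem measurableSet_Ioi).mono fun σ hσ => ?_
    rw [norm_mul]
    calc _ ≤ 1 * ‖v (t + σ)‖ := by
          gcongr; exact norm_exp_mul_le_one hμ (le_of_lt hσ)
      _ ≤ _ := by
        rw [one_mul]
        exact norm_translate_le h0 h1 hT hv le_rfl ht (le_of_lt hσ)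

theorem norm_integral_exp_mul_translate_le (h0 : 0 ≤ κ) (h1 : κ < 1) (hT : 0 < T) {μ : ℂ}
    (hμ : μ.re ≤ 0) {v : ℂ → ℂ} {C : ℝ} {m : ℕ} (hm : 1 ≤ m)
    (hv : ∀ t, T < sectorGauge κ t → ‖v t‖ ≤ C / sectorGauge κ t ^ (m + 1))
    {t : ℂ} (ht : T < sectorGauge κ t) :
    ‖∫ σ in Ioi (0 : ℝ), Complex.exp (μ * σ) * v (t + σ)‖ ≤
      C / ((1 - κ) * m) / sectorGauge κ t ^ m := by
  have hκ : 0 < 1 - κ := by linarith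
  have hg : 0 < sectorGauge κ t := hT.trans ht
  obtain ⟨hi, he⟩ := integral_inv_pow_Ioi hκ hg hm
  have hmain : ∀ σ ∈ Ioi (0 : ℝ), ‖Complex.exp (μ * σ) * v (t + σ)‖
      ≤ C * (1 / (sectorGauge κ t + (1 - κ) * σ) ^ (m + 1)) := by
    intro σ hσ
    have h2 := sectorGauge_add h0 t (le_of_lt hσ)
    have h3 : 0 < (1 - κ) * σ := mul_pos (by linarith) hσ
    have hgt : T < sectorGauge κ (t + σ) := by linarith
    have hv' := hv _ hgt
    have hC : 0 ≤ C := by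
      by_contra h
      have : C / sectorGauge κ (t + σ) ^ (m + 1) < 0 :=
        div_neg_of_neg_of_pos (by linarith) (pow_pos (by linarith) _)
      linarith [norm_nonneg (v (t + σ))]
    rw [norm_mul]
    calc _ ≤ 1 * ‖v (t + σ)‖ := by
          gcongr; exact norm_exp_mul_le_one hμ (le_of_lt hσ)
      _ ≤ C / sectorGauge κ (t + σ) ^ (m + 1) := by rwa [one_mul]
      _ ≤ _ := by
        rw [div_eq_mul_one_div]
        have hp : 0 < sectorGauge κ t + (1 - κ) * σ := by linarith
        gcongr
  calc _ ≤ ∫ σ in Ioi (0 : ℝ), C * (1 / (sectorGauge κ t + (1 - κ) * σ) ^ (m + 1)) :=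
        norm_integral_le_of_norm_le (hi.const_mul C)
          ((ae_restrict_mem measurableSet_Ioi).mono hmain)
    _ = _ := by
      rw [integral_const_mul, he]
      field_simp

theorem tendsto_exp_mul_translate (h0 : 0 ≤ κ) (h1 : κ < 1) (hT : 0 < T) {μ : ℂ}
    (hμ : μ.re ≤ 0) {v : ℂ → ℂ} {C : ℝ} {m : ℕ} (hm : 1 ≤ m)
    (hv : ∀ t, T < sectorGauge κ t → ‖v t‖ ≤ C / sectorGauge κ t ^ m)
    {t : ℂ} (ht : T < sectorGauge κ t) :
    Tendsto (fun σ : ℝ => Complex.exp (μ * σ) * v (t + σ)) atTop (𝓝 0) := by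
  have h1 : Tendsto (fun σ : ℝ => (T + (1 - κ) * σ) ^ m) atTop atTop :=
    (tendsto_pow_atTop (by omega)).comp
      (tendsto_atTop_add_const_left _ _ (tendsto_id.const_mul_atTop (by linarith)))
  have h2 : Tendsto (fun σ : ℝ => C * (1 / (T + (1 - κ) * σ) ^ m)) atTop (𝓝 0) := by
    simpa using h1.inv_tendsto_atTop.const_mul C
  refine squeeze_zero_norm' ?_ h2
  filter_upwards [eventually_ge_atTop 0] with σ hσ
  rw [norm_mul]
  calc _ ≤ 1 * ‖v (t + σ)‖ := by gcongr; exact norm_exp_mul_le_one hμ hσ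
    _ ≤ _ := by
      rw [one_mul]
      exact norm_translate_le h0 ‹_› hT hv le_rfl ht hσ

theorem hasDerivAt_ofReal_translate {v : ℂ → ℂ} {v' t : ℂ} {σ : ℝ}
    (h : HasDerivAt v v' (t + σ)) : HasDerivAt (fun σ : ℝ => v (t + σ)) v' σ :=
  (h.comp_const_add t σ).comp_ofReal

theorem hasDerivAt_exp_mul_ofReal (μ : ℂ) (σ : ℝ) :
    HasDerivAt (fun σ : ℝ => Complex.exp (μ * σ)) (Complex.exp (μ * σ) * μ) σ := by
  have := ((hasDerivAt_id (σ : ℂ)).const_mul μ).cexp.comp_ofReal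
  simpa using this

/-- A Cauchy estimate on discs of radius `ρ / 4` dominates `v'` and allows differentiation under the
integral. Integration by parts in `σ` then moves the derivative to the exponential and leaves the
boundary term `-v t`. -/
theorem hasDerivAt_integral_exp_mul_translate (h0 : 0 ≤ κ) (h1 : κ < 1) (hT : 0 < T) {μ : ℂ}
    (hμ : μ.re ≤ 0) {v : ℂ → ℂ} (hvd : DifferentiableOn ℂ v {t | T < sectorGauge κ t}) {C : ℝ}
    {m : ℕ} (hm : 1 ≤ m)
    (hv : ∀ t, T < sectorGauge κ t → ‖v t‖ ≤ C / sectorGauge κ t ^ (m + 1))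
    {t : ℂ} (ht : T < sectorGauge κ t) :
    HasDerivAt (fun t => ∫ σ in Ioi (0 : ℝ), Complex.exp (μ * σ) * v (t + σ))
      (-μ * (∫ σ in Ioi (0 : ℝ), Complex.exp (μ * σ) * v (t + σ)) - v t) t := by
  have hD := isOpen_sectorGauge κ T
  have hadd : ∀ {t : ℂ} {σ : ℝ}, T < sectorGauge κ t → 0 ≤ σ → T < sectorGauge κ (t + σ) := by
    intro t σ ht hσ
    have := sectorGauge_add h0 t hσ
    have h3 : 0 ≤ (1 - κ) * σ := mul_nonneg (by linarith) hσ
    linarith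
  obtain ⟨ρ, hρ, hball⟩ := Metric.isOpen_iff.1 hD t ht
  have hmem : ∀ x ∈ Metric.ball t (ρ / 2), ∀ y ∈ Metric.closedBall x (ρ / 4),
      T < sectorGauge κ y := by
    intro x hx y hy
    refine hball (Metric.mem_ball.2 ?_)
    have := dist_triangle y x t
    rw [Metric.mem_ball] at hx
    rw [Metric.mem_closedBall] at hy
    linarith
  have hmem0 : ∀ x ∈ Metric.ball t (ρ / 2), T < sectorGauge κ x := fun x hx =>
    hmem x hx x (Metric.mem_closedBall_self (by linarith))
  have hda : ∀ x, T < sectorGauge κ x → HasDerivAt v (deriv v x) x := fun x hx =>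
    (hvd.differentiableAt (hD.mem_nhds hx)).hasDerivAt
  have hvc := hvd.continuousOn
  have hdc : ContinuousOn (deriv v) {t | T < sectorGauge κ t} := (hvd.deriv hD).continuousOn
  have hC2 : IntegrableOn (fun σ : ℝ => (C * (1 / (T + (1 - κ) * σ) ^ (m + 1))) / (ρ / 4))
      (Ioi 0) :=
    ((integral_inv_pow_Ioi (by linarith) hT hm).1.const_mul C).div_const _
  have hmain := hasDerivAt_integral_of_dominated_loc_of_deriv_le
    (μ := volume.restrict (Ioi (0 : ℝ))) (𝕜 := ℂ)
    (F := fun t σ => Complex.exp (μ * σ) * v (t + (σ : ℝ)))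
    (F' := fun t σ => Complex.exp (μ * σ) * deriv v (t + (σ : ℝ))) (x₀ := t)
    (bound := fun σ => (C * (1 / (T + (1 - κ) * σ) ^ (m + 1))) / (ρ / 4))
    (Metric.ball_mem_nhds t (half_pos hρ)) ?_
    (integrableOn_exp_mul_translate h0 h1 hT hμ hvc hm hv ht) ?_ ?_ hC2 ?_
  · obtain ⟨hi', hder⟩ := hmain
    refine hder.congr_deriv ?_
    have hi := integrableOn_exp_mul_translate h0 h1 hT hμ hvc hm hv ht
    have hF : ∀ σ ∈ Ici (0 : ℝ), HasDerivAt (fun σ : ℝ => Complex.exp (μ * σ) * v (t + σ))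
        (μ * (Complex.exp (μ * σ) * v (t + σ)) + Complex.exp (μ * σ) * deriv v (t + σ)) σ := by
      intro σ hσ
      have hv1 := hasDerivAt_ofReal_translate (hda _ (hadd ht hσ))
      refine ((hasDerivAt_exp_mul_ofReal μ σ).mul hv1).congr_deriv ?_
      ring
    have := integral_Ioi_of_hasDerivAt_of_tendsto' hF ((hi.const_mul μ).add hi')
      (tendsto_exp_mul_translate h0 h1 hT hμ (by omega) hv ht)
    rw [integral_add (hi.const_mul μ) hi', integral_const_mul] at this
    simp only [Complex.ofReal_zero, mul_zero, Complex.exp_zero, one_mul, add_zero, zero_sub] at this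
    linear_combination this
  · filter_upwards [hD.mem_nhds ht] with x hx
    exact (integrableOn_exp_mul_translate h0 h1 hT hμ hvc hm hv hx).aestronglyMeasurable
  · refine ContinuousOn.aestronglyMeasurable ?_ measurableSet_Ioi
    exact ContinuousOn.mul (by fun_prop) (hdc.comp (by fun_prop) fun σ hσ => hadd ht (le_of_lt hσ))
  · refine (ae_restrict_mem measurableSet_Ioi).mono fun σ hσ x hx => ?_
    rw [norm_mul]
    calc _ ≤ 1 * ‖deriv v (x + σ)‖ := by
          gcongr; exact norm_exp_mul_le_one hμ (le_of_lt hσ)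
      _ ≤ _ := by
        rw [one_mul]
        have hsub : ∀ y ∈ Metric.closedBall (x + (σ : ℂ)) (ρ / 4), T < sectorGauge κ y ∧
            ‖v y‖ ≤ C * (1 / (T + (1 - κ) * σ) ^ (m + 1)) := by
          intro y hy
          have hy' : T < sectorGauge κ (y - σ) := hmem x hx _ (by
            rw [Metric.mem_closedBall, dist_eq_norm] at hy ⊢
            rwa [show y - σ - x = y - (x + σ) by ring])
          have e : y = (y - σ) + σ := by ring
          refine ⟨e ▸ hadd hy' (le_of_lt hσ), ?_⟩
          conv_lhs => rw [e]
          exact norm_translate_le h0 h1 hT hv le_rfl hy' (le_of_lt hσ)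
        refine Complex.norm_deriv_le_of_forall_mem_sphere_norm_le (by linarith) ?_
          fun y hy => (hsub y (Metric.sphere_subset_closedBall hy)).2
        refine DifferentiableOn.diffContOnCl (hvd.mono fun y hy => ?_)
        exact (hsub y (Metric.closure_ball_subset_closedBall hy)).1
  · refine (ae_restrict_mem measurableSet_Ioi).mono fun σ hσ x hx => ?_
    exact ((hda _ (hadd (hmem0 x hx) (le_of_lt hσ))).comp_add_const x σ).const_mul _

/-- A decaying solution of `r' = -μ r - v` is given by the integral along a half-line. -/
theorem eq_integral_exp_mul_translate (h0 : 0 ≤ κ) (h1 : κ < 1) (hT : 0 < T) {μ : ℂ}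
    (hμ : μ.re ≤ 0) {r v : ℂ → ℂ} (hvc : ContinuousOn v {t | T < sectorGauge κ t}) {C C' : ℝ}
    {m : ℕ} (hm : 1 ≤ m)
    (hv : ∀ t, T < sectorGauge κ t → ‖v t‖ ≤ C / sectorGauge κ t ^ (m + 1))
    (hr : ∀ t, T < sectorGauge κ t → ‖r t‖ ≤ C' / sectorGauge κ t ^ m)
    (hd : ∀ t, T < sectorGauge κ t → HasDerivAt r (-μ * r t - v t) t)
    {t : ℂ} (ht : T < sectorGauge κ t) :
    r t = ∫ σ in Ioi (0 : ℝ), Complex.exp (μ * σ) * v (t + σ) := by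
  have hi := integrableOn_exp_mul_translate h0 h1 hT hμ hvc hm hv ht
  have hF : ∀ σ ∈ Ici (0 : ℝ), HasDerivAt (fun σ : ℝ => Complex.exp (μ * σ) * r (t + σ))
      (-(Complex.exp (μ * σ) * v (t + σ))) σ := by
    intro σ hσ
    have hT' : T < sectorGauge κ (t + σ) := by
      have := sectorGauge_add h0 t hσ
      have h3 : 0 ≤ (1 - κ) * σ := mul_nonneg (by linarith) hσ
      linarith
    refine ((hasDerivAt_exp_mul_ofReal μ σ).mul
      (hasDerivAt_ofReal_translate (hd _ hT'))).congr_deriv ?_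
    ring
  have := integral_Ioi_of_hasDerivAt_of_tendsto' hF hi.neg
    (tendsto_exp_mul_translate h0 h1 hT hμ hm hr ht)
  rw [integral_neg] at this
  simp only [Complex.ofReal_zero, mul_zero, Complex.exp_zero, one_mul, add_zero, zero_sub] at this
  exact (neg_injective this).symm

end HalfLineIntegral

/-! ### Actual solutions with a prescribed asymptotic expansion -/

section DecayingSolutions

open MeasureTheory

variable {ι : Type*} [Fintype ι] {κ T : ℝ}

/-- The componentwise integrals of `exp (μ i σ) v i` along the half-lines `t + [0, ∞)`. -/
def halfLineOp (μ : ι → ℂ) (v : ℂ → ι → ℂ) (t : ℂ) : ι → ℂ :=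
  fun i => ∫ σ in Ioi (0 : ℝ), Complex.exp (μ i * σ) * v (t + σ) i

theorem hasDerivAt_halfLineOp (h0 : 0 ≤ κ) (h1 : κ < 1) (hT : 0 < T) {μ : ι → ℂ}
    (hμ : ∀ i, (μ i).re ≤ 0) {v : ℂ → ι → ℂ}
    (hvd : DifferentiableOn ℂ v {t | T < sectorGauge κ t}) {C : ℝ} {m : ℕ} (hm : 1 ≤ m)
    (hv : ∀ t, T < sectorGauge κ t → ‖v t‖ ≤ C / sectorGauge κ t ^ (m + 1))
    {t : ℂ} (ht : T < sectorGauge κ t) :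
    HasDerivAt (halfLineOp μ v) (-μ * halfLineOp μ v t - v t) t := by
  rw [hasDerivAt_pi]
  intro i
  exact hasDerivAt_integral_exp_mul_translate (v := fun t => v t i) h0 h1 hT (hμ i)
    (differentiableOn_pi.1 hvd i) hm (fun t ht => (norm_le_pi_norm _ i).trans (hv t ht)) ht

theorem norm_halfLineOp_le (h0 : 0 ≤ κ) (h1 : κ < 1) (hT : 0 < T) {μ : ι → ℂ}
    (hμ : ∀ i, (μ i).re ≤ 0) {v : ℂ → ι → ℂ} {C : ℝ} (hC : 0 ≤ C) {m : ℕ} (hm : 1 ≤ m)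
    (hv : ∀ t, T < sectorGauge κ t → ‖v t‖ ≤ C / sectorGauge κ t ^ (m + 1))
    {t : ℂ} (ht : T < sectorGauge κ t) :
    ‖halfLineOp μ v t‖ ≤ C / ((1 - κ) * m) / sectorGauge κ t ^ m := by
  have hg : 0 < sectorGauge κ t := hT.trans ht
  have hκ : 0 < 1 - κ := by linarith
  rw [pi_norm_le_iff_of_nonneg (by positivity)]
  intro i
  exact norm_integral_exp_mul_translate_le (v := fun t => v t i) h0 h1 hT (hμ i) hm
    (fun t ht => (norm_le_pi_norm _ i).trans (hv t ht)) ht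

theorem eq_halfLineOp (h0 : 0 ≤ κ) (h1 : κ < 1) (hT : 0 < T) {μ : ι → ℂ}
    (hμ : ∀ i, (μ i).re ≤ 0) {r v : ℂ → ι → ℂ}
    (hvc : ContinuousOn v {t | T < sectorGauge κ t}) {C C' : ℝ} {m : ℕ} (hm : 1 ≤ m)
    (hv : ∀ t, T < sectorGauge κ t → ‖v t‖ ≤ C / sectorGauge κ t ^ (m + 1))
    (hr : ∀ t, T < sectorGauge κ t → ‖r t‖ ≤ C' / sectorGauge κ t ^ m)
    (hd : ∀ t, T < sectorGauge κ t → HasDerivAt r (-μ * r t - v t) t)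
    {t : ℂ} (ht : T < sectorGauge κ t) : r t = halfLineOp μ v t := by
  ext i
  exact eq_integral_exp_mul_translate (r := fun t => r t i) (v := fun t => v t i) h0 h1 hT (hμ i)
    (continuousOn_pi.1 hvc i) hm (fun t ht => (norm_le_pi_norm _ i).trans (hv t ht))
    (fun t ht => (norm_le_pi_norm _ i).trans (hr t ht)) (fun t ht => hasDerivAt_pi.1 (hd t ht) i) ht

/-- A coefficient of size `b / sectorGauge` regains the power that `halfLineOp` loses, so their
composition preserves the order of decay and multiplies the constant by `b / ((1 - κ) m)`. -/
theorem norm_clm_apply_le_div_pow {B : ℂ → (ι → ℂ) →L[ℂ] (ι → ℂ)} {b : ℝ} (hT : 0 < T)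
    (hb : ∀ t, T < sectorGauge κ t → ‖B t‖ ≤ b / sectorGauge κ t) {u : ℂ → ι → ℂ} {C : ℝ} {m : ℕ}
    (hu : ∀ t, T < sectorGauge κ t → ‖u t‖ ≤ C / sectorGauge κ t ^ m)
    (t : ℂ) (ht : T < sectorGauge κ t) :
    ‖B t (u t)‖ ≤ b * C / sectorGauge κ t ^ (m + 1) := by
  have hg : 0 < sectorGauge κ t := hT.trans ht
  calc _ ≤ ‖B t‖ * ‖u t‖ := (B t).le_opNorm _
    _ ≤ b / sectorGauge κ t * (C / sectorGauge κ t ^ m) :=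
      mul_le_mul (hb t ht) (hu t ht) (norm_nonneg _) ((norm_nonneg _).trans (hb t ht))
    _ = _ := by rw [pow_succ]; field_simp

/-- Such an `r` is a fixed point of `r ↦ halfLineOp μ (B r)`, and by `hbm` each application halves
its bound. -/
theorem decaying_solution_eq_zero (h0 : 0 ≤ κ) (h1 : κ < 1) (hT : 0 < T) {μ : ι → ℂ}
    (hμ : ∀ i, (μ i).re ≤ 0) {B : ℂ → (ι → ℂ) →L[ℂ] (ι → ℂ)}
    (hB : ContinuousOn B {t | T < sectorGauge κ t}) {b : ℝ} (hb0 : 0 ≤ b)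
    (hb : ∀ t, T < sectorGauge κ t → ‖B t‖ ≤ b / sectorGauge κ t) {m : ℕ} (hm : 1 ≤ m)
    (hbm : b ≤ (1 - κ) * m / 2) {r : ℂ → ι → ℂ} {C : ℝ} (hC : 0 ≤ C)
    (hr : ∀ t, T < sectorGauge κ t → ‖r t‖ ≤ C / sectorGauge κ t ^ m)
    (hd : ∀ t, T < sectorGauge κ t → HasDerivAt r (-μ * r t - B t (r t)) t)
    {t : ℂ} (ht : T < sectorGauge κ t) : r t = 0 := by
  have hκ : 0 < (1 - κ) * m := mul_pos (by linarith) (by exact_mod_cast hm)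
  have hrc : ContinuousOn r {t | T < sectorGauge κ t} := fun t ht =>
    (hd t ht).continuousAt.continuousWithinAt
  have hall : ∀ n : ℕ, ∀ t, T < sectorGauge κ t → ‖r t‖ ≤ C / 2 ^ n / sectorGauge κ t ^ m := by
    intro n
    induction n with
    | zero => simpa using hr
    | succ n ih =>
      intro t ht
      have hg : 0 < sectorGauge κ t := hT.trans ht
      have hv := norm_clm_apply_le_div_pow hT hb ih
      rw [eq_halfLineOp h0 h1 hT hμ (hB.clm_apply hrc) hm hv ih hd ht]
      refine (norm_halfLineOp_le h0 h1 hT hμ (by positivity) hm hv ht).trans ?_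
      refine div_le_div_of_nonneg_right ?_ (by positivity)
      rw [div_le_iff₀ hκ, pow_succ]
      have : b * (C / 2 ^ n) ≤ (1 - κ) * m / 2 * (C / 2 ^ n) := by gcongr
      refine this.trans (le_of_eq ?_)
      field_simp
  have hlim : Tendsto (fun n : ℕ => C / 2 ^ n / sectorGauge κ t ^ m) atTop (𝓝 0) := by
    have : Tendsto (fun n : ℕ => C * (1 / 2 : ℝ) ^ n / sectorGauge κ t ^ m) atTop (𝓝 0) := by
      simpa using ((tendsto_pow_atTop_nhds_zero_of_lt_one (by norm_num : (0 : ℝ) ≤ 1 / 2)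
        (by norm_num)).const_mul C).div_const (sectorGauge κ t ^ m)
    refine this.congr fun n => ?_
    rw [one_div, inv_pow, div_eq_mul_inv C]
  exact norm_le_zero_iff.1 (ge_of_tendsto' hlim fun n => hall n t ht)

/-- The Neumann series for `r = halfLineOp μ (B r + φ)`: the sources are `v 0 = φ` and `v (n + 1) =
B (halfLineOp μ (v n))`, and `hbm` makes their bounds decrease geometrically with ratio 1/2. -/
theorem exists_decaying_solution (h0 : 0 ≤ κ) (h1 : κ < 1) (hT : 0 < T) {μ : ι → ℂ}
    (hμ : ∀ i, (μ i).re ≤ 0) {B : ℂ → (ι → ℂ) →L[ℂ] (ι → ℂ)}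
    (hB : DifferentiableOn ℂ B {t | T < sectorGauge κ t}) {b : ℝ}
    (hb : ∀ t, T < sectorGauge κ t → ‖B t‖ ≤ b / sectorGauge κ t) {m : ℕ} (hm : 1 ≤ m)
    (hbm : b ≤ (1 - κ) * m / 2) {φ : ℂ → ι → ℂ}
    (hφ : DifferentiableOn ℂ φ {t | T < sectorGauge κ t}) {C : ℝ} (hC : 0 ≤ C)
    (hφb : ∀ t, T < sectorGauge κ t → ‖φ t‖ ≤ C / sectorGauge κ t ^ (m + 1)) :
    ∃ r : ℂ → ι → ℂ, ∃ C', 0 ≤ C' ∧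
      (∀ t, T < sectorGauge κ t → ‖r t‖ ≤ C' / sectorGauge κ t ^ m) ∧
      ∀ t, T < sectorGauge κ t → HasDerivAt r (-μ * r t - (B t (r t) + φ t)) t := by
  have hD := isOpen_sectorGauge κ T
  have hκ : 0 < (1 - κ) * m := mul_pos (by linarith) (by exact_mod_cast hm)
  set C₀ := C / ((1 - κ) * m)
  have hC₀ : 0 ≤ C₀ := by positivity
  let v : ℕ → ℂ → ι → ℂ := fun n => Nat.rec φ (fun _ w t => B t (halfLineOp μ w t)) n
  have hv0 : v 0 = φ := rfl
  have hvs : ∀ n t, v (n + 1) t = B t (halfLineOp μ (v n) t) := fun n t => rfl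
  set u : ℕ → ℂ → ι → ℂ := fun n => halfLineOp μ (v n)
  have key : ∀ n : ℕ, DifferentiableOn ℂ (v n) {t | T < sectorGauge κ t} ∧
      ∀ t, T < sectorGauge κ t → ‖v n t‖ ≤ C / 2 ^ n / sectorGauge κ t ^ (m + 1) := by
    intro n
    induction n with
    | zero => simpa [hv0] using ⟨hφ, hφb⟩
    | succ n ih =>
      refine ⟨?_, fun t ht => ?_⟩
      · refine hB.clm_apply fun t ht => ?_
        exact (hasDerivAt_halfLineOp h0 h1 hT hμ ih.1 hm ih.2
          ht).differentiableAt.differentiableWithinAt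
      · have hg : 0 < sectorGauge κ t := hT.trans ht
        have := norm_clm_apply_le_div_pow hT hb
          (fun t ht => norm_halfLineOp_le h0 h1 hT hμ (by positivity) hm ih.2 ht) t ht
        refine this.trans ?_
        gcongr
        rw [mul_div_assoc', div_le_iff₀ hκ, pow_succ]
        have : b * (C / 2 ^ n) ≤ (1 - κ) * m / 2 * (C / 2 ^ n) := by gcongr
        refine this.trans (le_of_eq ?_)
        field_simp
  have hud : ∀ n t, T < sectorGauge κ t → HasDerivAt (u n) (-μ * u n t - v n t) t :=
    fun n t ht => hasDerivAt_halfLineOp h0 h1 hT hμ (key n).1 hm (key n).2 ht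
  have hub : ∀ n t, T < sectorGauge κ t → ‖u n t‖ ≤ C₀ / sectorGauge κ t ^ m * (1 / 2) ^ n := by
    intro n t ht
    refine (norm_halfLineOp_le h0 h1 hT hμ (by positivity) hm (key n).2 ht).trans (le_of_eq ?_)
    simp only [C₀, one_div, inv_pow]
    ring
  have hgeo : Summable fun n : ℕ => (1 / 2 : ℝ) ^ n := summable_geometric_two
  have hus : ∀ t, T < sectorGauge κ t → Summable fun n => u n t := fun t ht =>
    Summable.of_norm_bounded (hgeo.mul_left _) fun n => hub n t ht
  refine ⟨fun t => ∑' n, u n t, C₀ * 2, by positivity, fun t ht => ?_, fun t ht => ?_⟩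
  · have := tsum_of_norm_bounded (hgeo.hasSum.mul_left (C₀ / sectorGauge κ t ^ m))
      (fun n => hub n t ht)
    rw [tsum_geometric_two] at this
    refine this.trans (le_of_eq ?_)
    ring
  · obtain ⟨ρ, hρ, hball⟩ := Metric.isOpen_iff.1 hD t ht
    have hgpos : ∀ y, T < sectorGauge κ y → 0 < sectorGauge κ y := fun y hy => hT.trans hy
    have hder : HasDerivAt (fun t => ∑' n, u n t) (∑' n, (-μ * u n t - v n t)) t := by
      refine hasDerivAt_tsum_of_isPreconnected (𝕜 := ℂ) (F := ι → ℂ) (g := u)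
        (g' := fun n t => -μ * u n t - v n t) (y₀ := t)
        (u := fun n => (‖μ‖ * (C₀ / T ^ m) + C / T ^ (m + 1)) * (1 / 2) ^ n)
        (hgeo.mul_left _) Metric.isOpen_ball (convex_ball t ρ).isPreconnected
        (fun n y hy => hud n y (hball hy)) (fun n y hy => ?_) (Metric.mem_ball_self hρ)
        (hus t ht) (Metric.mem_ball_self hρ)
      have hy' := hball hy
      have h3 := hub n y hy'
      have h4 := (key n).2 y hy'
      have h5 := hgpos y hy'
      have hTy : T ≤ sectorGauge κ y := le_of_lt hy'
      calc ‖-μ * u n y - v n y‖ ≤ ‖-μ * u n y‖ + ‖v n y‖ := norm_sub_le _ _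
        _ ≤ ‖μ‖ * (C₀ / T ^ m * (1 / 2) ^ n) + C / 2 ^ n / T ^ (m + 1) := by
          refine add_le_add ((norm_mul_le _ _).trans ?_) (h4.trans ?_)
          · rw [norm_neg]
            gcongr
            refine h3.trans ?_
            gcongr
          · gcongr
        _ = _ := by simp only [one_div, inv_pow]; ring
    refine hder.congr_deriv ?_
    have e1 : HasSum (fun n => u n t) (∑' n, u n t) := (hus t ht).hasSum
    have e2 : HasSum (fun n => v n t) (B t (∑' n, u n t) + φ t) := by
      rw [← hasSum_nat_add_iff' 1]
      simpa [hv0] using (B t).hasSum e1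
    exact ((e1.mul_left (-μ)).sub e2).tsum_eq

/-- The truncation of a formal power series in `1 / t`. -/
def truncSeries (p : ℕ → ι → ℂ) (m : ℕ) (t : ℂ) : ι → ℂ :=
  ∑ k ∈ Finset.range (m + 1), (t⁻¹) ^ k • p k

/-- The recursion cancels all lower orders. The remaining defect has orders `m + 1` and `m + 2`,
which is the decay required for the source in `exists_decaying_solution`. -/
theorem hasDerivAt_truncSeries {μ : ι → ℂ} {R N : (ι → ℂ) →L[ℂ] (ι → ℂ)} {p : ℕ → ι → ℂ}
    (hp0 : μ * p 0 = 0) (hp1 : μ * p 1 + R (p 0) = 0)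
    (hp : ∀ m : ℕ, μ * p (m + 2) + R (p (m + 1)) + N (p m) = ((m : ℂ) + 1) • p (m + 1))
    (m : ℕ) {t : ℂ} (ht : t ≠ 0) :
    HasDerivAt (truncSeries p m)
      (-μ * truncSeries p m t - (t⁻¹ • R + (t⁻¹) ^ 2 • N) (truncSeries p m t)
        + ((t⁻¹) ^ (m + 2) • N (p m) - (t⁻¹) ^ (m + 1) • (μ * p (m + 1)))) t := by
  have hpow : ∀ k : ℕ, HasDerivAt (fun t : ℂ => (t⁻¹) ^ k) (-(k : ℂ) * (t⁻¹) ^ (k + 1)) t := by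
    intro k
    refine ((hasDerivAt_inv ht).pow k).congr_deriv ?_
    rcases k with _ | k
    · simp
    · simp only [Nat.add_sub_cancel, ← inv_pow]
      ring
  induction m with
  | zero =>
    have e : truncSeries p 0 = fun t => p 0 := by
      ext t; simp [truncSeries]
    rw [e]
    refine (hasDerivAt_const t (p 0)).congr_deriv ?_
    have h1 : μ * p 1 = -R (p 0) := eq_neg_of_add_eq_zero_left hp1
    simp only [neg_mul, hp0, neg_zero, zero_add, h1, zero_sub, add_apply,
      smul_apply]
    module
  | succ m ih =>
    have e : truncSeries p (m + 1) = fun t => truncSeries p m t + (t⁻¹) ^ (m + 1) • p (m + 1) := by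
      ext t; simp [truncSeries, Finset.sum_range_succ]
    rw [e]
    refine (ih.add ((hpow (m + 1)).smul_const (p (m + 1)))).congr_deriv ?_
    have h1 : μ * p (m + 2) = ((m : ℂ) + 1) • p (m + 1) - R (p (m + 1)) - N (p m) := by
      rw [← hp m]; abel
    simp only [map_add, map_smul, mul_add, mul_smul_comm, neg_mul, add_apply,
      smul_apply, h1]
    push_cast
    module

theorem norm_truncSeries_sub_le (p : ℕ → ι → ℂ) {m n : ℕ} (hmn : m ≤ n) :
    ∃ C, 0 ≤ C ∧ ∀ t : ℂ, 1 ≤ ‖t‖ →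
      ‖truncSeries p n t - truncSeries p m t‖ ≤ C / ‖t‖ ^ (m + 1) := by
  refine ⟨∑ k ∈ Finset.range (n + 1) \ Finset.range (m + 1), ‖p k‖,
    Finset.sum_nonneg fun _ _ => norm_nonneg _, fun t ht => ?_⟩
  have hsub : Finset.range (m + 1) ⊆ Finset.range (n + 1) :=
    Finset.range_subset_range.2 (by omega)
  rw [truncSeries, truncSeries, ← Finset.sum_sdiff hsub, add_sub_cancel_right, Finset.sum_div]
  refine norm_sum_le_of_le _ fun k hk => ?_
  have hk' : m + 1 ≤ k := by simpa using (Finset.mem_sdiff.1 hk).2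
  rw [norm_smul, norm_pow, norm_inv, inv_pow, inv_mul_eq_div]
  gcongr

/-- A formal solution `∑ p m / t ^ m` of `h' = -(diag μ + R / t + N / t ^ 2) h` with `Re μ i ≤ 0`
is the asymptotic expansion of an actual solution on a sectorial neighborhood of infinity. -/
theorem exists_solution_with_asymptotics (h0 : 0 ≤ κ) (h1 : κ < 1) {μ : ι → ℂ}
    (hμ : ∀ i, (μ i).re ≤ 0) {R N : (ι → ℂ) →L[ℂ] (ι → ℂ)} {p : ℕ → ι → ℂ}
    (hp0 : μ * p 0 = 0) (hp1 : μ * p 1 + R (p 0) = 0)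
    (hp : ∀ m : ℕ, μ * p (m + 2) + R (p (m + 1)) + N (p m) = ((m : ℂ) + 1) • p (m + 1)) :
    ∃ h : ℂ → ι → ℂ,
      (∀ t, 2 < sectorGauge κ t →
        HasDerivAt h (-μ * h t - (t⁻¹ • R + (t⁻¹) ^ 2 • N) (h t)) t) ∧
      ∃ m₀ : ℕ, ∀ m ≥ m₀, ∃ C, ∀ t, 2 < sectorGauge κ t →
        ‖h t - truncSeries p m t‖ ≤ C / sectorGauge κ t ^ m := by
  set B : ℂ → (ι → ℂ) →L[ℂ] (ι → ℂ) := fun t => t⁻¹ • R + (t⁻¹) ^ 2 • N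
  have hnorm : ∀ t, 2 < sectorGauge κ t → 1 < ‖t‖ := fun t ht => by
    linarith [sectorGauge_le h1 t]
  have hne : ∀ t, 2 < sectorGauge κ t → t ≠ 0 := fun t ht => by
    rw [← norm_pos_iff]; linarith [hnorm t ht]
  have hinv : DifferentiableOn ℂ (fun t : ℂ => t⁻¹) {t | 2 < sectorGauge κ t} := fun t ht =>
    (differentiableAt_inv (hne t ht)).differentiableWithinAt
  have hBd : DifferentiableOn ℂ B {t | 2 < sectorGauge κ t} :=
    (hinv.smul_const R).add ((hinv.pow 2).smul_const N)
  have hdiv : ∀ {C : ℝ}, 0 ≤ C → ∀ (k : ℕ) t, 2 < sectorGauge κ t →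
      C / ‖t‖ ^ k ≤ C * 2 ^ k / sectorGauge κ t ^ k := by
    intro C hC k t ht
    have hg : 0 < sectorGauge κ t := by linarith
    have hn := hnorm t ht
    rw [div_le_div_iff₀ (by positivity) (by positivity), mul_assoc, ← mul_pow]
    gcongr
    exact sectorGauge_le h1 t
  set b : ℝ := (‖R‖ + ‖N‖) * 2
  have hb0 : 0 ≤ b := by positivity
  have hb : ∀ t, 2 < sectorGauge κ t → ‖B t‖ ≤ b / sectorGauge κ t := by
    intro t ht
    have hn := hnorm t ht
    have hi : ‖t‖⁻¹ ≤ 1 := inv_le_one_of_one_le₀ hn.le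
    have := hdiv (show 0 ≤ ‖R‖ + ‖N‖ by positivity) 1 t ht
    simp only [pow_one] at this
    refine le_trans ?_ this
    calc ‖B t‖ ≤ ‖t‖⁻¹ * ‖R‖ + ‖t‖⁻¹ ^ 2 * ‖N‖ := by
          refine (norm_add_le _ _).trans (le_of_eq ?_)
          rw [norm_smul, norm_smul, norm_pow, norm_inv]
      _ ≤ ‖t‖⁻¹ * ‖R‖ + ‖t‖⁻¹ * ‖N‖ := by
        gcongr
        rw [sq]
        exact mul_le_of_le_one_left (by positivity) hi
      _ = _ := by rw [← mul_add, inv_mul_eq_div]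
  -- Beyond this order of decay the integral operator halves bounds.
  obtain ⟨m₀, hm₀⟩ := exists_nat_ge (b * 2 / (1 - κ))
  have hbm : ∀ m ≥ m₀ + 1, b ≤ (1 - κ) * m / 2 := by
    intro m hm
    have : b * 2 / (1 - κ) ≤ m := hm₀.trans (by exact_mod_cast (Nat.le_of_succ_le hm))
    rw [div_le_iff₀ (by linarith)] at this
    linarith
  have hex : ∀ m ≥ m₀ + 1, ∃ r : ℂ → ι → ℂ, ∃ C', 0 ≤ C' ∧
      (∀ t, 2 < sectorGauge κ t → ‖r t‖ ≤ C' / sectorGauge κ t ^ m) ∧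
      ∀ t, 2 < sectorGauge κ t → HasDerivAt r (-μ * r t - (B t (r t)
        + ((t⁻¹) ^ (m + 2) • N (p m) - (t⁻¹) ^ (m + 1) • (μ * p (m + 1))))) t := by
    intro m hm
    refine exists_decaying_solution h0 h1 two_pos hμ hBd hb (by omega) (hbm m hm)
      (((hinv.pow _).smul_const _).sub ((hinv.pow _).smul_const _))
      (C := (‖N (p m)‖ + ‖μ * p (m + 1)‖) * 2 ^ (m + 1)) (by positivity) fun t ht => ?_
    refine le_trans ?_ (hdiv (by positivity) (m + 1) t ht)
    have hn := hnorm t ht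
    calc _ ≤ ‖t‖⁻¹ ^ (m + 2) * ‖N (p m)‖ + ‖t‖⁻¹ ^ (m + 1) * ‖μ * p (m + 1)‖ := by
          refine (norm_sub_le _ _).trans (le_of_eq ?_)
          rw [norm_smul, norm_smul, norm_pow, norm_inv, norm_pow, norm_inv]
      _ ≤ ‖t‖⁻¹ ^ (m + 1) * ‖N (p m)‖ + ‖t‖⁻¹ ^ (m + 1) * ‖μ * p (m + 1)‖ := by
        gcongr ?_ * _ + _
        exact pow_le_pow_of_le_one (by positivity) (inv_le_one_of_one_le₀ hn.le) (by omega)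
      _ = _ := by rw [← mul_add, inv_pow, inv_mul_eq_div]
  have hsol : ∀ (m : ℕ) (r : ℂ → ι → ℂ), (∀ t, 2 < sectorGauge κ t →
        HasDerivAt r (-μ * r t - (B t (r t)
        + ((t⁻¹) ^ (m + 2) • N (p m) - (t⁻¹) ^ (m + 1) • (μ * p (m + 1))))) t) →
      ∀ t, 2 < sectorGauge κ t → HasDerivAt (fun t => truncSeries p m t + r t)
        (-μ * (truncSeries p m t + r t) - B t (truncSeries p m t + r t)) t := by
    intro m r hr t ht
    refine ((hasDerivAt_truncSeries hp0 hp1 hp m (hne t ht)).add (hr t ht)).congr_deriv ?_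
    simp only [map_add, mul_add, B]
    abel
  obtain ⟨r₀, C₀, hC₀, hr₀b, hr₀⟩ := hex (m₀ + 1) le_rfl
  refine ⟨fun t => truncSeries p (m₀ + 1) t + r₀ t, hsol _ _ hr₀, m₀ + 1, fun m hm => ?_⟩
  obtain ⟨r, C, hC, hrb, hr⟩ := hex m hm
  refine ⟨C, fun t ht => ?_⟩
  -- Solutions built from different truncations coincide: their difference solves the homogeneous
  -- equation and decays to order `m₀ + 1`. Hence one solution has the expansion to every order.
  suffices h : truncSeries p (m₀ + 1) t + r₀ t - (truncSeries p m t + r t) = 0 by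
    rw [sub_eq_zero] at h
    calc _ = ‖r t‖ := by simp only [h, add_sub_cancel_left]
      _ ≤ _ := hrb t ht
  obtain ⟨C₁, hC₁, htr⟩ := norm_truncSeries_sub_le p hm
  refine decaying_solution_eq_zero (m := m₀ + 1) h0 h1 two_pos hμ hBd.continuousOn hb0 hb
    (by omega) (hbm _ le_rfl) (C := C₁ * 2 ^ (m₀ + 1) + C₀ + C) (by positivity)
    (r := fun t => truncSeries p (m₀ + 1) t + r₀ t - (truncSeries p m t + r t))
    (fun t ht => ?_) (fun t ht => ?_) ht
  · have hg : 1 ≤ sectorGauge κ t := by linarith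
    have hn := hnorm t ht
    have h2 : ‖truncSeries p m t - truncSeries p (m₀ + 1) t‖
        ≤ C₁ * 2 ^ (m₀ + 1) / sectorGauge κ t ^ (m₀ + 1) := by
      refine (htr t hn.le).trans (le_trans ?_ (hdiv hC₁ (m₀ + 1) t ht))
      gcongr
      · exact hn.le
      · omega
    have h3 : ‖r t‖ ≤ C / sectorGauge κ t ^ (m₀ + 1) := (hrb t ht).trans (by gcongr)
    calc _ = ‖r₀ t - r t - (truncSeries p m t - truncSeries p (m₀ + 1) t)‖ := by congr 1; abel
      _ ≤ ‖r₀ t‖ + ‖r t‖ + ‖truncSeries p m t - truncSeries p (m₀ + 1) t‖ :=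
        (norm_sub_le _ _).trans (by gcongr; exact norm_sub_le _ _)
      _ ≤ _ := by
        rw [add_div, add_div]
        linarith [hr₀b t ht]
  · refine ((hsol _ _ hr₀ t ht).sub (hsol _ _ hr t ht)).congr_deriv ?_
    simp only [map_sub, mul_sub]
    abel

end DecayingSolutions

/-! ### Smoothness up to the vertex of a sector -/

section Smoothness

/-- The successive derivatives are supplied as data, so no uniqueness of derivatives within `S` is
required and `S` may be an arbitrary set, such as a closed sector near its vertex. -/
theorem contDiffOn_of_hasDerivWithinAt_chain {F : ℕ → ℂ → ℂ} {S : Set ℂ}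
    (h : ∀ n, ∀ z ∈ S, HasDerivWithinAt (F n) (F (n + 1) z) S z) : ContDiffOn ℝ ∞ (F 0) S := by
  have key : ∀ k n : ℕ, ContDiffOn ℂ k (F n) S := by
    intro k
    induction k with
    | zero =>
      intro n
      exact contDiffOn_zero.2 fun z hz => (h n z hz).continuousWithinAt
    | succ k ih =>
      intro n
      push_cast
      rw [contDiffOn_succ_iff_hasFDerivWithinAt (by simp)]
      intro z hz
      refine ⟨S, by rw [insert_eq_of_mem hz]; exact self_mem_nhdsWithin, by simp,
        fun x => ContinuousLinearMap.toSpanSingleton ℂ (F (n + 1) x),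
        fun x hx => (h n x hx).hasFDerivWithinAt, ?_⟩
      exact (ContinuousLinearMap.toSpanSingletonCLE (𝕜 := ℂ) (E := ℂ)).toContinuousLinearMap.contDiff.comp_contDiffOn
        (ih (n + 1))
  exact (contDiffOn_infty.2 fun k => key k 0).restrict_scalars ℝ

theorem iteratedDeriv_sum_pow_zero (p : ℕ → ℂ) {M n : ℕ} (hn : n ≤ M) :
    iteratedDeriv n (fun z : ℂ => ∑ k ∈ Finset.range (M + 1), p k * z ^ k) 0
      = n.factorial * p n := by
  rw [iteratedDeriv_fun_sum fun i _ => by fun_prop]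
  have h : ∀ k, iteratedDeriv n (fun z : ℂ => p k * z ^ k) 0
      = if k = n then n.factorial * p n else 0 := by
    intro k
    rw [iteratedDeriv_const_mul (p k) (by fun_prop), iteratedDeriv_pow]
    split_ifs with hk
    · subst hk; simp [Nat.descFactorial_self]; ring
    · rcases Nat.lt_or_ge k n with h1 | h1
      · simp [Nat.descFactorial_of_lt h1]
      · rw [zero_pow (by omega)]; simp
  simp only [h]
  rw [Finset.sum_ite_eq']
  simp [Nat.lt_succ_of_le hn]

/-- A holomorphic function with an asymptotic power expansion on a sectorial domain is smooth up to
the vertex on smaller sectors. -/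
theorem contDiffOn_of_asymptotics {f : ℂ → ℂ} {p : ℕ → ℂ} {S Ω : Set ℂ}
    (hΩ : IsOpen Ω) (hf : DifferentiableOn ℂ f Ω) {c : ℝ} (hc : 0 < c) (hc1 : c < 1)
    (hS : ∀ z ∈ S, z ≠ 0 → Metric.closedBall z (c * ‖z‖) ⊆ Ω) {m₀ : ℕ}
    (has : ∀ m ≥ m₀, ∃ C, ∀ z ∈ Ω,
      ‖f z - ∑ k ∈ Finset.range (m + 1), p k * z ^ k‖ ≤ C * ‖z‖ ^ m)
    (hf0 : f 0 = p 0) : ContDiffOn ℝ ∞ f S := by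
  have hmem : ∀ z ∈ S, z ≠ 0 → z ∈ Ω := fun z hz h0 =>
    hS z hz h0 (Metric.mem_closedBall_self (by positivity))
  -- The derivatives of `f` off the vertex, completed at the vertex by those of the formal series.
  let F : ℕ → ℂ → ℂ := fun n z => if z = 0 then n.factorial * p n else iteratedDeriv n f z
  have hF0 : F 0 = f := by
    ext z
    by_cases hz : z = 0
    · simp [F, hz, hf0]
    · simp [F, hz]
  have han : ∀ z ∈ Ω, AnalyticAt ℂ f z := fun z hz => hf.analyticAt (hΩ.mem_nhds hz)
  rw [← hF0]
  refine contDiffOn_of_hasDerivWithinAt_chain fun n z hz => ?_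
  by_cases hz0 : z = 0
  · subst hz0
    -- A Cauchy estimate on the disc of radius `c ‖z‖` costs `n` powers of `‖z‖`. Truncation at
    -- order at least `n + 2` leaves an error `O(‖z‖ ^ 2)` in the `n`-th derivative, hence no
    -- contribution to its derivative at 0.
    set M := max m₀ (n + 2)
    obtain ⟨C, hC⟩ := has M (le_max_left _ _)
    set P : ℂ → ℂ := fun z => ∑ k ∈ Finset.range (M + 1), p k * z ^ k
    have hP : ∀ k : WithTop ℕ∞, ContDiff ℂ k P := fun k => by fun_prop
    have hPan : ∀ z, AnalyticAt ℂ P z := fun z => (hP ω).contDiffAt.analyticAt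
    have hQ : HasDerivAt (iteratedDeriv n P) (F (n + 1) 0) 0 := by
      have h1 : DifferentiableAt ℂ (iteratedDeriv n P) 0 := by
        rw [iteratedDeriv_eq_iterate]
        exact ((hPan 0).iterated_deriv n).differentiableAt
      have h2 := h1.hasDerivAt
      rw [← iteratedDeriv_succ] at h2
      refine h2.congr_deriv ?_
      simp only [F, if_true]
      exact iteratedDeriv_sum_pow_zero p (by omega)
    have hE : HasDerivWithinAt (fun z => F n z - iteratedDeriv n P z) 0 S 0 := by
      have h0 : F n 0 - iteratedDeriv n P 0 = 0 := by
        simp only [F, if_true, P]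
        rw [iteratedDeriv_sum_pow_zero p (by omega), sub_self]
      rw [hasDerivWithinAt_iff_isLittleO]
      simp only [h0, sub_zero, smul_zero]
      have hO : (fun z => F n z - iteratedDeriv n P z) =O[𝓝[S] 0] fun z => ‖z‖ ^ 2 := by
        refine Asymptotics.IsBigO.of_bound (n.factorial * (|C| * 2 ^ M) / c ^ n) ?_
        filter_upwards [self_mem_nhdsWithin,
          mem_nhdsWithin_of_mem_nhds (Metric.ball_mem_nhds (0 : ℂ) one_pos)] with z hzS hz1
        have hz1 : ‖z‖ < 1 := by simpa using hz1
        by_cases hz0 : z = 0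
        · subst hz0; simp [h0]
        have hzp : 0 < ‖z‖ := norm_pos_iff.2 hz0
        have hcz : 0 < c * ‖z‖ := by positivity
        have hsub := hS z hzS hz0
        have hzΩ := hmem z hzS hz0
        have e : F n z - iteratedDeriv n P z = iteratedDeriv n (fun z => f z - P z) z := by
          simp only [F, if_neg hz0]
          rw [iteratedDeriv_fun_sub (han z hzΩ).contDiffAt (hP n).contDiffAt]
        have hb := Complex.norm_iteratedDeriv_le_of_forall_mem_sphere_norm_le
          (f := fun z => f z - P z) (c := z) (R := c * ‖z‖) (C := |C| * (2 ^ M * ‖z‖ ^ M)) n hcz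
          (DifferentiableOn.diffContOnCl fun w hw =>
            ((han w (hsub (Metric.closure_ball_subset_closedBall hw))).differentiableAt.sub
              (hPan w).differentiableAt).differentiableWithinAt) fun w hw => by
            refine (hC w (hsub (Metric.sphere_subset_closedBall hw))).trans ?_
            rw [← mul_pow]
            gcongr
            · exact le_abs_self C
            · have h3 : ‖w‖ ≤ ‖w - z‖ + ‖z‖ := by simpa using norm_add_le (w - z) z
              rw [mem_sphere_iff_norm] at hw
              nlinarith
        rw [e, norm_pow, norm_norm]
        refine hb.trans ?_
        rw [mul_pow]
        have h4 : ‖z‖ ^ M ≤ ‖z‖ ^ 2 * ‖z‖ ^ n := by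
          rw [← pow_add]
          exact pow_le_pow_of_le_one hzp.le hz1.le (by omega)
        calc _ ≤ n.factorial * (|C| * (2 ^ M * (‖z‖ ^ 2 * ‖z‖ ^ n))) / (c ^ n * ‖z‖ ^ n) := by
              gcongr
          _ = _ := by field_simp
      refine hO.trans_isLittleO ?_
      have : (fun z : ℂ => ‖z‖ ^ 2) =o[𝓝 0] fun z => ‖z‖ ^ 1 :=
        (Asymptotics.isLittleO_pow_pow one_lt_two).comp_tendsto tendsto_norm_zero
      simp only [pow_one] at this
      exact (Asymptotics.isLittleO_norm_right.1 this).mono nhdsWithin_le_nhds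
    have := hE.add hQ.hasDerivWithinAt
    rw [zero_add] at this
    exact this.congr (fun y _ => by simp) (by simp)
  · have hzΩ := hmem z hz hz0
    have h1 : HasDerivAt (iteratedDeriv n f) (iteratedDeriv (n + 1) f z) z := by
      rw [iteratedDeriv_succ]
      refine DifferentiableAt.hasDerivAt ?_
      rw [iteratedDeriv_eq_iterate]
      exact ((han z hzΩ).iterated_deriv n).differentiableAt
    have h2 : F n =ᶠ[𝓝 z] iteratedDeriv n f := by
      filter_upwards [isOpen_ne.mem_nhds hz0] with y hy
      exact if_neg hy
    refine (h1.congr_of_eventuallyEq h2).hasDerivWithinAt.congr_deriv ?_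
    simp [F, hz0]

end Smoothness

/-! ### Global solutions on the universal cover -/

section FundamentalSolution

/-- Matrices as continuous linear operators. -/
def mulVecCLM : Matrix (Fin 2) (Fin 2) ℂ ≃ₐ[ℂ] ((Fin 2 → ℂ) →L[ℂ] (Fin 2 → ℂ)) :=
  Matrix.toLinAlgEquiv'.trans (Module.End.toContinuousLinearMap (Fin 2 → ℂ))

theorem mulVecCLM_apply (M : Matrix (Fin 2) (Fin 2) ℂ) (v : Fin 2 → ℂ) :
    mulVecCLM M v = M.mulVec v := rfl

namespace LinSystem

/-- The operator of the system in the logarithmic coordinate. -/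
def logCoeff (L : LinSystem) (x : ℂ) : (Fin 2 → ℂ) →L[ℂ] (Fin 2 → ℂ) :=
  Complex.exp (-x) • mulVecCLM L.K + mulVecCLM L.R + Complex.exp x • mulVecCLM L.N

theorem exp_smul_coeff_mulVec (L : LinSystem) (x : ℂ) (v : Fin 2 → ℂ) :
    Complex.exp x • (L.coeff (Complex.exp x)).mulVec v = L.logCoeff x v := by
  have hx := Complex.exp_ne_zero x
  have e1 : Complex.exp x • L.coeff (Complex.exp x)
      = Complex.exp (-x) • L.K + L.R + Complex.exp x • L.N := by
    simp only [coeff, smul_add, smul_smul, Complex.exp_neg]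
    congr 3
    · field_simp
    · rw [mul_inv_cancel₀ hx, one_smul]
  rw [← Matrix.smul_mulVec, e1, ← mulVecCLM_apply]
  simp [logCoeff]

theorem differentiable_logCoeff (L : LinSystem) : Differentiable ℂ L.logCoeff := by
  unfold logCoeff
  fun_prop

theorem isSolution_iff {L : LinSystem} {Y : ℂ → Fin 2 → ℂ} :
    L.IsSolution Y ↔ ∀ x, HasDerivAt Y (L.logCoeff x (Y x)) x := by
  simp only [IsSolution, exp_smul_coeff_mulVec]

theorem invert_logCoeff (L : LinSystem) (x : ℂ) : L.invert.logCoeff x = -L.logCoeff (-x) := by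
  simp only [logCoeff, invert, map_neg, neg_neg]
  module

theorem IsSolution.invert {L : LinSystem} {Y : ℂ → Fin 2 → ℂ} (h : L.IsSolution Y) :
    L.invert.IsSolution fun x => Y (-x) := by
  rw [isSolution_iff] at h ⊢
  intro x
  have := (h (-x)).scomp x (hasDerivAt_neg x)
  refine this.congr_deriv ?_
  simp [invert_logCoeff]

theorem invert_invert (L : LinSystem) : L.invert.invert = L := by
  cases L; simp [LinSystem.invert]

/-- A fundamental matrix of the system, normalized at `x = 0`. -/
theorem exists_fundamental (L : LinSystem) :
    ∃ Φ Ψ : ℂ → (Fin 2 → ℂ) →L[ℂ] (Fin 2 → ℂ), Φ 0 = 1 ∧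
      (∀ x, HasDerivAt Φ (L.logCoeff x * Φ x) x) ∧ (∀ x, Ψ x * Φ x = 1) ∧ ∀ x, Φ x * Ψ x = 1 := by
  obtain ⟨Φ, Ψ, h0, hd, hi⟩ := exists_entire_fundamental L.differentiable_logCoeff
  refine ⟨Φ, Ψ, h0, hd, hi, fun x => ?_⟩
  have h1 : mulVecCLM.symm (Ψ x) * mulVecCLM.symm (Φ x) = 1 := by rw [← map_mul, hi, map_one]
  have h2 := mul_eq_one_comm.1 h1
  rw [← map_mul] at h2
  simpa using congrArg mulVecCLM h2

/-- A local solution extends to a solution on the whole universal cover. -/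
theorem exists_solution_eqOn (L : LinSystem) {W : Set ℂ} (hW : IsOpen W) (hWc : IsPreconnected W)
    (hne : W.Nonempty) {F : ℂ → Fin 2 → ℂ}
    (hF : ∀ x ∈ W, HasDerivAt F (L.logCoeff x (F x)) x) :
    ∃ Y, L.IsSolution Y ∧ EqOn Y F W := by
  obtain ⟨Φ, Ψ, -, hd, hi, hi'⟩ := L.exists_fundamental
  obtain ⟨x₀, hx₀⟩ := hne
  have hΦΨ : ∀ x v, Φ x (Ψ x v) = v := fun x v => by
    rw [← mul_apply_eq_comp, hi', one_apply_eq_self]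
  have hΨΦ : ∀ x v, Ψ x (Φ x v) = v := fun x v => by
    rw [← mul_apply_eq_comp, hi, one_apply_eq_self]
  have hΨ : ∀ x, HasDerivAt Ψ (-(Ψ x * L.logCoeff x)) x := by
    intro x
    have hinv : Ψ = fun y => Ring.inverse (Φ y) := by
      ext1 y
      exact (Ring.inverse_unit ⟨Φ y, Ψ y, hi' y, hi y⟩).symm
    let U : ((Fin 2 → ℂ) →L[ℂ] (Fin 2 → ℂ))ˣ := ⟨Φ x, Ψ x, hi' x, hi x⟩
    have h1 := (hasFDerivAt_ringInverse (𝕜 := ℂ) U).comp_hasDerivAt x (hd x)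
    rw [hinv]
    refine h1.congr_deriv ?_
    have e : Ring.inverse (Φ x) = Ψ x := (congrFun hinv x).symm
    simp only [neg_apply, ContinuousLinearMap.mulLeftRight_apply, e]
    change -(Ψ x * (L.logCoeff x * Φ x) * Ψ x) = _
    rw [mul_assoc, mul_assoc, hi', mul_one]
  refine ⟨fun x => Φ x (Ψ x₀ (F x₀)), isSolution_iff.2 fun x => ?_, fun x hx => ?_⟩
  · exact (hd x).clm_apply (hasDerivAt_const x (Ψ x₀ (F x₀))) |>.congr_deriv (by simp)
  -- Variation of constants: `Ψ F` has zero derivative, so on `W` the local solution is `Φ` applied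
  -- to a constant vector.
  · have hcd : ∀ y ∈ W, HasDerivAt (fun y => Ψ y (F y)) 0 y := by
      intro y hy
      refine ((hΨ y).clm_apply (hF y hy)).congr_deriv ?_
      simp
    have := hW.is_const_of_deriv_eq_zero hWc (fun y hy => (hcd y hy).differentiableAt.differentiableWithinAt)
      (fun y hy => (hcd y hy).deriv) hx hx₀
    simp only at this ⊢
    rw [← this, hΦΨ]

/-- Along the segment from `x₀` to `x` the difference satisfies a linear equation with bounded
coefficient and zero initial value. -/
theorem IsSolution.eq_of_eq {L : LinSystem} {Y Z : ℂ → Fin 2 → ℂ} (hY : L.IsSolution Y)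
    (hZ : L.IsSolution Z) {x₀ : ℂ} (h : Y x₀ = Z x₀) : Y = Z := by
  ext1 x
  set l : ℝ → ℂ := fun τ => x₀ + τ * (x - x₀)
  have hl : ∀ τ, HasDerivAt l (x - x₀) τ := fun τ => by
    have := ((Complex.ofRealCLM.hasDerivAt (x := τ)).mul_const (x - x₀)).const_add x₀
    exact this.congr_deriv (by simp)
  have hlc : Continuous l := continuous_iff_continuousAt.2 fun τ => (hl τ).continuousAt
  have hc : Continuous fun τ : ℝ => (x - x₀) • L.logCoeff (l τ) :=
    (L.differentiable_logCoeff.continuous.comp hlc).const_smul (x - x₀)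
  obtain ⟨C, hC⟩ := (isCompact_Icc (a := (0 : ℝ)) (b := 1)).exists_bound_of_continuousOn
    hc.continuousOn
  have hd : ∀ τ ∈ Icc (0 : ℝ) 1, HasDerivWithinAt (fun τ => Y (l τ) - Z (l τ))
      (((x - x₀) • L.logCoeff (l τ)) (Y (l τ) - Z (l τ))) (Icc 0 1) τ := by
    intro τ _
    have h1 := (isSolution_iff.1 hY (l τ)).scomp τ (hl τ)
    have h2 := (isSolution_iff.1 hZ (l τ)).scomp τ (hl τ)
    refine ((h1.sub h2).congr_deriv ?_).hasDerivWithinAt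
    simp [smul_sub]
  have := norm_le_gronwallBound_Icc hd (δ := 0) (K := C) (ε := 0) (by simp [l, h])
    (fun t ht => by
      rw [add_zero]
      exact (ContinuousLinearMap.le_opNorm _ _).trans (by gcongr; exact hC t ht)) 1 (by simp)
  rw [gronwallBound_ε0_δ0, norm_le_zero_iff, sub_eq_zero] at this
  simpa [l] using this

end LinSystem

end FundamentalSolution

/-! ### Good sectors and rays -/

section Sectors

/-- On a dividing ray the quotient is purely imaginary, and rotating it by `θ - φ` produces the
sine. All sign questions about the two exponentials reduce to the sign of this sine. -/
theorem re_div_exp_eq {δ : ℂ} {θ φ : ℝ} (h : (δ / Complex.exp (θ * Complex.I)).re = 0) :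
    (δ / Complex.exp (φ * Complex.I)).re
      = (δ / Complex.exp (θ * Complex.I)).im * Real.sin (φ - θ) := by
  have e : δ / Complex.exp (φ * Complex.I)
      = δ / Complex.exp (θ * Complex.I) * Complex.exp (((θ - φ : ℝ) : ℂ) * Complex.I) := by
    push_cast
    rw [sub_mul, Complex.exp_sub]
    field_simp
  rw [e, Complex.mul_re, h, Complex.exp_ofReal_mul_I_im, ← neg_sub φ θ, Real.sin_neg]
  ring

/-- A good sector contains rays along which a given one of the two exponentials dominates; they can
be chosen close to the imaginary dividing ray. -/
theorem IsGoodSectorAtZero.exists_ray {ev : Fin 2 → ℂ} {α β : ℝ} (h : IsGoodSectorAtZero ev α β)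
    (k : Fin 2) :
    ∃ φ ∈ Ioo α β, β - φ < Real.pi ∧ φ - α < Real.pi ∧
      ∀ j, j ≠ k → ((ev j - ev k) / Complex.exp (φ * Complex.I)).re < 0 := by
  obtain ⟨θ, ⟨hα, hβ⟩, h⟩ := h
  have h0 := (h θ ⟨hα.le, hβ.le⟩).2 rfl
  set m := ((ev 0 - ev 1) / Complex.exp (θ * Complex.I)).im
  have hsin : ∀ φ ∈ Icc α β, m * Real.sin (φ - θ) = 0 → φ = θ := fun φ hφ h1 =>
    (h φ hφ).1 ((re_div_exp_eq h0).trans h1)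
  have hm : m ≠ 0 := fun hm => by
    have := hsin α ⟨le_rfl, (hα.trans hβ).le⟩ (by rw [hm, zero_mul])
    linarith
  -- Otherwise the opposite dividing ray, at angle `θ - π`, would lie in the closed sector.
  have hθα : θ - α < Real.pi := by
    by_contra! hle
    have := hsin (θ - Real.pi) ⟨by linarith, by linarith [Real.pi_pos]⟩ (by simp)
    linarith [Real.pi_pos]
  have hβθ : β - θ < Real.pi := by
    by_contra! hle
    have := hsin (θ + Real.pi) ⟨by linarith [Real.pi_pos], by linarith⟩ (by simp)
    linarith [Real.pi_pos]
  obtain ⟨η, hη0, hη⟩ : ∃ η, 0 < η ∧ η < min (min (θ - α) (β - θ))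
      (min (Real.pi - (θ - α)) (Real.pi - (β - θ))) := by
    refine exists_between ?_
    simp only [lt_min_iff]
    exact ⟨⟨by linarith, by linarith⟩, by linarith, by linarith⟩
  simp only [lt_min_iff] at hη
  have hs : 0 < Real.sin η := Real.sin_pos_of_pos_of_lt_pi hη0 (by linarith)
  -- The ray is the dividing ray tilted by the small angle `η`, to the side that the sign of `m` and
  -- the index `k` dictate.
  obtain ⟨φ, hφ, hcase⟩ : ∃ φ, |φ - θ| ≤ η ∧
      (if k = 0 then -1 else (1 : ℝ)) * (m * Real.sin (φ - θ)) < 0 := by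
    have hηa : |η| ≤ η := (abs_of_pos hη0).le
    rcases lt_or_gt_of_ne hm with hneg | hpos
    · by_cases hk : k = 0
      · refine ⟨θ - η, by simpa, ?_⟩
        simp only [hk, if_true, sub_sub_cancel_left, Real.sin_neg]
        nlinarith
      · refine ⟨θ + η, by simpa, ?_⟩
        simp only [hk, if_false, add_sub_cancel_left]
        nlinarith
    · by_cases hk : k = 0
      · refine ⟨θ + η, by simpa, ?_⟩
        simp only [hk, if_true, add_sub_cancel_left]
        nlinarith
      · refine ⟨θ - η, by simpa, ?_⟩
        simp only [hk, if_false, sub_sub_cancel_left, Real.sin_neg]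
        nlinarith
  rw [abs_le] at hφ
  refine ⟨φ, ⟨by linarith, by linarith⟩, by linarith, by linarith, fun j hj => ?_⟩
  have hre := re_div_exp_eq (φ := φ) h0
  change _ = m * _ at hre
  fin_cases k <;> fin_cases j <;> simp at hj hcase ⊢
  · have e : (ev 1 - ev 0) / Complex.exp (φ * Complex.I)
        = -((ev 0 - ev 1) / Complex.exp (φ * Complex.I)) := by ring
    rw [e, Complex.neg_re, hre]
    linarith
  · rw [hre]
    linarith

/-- A ray in the sector; points of the closed sector in terms of the coordinate in which the ray
is the positive half-line. -/
theorem closure_sector_subset {α β φ w : ℝ} (hα : φ - α ≤ w) (hβ : β - φ ≤ w) (hw : w ≤ Real.pi)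
    {z : ℂ} (hz : z ∈ closure (sector α β)) :
    Real.cos w * ‖Complex.exp (-φ * Complex.I) * z‖ ≤ (Complex.exp (-φ * Complex.I) * z).re := by
  have hcl : IsClosed {z : ℂ | Real.cos w * ‖Complex.exp (-φ * Complex.I) * z‖ ≤
      (Complex.exp (-φ * Complex.I) * z).re} := isClosed_le (by fun_prop) (by fun_prop)
  refine closure_minimal ?_ hcl hz
  rintro _ ⟨x, ⟨h1, h2⟩, rfl⟩
  have e : Complex.exp (-φ * Complex.I) * Complex.exp x = Complex.exp (x - φ * Complex.I) := by
    rw [← Complex.exp_add]; congr 1; ring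
  rw [mem_ofPred_eq, e, Complex.norm_exp, Complex.exp_re, mul_comm]
  have him : (x - φ * Complex.I).im = x.im - φ := by simp
  rw [him]
  gcongr
  rw [← Real.cos_abs (x.im - φ)]
  exact Real.cos_le_cos_of_nonneg_of_le_pi (abs_nonneg _) hw (abs_le.2 ⟨by linarith, by linarith⟩)

/-- Besides putting the vertex in the closure, this gives the approach to it along the ray of angle
`φ`, with `y = -log |z|`, on which all limits at the vertex are taken. -/
theorem zero_mem_closure_sector {α β φ : ℝ} (h : φ ∈ Ioo α β) :
    Tendsto (fun y : ℝ => Complex.exp (-(y : ℂ) + φ * Complex.I)) atTop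
      (𝓝[sector α β] 0) := by
  refine tendsto_nhdsWithin_iff.2 ⟨?_, Eventually.of_forall fun y => ⟨_, ?_, rfl⟩⟩
  · rw [tendsto_zero_iff_norm_tendsto_zero]
    simp only [Complex.norm_exp]
    have : Tendsto (fun y : ℝ => Real.exp (-y)) atTop (𝓝 0) := Real.tendsto_exp_neg_atTop_nhds_zero
    simpa using this
  · simpa using h

theorem sectorGauge_inv {κ : ℝ} (u : ℂ) (hu : u ≠ 0) :
    sectorGauge κ u⁻¹ = (u.re + κ * ‖u‖) / ‖u‖ ^ 2 := by
  have := norm_pos_iff.2 hu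
  rw [sectorGauge, Complex.inv_re, norm_inv, Complex.normSq_eq_norm_sq]
  field_simp

end Sectors

/-! ### The formal equation for one column -/

section CanonicalColumn

variable {L : LinSystem} {ev res : Fin 2 → ℂ}

/-- The formal normal form in the basis of eigenvectors. -/
theorem formal_column_equations {H : ℕ → Matrix (Fin 2) (Fin 2) ℂ} (hdet : IsUnit (H 0).det)
    (hH0 : H 0 * Matrix.diagonal ev = L.K * H 0)
    (hH1 : H 1 * Matrix.diagonal ev + H 0 * Matrix.diagonal res = L.K * H 1 + L.R * H 0)
    (hH : ∀ m : ℕ, ((m : ℂ) + 1) • H (m + 1) + H (m + 2) * Matrix.diagonal ev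
        + H (m + 1) * Matrix.diagonal res = L.K * H (m + 2) + L.R * H (m + 1) + L.N * H m)
    (k : Fin 2) {ζ : ℂ} (hζ : ζ ≠ 0) :
    -- These are the coefficients for the `k`-th column, written in the eigenbasis, after division
    -- by its factor `exp (-ev k / z) z ^ res k`, in the rotated coordinate `t = 1 / (ζ z)`; this
    -- explains the powers of `ζ`.
    let μ : Fin 2 → ℂ := fun i => ζ * (ev i - ev k)
    let R := mulVecCLM ((H 0)⁻¹ * (L.R - res k • 1) * H 0)
    let N := mulVecCLM (ζ⁻¹ • ((H 0)⁻¹ * L.N * H 0))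
    let p : ℕ → Fin 2 → ℂ := fun m => (ζ⁻¹) ^ m • ((H 0)⁻¹ * H m).mulVec (Pi.single k 1)
    μ * p 0 = 0 ∧ μ * p 1 + R (p 0) = 0 ∧
      ∀ m : ℕ, μ * p (m + 2) + R (p (m + 1)) + N (p m) = ((m : ℂ) + 1) • p (m + 1) := by
  intro μ R N p
  have hinv : (H 0)⁻¹ * H 0 = 1 := Matrix.nonsing_inv_mul _ hdet
  have hinv' : H 0 * (H 0)⁻¹ = 1 := Matrix.mul_nonsing_inv _ hdet
  have hμ : ∀ v : Fin 2 → ℂ, μ * v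
      = (ζ • ((H 0)⁻¹ * (L.K - ev k • 1) * H 0)).mulVec v := by
    intro v
    have e : (H 0)⁻¹ * (L.K - ev k • 1) * H 0 = Matrix.diagonal fun i => ev i - ev k := by
      rw [mul_assoc, sub_mul, ← hH0, mul_sub, ← mul_assoc, hinv, one_mul, smul_mul_assoc, one_mul,
        mul_smul_comm, hinv, ← Matrix.diagonal_one, ← Matrix.diagonal_smul, Matrix.diagonal_sub]
      congr 1
      ext i
      simp
    rw [e, ← Matrix.diagonal_smul]
    ext i
    simp only [μ, Matrix.mulVec_diagonal, Pi.mul_apply, Pi.smul_apply, smul_eq_mul]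
  have hdiag : ∀ (M : Matrix (Fin 2) (Fin 2) ℂ) (d : Fin 2 → ℂ),
      (M * Matrix.diagonal d).mulVec (Pi.single k 1) = d k • M.mulVec (Pi.single k 1) := by
    intro M d
    ext i
    simp [Matrix.mul_diagonal, mul_comm]
  have hcancel : ∀ M M' : Matrix (Fin 2) (Fin 2) ℂ,
      ((H 0)⁻¹ * M * H 0) * ((H 0)⁻¹ * M') = (H 0)⁻¹ * (M * M') := by
    intro M M'
    rw [mul_assoc ((H 0)⁻¹ * M), ← mul_assoc (H 0), hinv', one_mul, mul_assoc]
  set e : Fin 2 → ℂ := Pi.single k 1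
  have hKm : ∀ m, μ * p m = (ζ * (ζ⁻¹) ^ m) • ((H 0)⁻¹ * (L.K * H m)).mulVec e
      - (ζ * (ζ⁻¹) ^ m) • (ev k • ((H 0)⁻¹ * H m).mulVec e) := by
    intro m
    simp only [hμ, p, Matrix.mulVec_smul, Matrix.smul_mulVec, Matrix.mulVec_mulVec, hcancel,
      sub_mul, mul_sub, smul_mul_assoc, one_mul, mul_smul_comm, Matrix.sub_mulVec]
    module
  have hRm : ∀ m, R (p m) = (ζ⁻¹) ^ m • ((H 0)⁻¹ * (L.R * H m)).mulVec e
      - (ζ⁻¹) ^ m • (res k • ((H 0)⁻¹ * H m).mulVec e) := by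
    intro m
    simp only [R, mulVecCLM_apply, p, Matrix.mulVec_smul, Matrix.smul_mulVec,
      Matrix.mulVec_mulVec, hcancel, sub_mul, mul_sub, smul_mul_assoc, one_mul, mul_smul_comm,
      Matrix.sub_mulVec]
    module
  have hNm : ∀ m, N (p m) = (ζ⁻¹) ^ (m + 1) • ((H 0)⁻¹ * (L.N * H m)).mulVec e := by
    intro m
    simp only [N, mulVecCLM_apply, p, Matrix.mulVec_smul, Matrix.smul_mulVec,
      Matrix.mulVec_mulVec, smul_mul_assoc, hcancel, smul_smul, pow_succ, e]
  have hstep : ∀ m, ζ * (ζ⁻¹) ^ (m + 1) = (ζ⁻¹) ^ m := by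
    intro m
    rw [pow_succ]
    field_simp
  refine ⟨?_, ?_, fun m => ?_⟩
  · rw [hKm, ← hH0, ← mul_assoc, hdiag]
    module
  · have h1 := congrArg (fun M => ((H 0)⁻¹ * M).mulVec e) hH1
    simp only [mul_add, Matrix.add_mulVec, ← mul_assoc (H 0)⁻¹ _ (Matrix.diagonal _), hdiag] at h1
    rw [hKm, hRm, hstep 0, pow_zero, one_smul, one_smul, one_smul, one_smul]
    rw [sub_add_sub_comm, ← h1]
    abel
  · have h1 := congrArg (fun M => ((H 0)⁻¹ * M).mulVec e) (hH m)
    simp only [mul_add, Matrix.add_mulVec, ← mul_assoc (H 0)⁻¹ _ (Matrix.diagonal _), hdiag,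
      mul_smul_comm, Matrix.smul_mulVec] at h1
    rw [hKm, hRm, hNm, hstep (m + 1)]
    simp only [p]
    have h2 : ((H 0)⁻¹ * (L.K * H (m + 2))).mulVec e = ((m : ℂ) + 1) • ((H 0)⁻¹ * H (m + 1)).mulVec e
        + ev k • ((H 0)⁻¹ * H (m + 2)).mulVec e + res k • ((H 0)⁻¹ * H (m + 1)).mulVec e
        - ((H 0)⁻¹ * (L.R * H (m + 1))).mulVec e - ((H 0)⁻¹ * (L.N * H m)).mulVec e := by
      rw [h1]; abel
    rw [h2]
    module

end CanonicalColumn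

/-! ### Existence of canonical sectorial bases -/

section CanonicalColumn

variable {L : LinSystem} {ev res : Fin 2 → ℂ}

/-- The solution given in the coordinate `t = exp (-x + φ i)` by an actual solution of the
diagonalized system solves `L` in the logarithmic coordinate. -/
theorem hasDerivAt_column {H₀ : Matrix (Fin 2) (Fin 2) ℂ} (hdet : IsUnit H₀.det)
    (hH0 : H₀ * Matrix.diagonal ev = L.K * H₀) (k : Fin 2) {ζ : ℂ} (hζ : ζ ≠ 0)
    {v : ℂ → Fin 2 → ℂ} {x : ℂ}
    (hv : HasDerivAt v (-(fun i => ζ * (ev i - ev k)) * v (ζ⁻¹ * Complex.exp (-x))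
      - ((ζ⁻¹ * Complex.exp (-x))⁻¹ • mulVecCLM (H₀⁻¹ * (L.R - res k • 1) * H₀)
        + ((ζ⁻¹ * Complex.exp (-x))⁻¹) ^ 2 • mulVecCLM (ζ⁻¹ • (H₀⁻¹ * L.N * H₀)))
          (v (ζ⁻¹ * Complex.exp (-x)))) (ζ⁻¹ * Complex.exp (-x))) :
    HasDerivAt (fun x => Complex.exp (-(ev k) * Complex.exp (-x) + res k * x) •
        mulVecCLM H₀ (v (ζ⁻¹ * Complex.exp (-x))))
      (L.logCoeff x (Complex.exp (-(ev k) * Complex.exp (-x) + res k * x) •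
        mulVecCLM H₀ (v (ζ⁻¹ * Complex.exp (-x))))) x := by
  have hx := Complex.exp_ne_zero x
  have hinv' : H₀ * H₀⁻¹ = 1 := Matrix.mul_nonsing_inv _ hdet
  set τ := ζ⁻¹ * Complex.exp (-x)
  have hexp : HasDerivAt (fun x => Complex.exp (-x)) (-Complex.exp (-x)) x := by
    simpa using (hasDerivAt_neg x).cexp
  have hE : HasDerivAt (fun x => Complex.exp (-(ev k) * Complex.exp (-x) + res k * x))
      (Complex.exp (-(ev k) * Complex.exp (-x) + res k * x)
        * (ev k * Complex.exp (-x) + res k)) x := by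
    have := ((hexp.const_mul (-(ev k))).add ((hasDerivAt_id x).const_mul (res k))).cexp
    refine this.congr_deriv ?_
    simp
  have hvx := hv.scomp x (hexp.const_mul ζ⁻¹)
  have hw := (hasDerivAt_const x (mulVecCLM H₀)).clm_apply hvx
  refine (hE.smul hw).congr_deriv ?_
  set w := v τ
  have h1 : mulVecCLM H₀ ((fun i => ζ * (ev i - ev k)) * w)
      = ζ • (mulVecCLM L.K (mulVecCLM H₀ w) - ev k • mulVecCLM H₀ w) := by
    have e : (fun i => ζ * (ev i - ev k)) * w
        = ζ • ((Matrix.diagonal ev).mulVec w - ev k • w) := by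
      ext i
      simp only [Pi.mul_apply, Pi.smul_apply, Pi.sub_apply, Matrix.mulVec_diagonal, smul_eq_mul]
      ring
    rw [e, map_smul, map_sub, map_smul, mulVecCLM_apply, mulVecCLM_apply, mulVecCLM_apply,
      Matrix.mulVec_mulVec, Matrix.mulVec_mulVec, hH0]
  have h2 : ∀ M : Matrix (Fin 2) (Fin 2) ℂ,
      mulVecCLM H₀ (mulVecCLM (H₀⁻¹ * M * H₀) w) = mulVecCLM M (mulVecCLM H₀ w) := by
    intro M
    simp only [mulVecCLM_apply, Matrix.mulVec_mulVec]
    rw [← mul_assoc, ← mul_assoc, hinv', one_mul]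
  have h3 : mulVecCLM (L.R - res k • 1) (mulVecCLM H₀ w)
      = mulVecCLM L.R (mulVecCLM H₀ w) - res k • mulVecCLM H₀ w := by
    simp
  have hτ1 : ζ⁻¹ * Complex.exp (-x) * ζ = Complex.exp (-x) := by field_simp
  have hτ2 : ζ⁻¹ * Complex.exp (-x) * τ⁻¹ = 1 :=
    mul_inv_cancel₀ (mul_ne_zero (inv_ne_zero hζ) (Complex.exp_ne_zero _))
  have hτ3 : ζ⁻¹ * Complex.exp (-x) * ((τ⁻¹) ^ 2 * ζ⁻¹) = Complex.exp x := by
    simp only [τ, Complex.exp_neg]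
    field_simp
  change Complex.exp (-(ev k) * Complex.exp (-x) + res k * x) •
      ((0 : (Fin 2 → ℂ) →L[ℂ] (Fin 2 → ℂ)) w + mulVecCLM H₀ ((ζ⁻¹ * -Complex.exp (-x)) •
        (-(fun i => ζ * (ev i - ev k)) * w - (τ⁻¹ • mulVecCLM (H₀⁻¹ * (L.R - res k • 1) * H₀)
        + (τ⁻¹) ^ 2 • mulVecCLM (ζ⁻¹ • (H₀⁻¹ * L.N * H₀))) w)))
      + (Complex.exp (-(ev k) * Complex.exp (-x) + res k * x)
        * (ev k * Complex.exp (-x) + res k)) • mulVecCLM H₀ w = _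
  have e4 : mulVecCLM H₀ ((ζ⁻¹ * -Complex.exp (-x)) •
        (-(fun i => ζ * (ev i - ev k)) * w - (τ⁻¹ • mulVecCLM (H₀⁻¹ * (L.R - res k • 1) * H₀)
        + (τ⁻¹) ^ 2 • mulVecCLM (ζ⁻¹ • (H₀⁻¹ * L.N * H₀))) w))
      = (ζ⁻¹ * Complex.exp (-x) * ζ) • (mulVecCLM L.K (mulVecCLM H₀ w) - ev k • mulVecCLM H₀ w)
        + (ζ⁻¹ * Complex.exp (-x) * τ⁻¹) • (mulVecCLM L.R (mulVecCLM H₀ w)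
          - res k • mulVecCLM H₀ w)
        + (ζ⁻¹ * Complex.exp (-x) * ((τ⁻¹) ^ 2 * ζ⁻¹)) • mulVecCLM L.N (mulVecCLM H₀ w) := by
    have hR := h2 (L.R - res k • 1)
    rw [h3] at hR
    have hN := h2 L.N
    rw [map_smul mulVecCLM ζ⁻¹]
    generalize mulVecCLM (H₀⁻¹ * (L.R - res k • 1) * H₀) = RR at hR ⊢
    generalize mulVecCLM (H₀⁻¹ * L.N * H₀) = NN at hN ⊢
    simp only [neg_mul, map_smul, map_sub, map_neg, h1, add_apply, smul_apply, map_add, hR, hN]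
    module
  rw [e4, hτ1, hτ2, hτ3]
  simp only [zero_apply, LinSystem.logCoeff, map_smul, add_apply, smul_apply]
  module

/-- The column is constructed as a solution recessive along a ray `φ` of its own. After rotating
this ray to the positive half-line all `Re μ i ≤ 0`, and the domain of the half-line construction
has opening close enough to `2π` to contain the whole sector near the vertex. The two columns use
different rays and are built independently. -/
theorem exists_canonical_column {α β : ℝ} (hgood : IsGoodSectorAtZero ev α β)
    {H : ℕ → Matrix (Fin 2) (Fin 2) ℂ} (hdet : IsUnit (H 0).det)
    (hH0 : H 0 * Matrix.diagonal ev = L.K * H 0)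
    (hH1 : H 1 * Matrix.diagonal ev + H 0 * Matrix.diagonal res = L.K * H 1 + L.R * H 0)
    (hH : ∀ m : ℕ, ((m : ℂ) + 1) • H (m + 1) + H (m + 2) * Matrix.diagonal ev
        + H (m + 1) * Matrix.diagonal res = L.K * H (m + 2) + L.R * H (m + 1) + L.N * H m)
    (k : Fin 2) :
    ∃ f h : ℂ → Fin 2 → ℂ, L.IsSolution f ∧
      (∀ i, DifferentiableOn ℂ (fun z => h z i) (sector α β)) ∧
      (∃ r : ℝ, 0 < r ∧
        ∀ i, ContDiffOn ℝ ∞ (fun z => h z i) (closure (sector α β) ∩ Metric.ball 0 r)) ∧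
      h 0 = (H 0).mulVec (Pi.single k 1) ∧
      ∀ x : ℂ, α < x.im → x.im < β → ∀ i, f x i = h (Complex.exp x) i
        * Complex.exp (-(ev k) * Complex.exp (-x) + res k * x) := by
  obtain ⟨φ, ⟨hφα, hφβ⟩, hβπ, hαπ, hneg⟩ := hgood.exists_ray k
  set ζ : ℂ := Complex.exp (-φ * Complex.I)
  have hζ : ζ ≠ 0 := Complex.exp_ne_zero _
  have hζinv : ζ⁻¹ = Complex.exp (φ * Complex.I) := by
    rw [← Complex.exp_neg]; congr 1; ring
  have hζn : ‖ζ‖ = 1 := by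
    have := Complex.norm_exp_ofReal_mul_I (-φ)
    rwa [Complex.ofReal_neg] at this
  -- angles and constants
  set w₀ := max (max (φ - α) (β - φ)) (Real.pi / 2)
  have hw₀α : φ - α ≤ w₀ := (le_max_left _ _).trans (le_max_left _ _)
  have hw₀β : β - φ ≤ w₀ := (le_max_right _ _).trans (le_max_left _ _)
  have hw₀2 : Real.pi / 2 ≤ w₀ := le_max_right _ _
  have hpi := Real.pi_pos
  have hw₀π : w₀ < Real.pi := max_lt (max_lt hαπ hβπ) (by linarith)
  set w₁ := (w₀ + Real.pi) / 2
  have hw₁ : w₀ < w₁ := by simp only [w₁]; linarith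
  have hw₁π : w₁ < Real.pi := by simp only [w₁]; linarith
  -- For `w ≤ π`, the sector `|arg u| ≤ w` is `Re u ≥ cos w ‖u‖`. The constants `κ' < κ₁ < κ < 1`
  -- describe three nested sectors: one containing the given closed sector, one on which the
  -- expansion is used, and one on which the solution is constructed.
  set κ' := -Real.cos w₀
  set κ₁ := -Real.cos w₁
  have hκ'0 : 0 ≤ κ' := by
    simp only [κ', neg_nonneg]
    exact Real.cos_nonpos_of_pi_div_two_le_of_le hw₀2 (by linarith)
  have hκ'1 : κ' < κ₁ := neg_lt_neg
    (Real.cos_lt_cos_of_nonneg_of_le_pi (by linarith) hw₁π.le hw₁)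
  have hκ₁1 : κ₁ < 1 := by
    have := Real.cos_lt_cos_of_nonneg_of_le_pi (by linarith) le_rfl hw₁π
    rw [Real.cos_pi] at this
    simp only [κ₁]; linarith
  set κ := (1 + κ₁) / 2
  have hκ0 : 0 ≤ κ := by simp only [κ]; linarith
  have hκ1 : κ < 1 := by simp only [κ]; linarith
  have hκκ : κ₁ < κ := by simp only [κ]; linarith
  -- Chosen so that `(κ - κ₁) / ‖u‖ > 2` for `‖u‖ < ρ`, which brings `u⁻¹` into the domain of
  -- `exists_solution_with_asymptotics`.
  set ρ := (κ - κ₁) / 2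
  have hρ : 0 < ρ := by simp only [ρ]; linarith
  set Ω : Set ℂ := {u | -κ₁ * ‖u‖ < u.re ∧ ‖u‖ < ρ}
  have hΩ : IsOpen Ω :=
    (isOpen_lt (f := fun u : ℂ => -κ₁ * ‖u‖) (g := fun u => u.re) (by fun_prop)
      Complex.continuous_re).inter (isOpen_lt continuous_norm continuous_const)
  have hΩ0 : ∀ u ∈ Ω, u ≠ 0 := by
    rintro u ⟨h1, -⟩ rfl
    simp at h1
  have hΩg : ∀ u ∈ Ω, (κ - κ₁) / ‖u‖ ≤ sectorGauge κ u⁻¹ ∧ 2 < sectorGauge κ u⁻¹ := by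
    intro u hu
    have hn := norm_pos_iff.2 (hΩ0 u hu)
    have h1 : (κ - κ₁) / ‖u‖ ≤ sectorGauge κ u⁻¹ := by
      rw [sectorGauge_inv u (hΩ0 u hu), div_le_div_iff₀ hn (by positivity)]
      nlinarith [hu.1]
    refine ⟨h1, lt_of_lt_of_le ?_ h1⟩
    rw [lt_div_iff₀ hn]
    have := hu.2
    simp only [ρ] at this
    linarith
  have hΩarg : ∀ u ∈ Ω, |u.arg| < w₁ := by
    intro u hu
    have hn := norm_pos_iff.2 (hΩ0 u hu)
    by_contra! hle
    have h1 := Real.cos_le_cos_of_nonneg_of_le_pi (by linarith) (Complex.abs_arg_le_pi u) hle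
    rw [Real.cos_abs] at h1
    have h2 := hu.1
    rw [← Complex.norm_mul_cos_arg] at h2
    simp only [κ₁] at h2
    nlinarith
  -- the actual solution
  obtain ⟨hp0, hp1, hp⟩ := formal_column_equations hdet hH0 hH1 hH k hζ
  set p : ℕ → Fin 2 → ℂ := fun m => (ζ⁻¹) ^ m • ((H 0)⁻¹ * H m).mulVec (Pi.single k 1)
  have hμ : ∀ i, (ζ * (ev i - ev k)).re ≤ 0 := by
    intro i
    by_cases hi : i = k
    · simp [hi]
    · have := hneg i hi
      rw [div_eq_mul_inv, ← hζinv, inv_inv, mul_comm] at this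
      exact this.le
  obtain ⟨v, hv, m₀, has⟩ := exists_solution_with_asymptotics hκ0 hκ1 hμ hp0 hp1 hp
  set F : ℂ → Fin 2 → ℂ := fun x => Complex.exp (-(ev k) * Complex.exp (-x) + res k * x) •
    mulVecCLM (H 0) (v (ζ⁻¹ * Complex.exp (-x)))
  -- The lift of the truncated sector on which the column is first defined. It is convex, so the
  -- column extends from it to the whole universal cover.
  set W : Set ℂ := {x | x.re < Real.log ρ} ∩ ({x | φ - w₁ < x.im} ∩ {x | x.im < φ + w₁})
  have hWo : IsOpen W := (isOpen_lt Complex.continuous_re continuous_const).inter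
    ((isOpen_lt continuous_const Complex.continuous_im).inter
      (isOpen_lt Complex.continuous_im continuous_const))
  have hWc : Convex ℝ W := (convex_halfSpace_re_lt _).inter
    ((convex_halfSpace_im_gt _).inter (convex_halfSpace_im_lt _))
  have hWne : W.Nonempty := ⟨⟨Real.log ρ - 1, φ⟩, by simp, by simp; linarith, by simp; linarith⟩
  have hζexp : ∀ x : ℂ, ζ⁻¹ * Complex.exp (-x) = (Complex.exp (x - φ * Complex.I))⁻¹ := by
    intro x
    rw [hζinv, ← Complex.exp_add, ← Complex.exp_neg]; congr 1; ring
  have hWΩ : ∀ x ∈ W, Complex.exp (x - φ * Complex.I) ∈ Ω := by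
    rintro x ⟨h1, h2, h3⟩
    have him : (x - φ * Complex.I).im = x.im - φ := by simp
    have hre : (x - φ * Complex.I).re = x.re := by simp
    have h1 : x.re < Real.log ρ := h1
    have h2 : φ - w₁ < x.im := h2
    have h3 : x.im < φ + w₁ := h3
    refine ⟨?_, ?_⟩
    · rw [Complex.norm_exp, Complex.exp_re, him, mul_comm]
      refine mul_lt_mul_of_pos_left ?_ (Real.exp_pos _)
      simp only [κ₁, neg_neg]
      rw [← Real.cos_abs (x.im - φ)]
      exact Real.cos_lt_cos_of_nonneg_of_le_pi (abs_nonneg _) hw₁π.le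
        (abs_lt.2 ⟨by linarith, by linarith⟩)
    · rw [Complex.norm_exp, hre]
      exact (Real.lt_log_iff_exp_lt hρ).1 h1
  obtain ⟨f, hf, hfF⟩ := L.exists_solution_eqOn hWo hWc.isPreconnected hWne (F := F)
    fun x hx => hasDerivAt_column hdet hH0 k hζ
      (hv _ (by rw [hζexp]; exact (hΩg _ (hWΩ x hx)).2))
  have hfd : Differentiable ℂ f := fun x => (hf x).differentiableAt
  -- the holomorphic factor
  set e₀ : Fin 2 → ℂ := (H 0).mulVec (Pi.single k 1)
  let X : ℂ → ℂ := fun u => Complex.log u + φ * Complex.I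
  -- The solution with its exponential factor removed, as a function of the rotated variable `u = ζ
  -- z`; the branch of the logarithm is centred at the ray `φ`, and the value at 0 is the leading
  -- formal coefficient.
  let g : ℂ → Fin 2 → ℂ := fun u => if u = 0 then e₀ else
    Complex.exp (ev k * Complex.exp (-X u) - res k * X u) • f (X u)
  have hgd : ∀ u ∈ Complex.slitPlane, DifferentiableAt ℂ g u := by
    intro u hu
    have hX : DifferentiableAt ℂ X u := (Complex.differentiableAt_log hu).add_const _
    have h1 : DifferentiableAt ℂ (fun u =>
        Complex.exp (ev k * Complex.exp (-X u) - res k * X u) • f (X u)) u := by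
      have h2 : DifferentiableAt ℂ (fun u => f (X u)) u := (hfd (X u)).comp u hX
      fun_prop
    refine h1.congr_of_eventuallyEq ?_
    filter_upwards [isOpen_ne.mem_nhds (Complex.slitPlane_ne_zero hu)] with y hy
    exact if_neg hy
  have hΩslit : ∀ u ∈ Ω, u ∈ Complex.slitPlane := by
    intro u hu
    rw [Complex.mem_slitPlane_iff_arg]
    refine ⟨fun h => ?_, hΩ0 u hu⟩
    have := hΩarg u hu
    rw [h, abs_of_pos hpi] at this
    linarith
  have hgΩ : ∀ u ∈ Ω, g u = mulVecCLM (H 0) (v u⁻¹) := by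
    intro u hu
    have hu0 := hΩ0 u hu
    have harg := abs_lt.1 (hΩarg u hu)
    have hXW : X u ∈ W := by
      refine ⟨?_, ?_, ?_⟩
      · change (Complex.log u + φ * Complex.I).re < Real.log ρ
        simp only [Complex.add_re, Complex.log_re, Complex.mul_re, Complex.ofReal_re,
          Complex.I_re, mul_zero, Complex.ofReal_im, Complex.I_im, zero_mul, sub_zero, add_zero]
        exact Real.log_lt_log (norm_pos_iff.2 hu0) hu.2
      · change φ - w₁ < (Complex.log u + φ * Complex.I).im
        simp [Complex.log_im]; linarith
      · change (Complex.log u + φ * Complex.I).im < φ + w₁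
        simp [Complex.log_im]; linarith
    have hXe : ζ⁻¹ * Complex.exp (-X u) = u⁻¹ := by
      rw [hζexp]
      simp only [X, add_sub_cancel_right, Complex.exp_log hu0]
    simp only [g, if_neg hu0]
    rw [hfF hXW]
    simp only [F, hXe, smul_smul]
    rw [← Complex.exp_add]
    simp
  have hsector : ∀ x : ℂ, α < x.im → x.im < β →
      ζ * Complex.exp x ∈ Complex.slitPlane ∧ X (ζ * Complex.exp x) = x := by
    intro x h1 h2
    have e : ζ * Complex.exp x = Complex.exp (x - φ * Complex.I) := by
      rw [← Complex.exp_add]; congr 1; ring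
    have him : (x - φ * Complex.I).im = x.im - φ := by simp
    have hlog : Complex.log (ζ * Complex.exp x) = x - φ * Complex.I := by
      rw [e, Complex.log_exp (by rw [him]; linarith) (by rw [him]; linarith)]
    refine ⟨?_, by simp only [X, hlog, sub_add_cancel]⟩
    rw [Complex.mem_slitPlane_iff_arg, ← Complex.log_im, hlog, him]
    exact ⟨by linarith, mul_ne_zero hζ (Complex.exp_ne_zero _)⟩
  refine ⟨f, fun z => g (ζ * z), hf, fun i => ?_, ⟨ρ / 2, by positivity, fun i => ?_⟩, by simp [g],
    fun x h1 h2 i => ?_⟩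
  · rintro _ ⟨x, ⟨h1, h2⟩, rfl⟩
    have hd := hgd _ (hsector x h1 h2).1
    have h3 : DifferentiableAt ℂ (fun z => g (ζ * z)) (Complex.exp x) :=
      hd.comp (Complex.exp x) (differentiableAt_id.const_mul ζ)
    exact (differentiableAt_pi.1 h3 i).differentiableWithinAt
  · set S : Set ℂ := {u | -κ' * ‖u‖ ≤ u.re ∧ ‖u‖ < ρ / 2}
    -- Discs of this relative radius around points of the smaller sector `S` stay in `Ω`, because `1
    -- + κ₁ < 2`.
    have hc : 0 < (κ₁ - κ') / 4 := by linarith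
    have hS : ContDiffOn ℝ ∞ (fun u => g u i) S := by
      refine contDiffOn_of_asymptotics (p := fun m => mulVecCLM (H 0) (p m) i) hΩ
        (fun u hu => (differentiableAt_pi.1 (hgd u (hΩslit u hu)) i).differentiableWithinAt)
        hc (by linarith) (fun u hu hu0 y hy => ?_) (m₀ := m₀) (fun m hm => ?_) ?_
      · have hn := norm_pos_iff.2 hu0
        rw [mem_closedBall_iff_norm] at hy
        have h1 : ‖u‖ ≤ ‖y‖ + ‖y - u‖ := by
          have := norm_sub_le y (y - u)
          rwa [sub_sub_cancel] at this
        have h2 : ‖y‖ ≤ ‖y - u‖ + ‖u‖ := by simpa using norm_add_le (y - u) u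
        have h3 : u.re - ‖y - u‖ ≤ y.re := by
          have := Complex.abs_re_le_norm (y - u)
          rw [Complex.sub_re, abs_le] at this
          linarith [this.1]
        obtain ⟨h4, h5⟩ := hu
        refine ⟨?_, ?_⟩
        · have h6 : (1 - (κ₁ - κ') / 4) * ‖u‖ ≤ ‖y‖ := by linarith
          have h7 : κ₁ * ((1 - (κ₁ - κ') / 4) * ‖u‖) ≤ κ₁ * ‖y‖ :=
            mul_le_mul_of_nonneg_left h6 (by linarith)
          have h8 : 0 < (κ₁ - κ') * ‖u‖ := mul_pos (by linarith) hn
          have h9 : κ₁ * ((κ₁ - κ') * ‖u‖) ≤ 1 * ((κ₁ - κ') * ‖u‖) :=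
            mul_le_mul_of_nonneg_right hκ₁1.le h8.le
          nlinarith
        · nlinarith
      · obtain ⟨C, hC⟩ := has m hm
        refine ⟨‖mulVecCLM (H 0)‖ * (|C| / (κ - κ₁) ^ m), fun u hu => ?_⟩
        obtain ⟨hg1, hg2⟩ := hΩg u hu
        have hn := norm_pos_iff.2 (hΩ0 u hu)
        have e : g u i - ∑ k ∈ Finset.range (m + 1), mulVecCLM (H 0) (p k) i * u ^ k
            = mulVecCLM (H 0) (v u⁻¹ - truncSeries p m u⁻¹) i := by
          rw [hgΩ u hu, map_sub, truncSeries, map_sum, Pi.sub_apply, Finset.sum_apply]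
          simp [mul_comm]
        rw [e]
        refine (norm_le_pi_norm _ i).trans ((ContinuousLinearMap.le_opNorm _ _).trans ?_)
        rw [mul_assoc]
        gcongr
        have hd : 0 < (κ - κ₁) / ‖u‖ := div_pos (by linarith) hn
        calc _ ≤ C / sectorGauge κ u⁻¹ ^ m := hC _ hg2
          _ ≤ |C| / ((κ - κ₁) / ‖u‖) ^ m := by
            gcongr
            exact le_abs_self C
          _ = _ := by rw [div_pow]; field_simp
      · simp only [g, if_true, p, pow_zero, one_smul, Matrix.nonsing_inv_mul _ hdet,
          Matrix.one_mulVec]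
        rfl
    refine hS.comp (by fun_prop) fun z hz => ⟨?_, ?_⟩
    · have := closure_sector_subset hw₀α hw₀β hw₀π.le hz.1
      change -κ' * ‖ζ * z‖ ≤ (ζ * z).re
      simp only [κ', neg_neg]
      exact this
    · rw [norm_mul, hζn, one_mul]
      simpa using hz.2
  · obtain ⟨hs, hXx⟩ := hsector x h1 h2
    simp only [g, if_neg (Complex.slitPlane_ne_zero hs), hXx, Pi.smul_apply, smul_eq_mul]
    rw [mul_right_comm, ← Complex.exp_add]
    simp

/-- Existence of the canonical sectorial solution basis. -/
theorem LinSystem.IsFormalNormalFormAtZero.exists_canonicalBasis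
    (hL : L.IsFormalNormalFormAtZero ev res) {α β : ℝ} (hgood : IsGoodSectorAtZero ev α β) :
    ∃ f, L.IsCanonicalBasisAtZero ev res α β f := by
  obtain ⟨-, H, hdet, hH0, hH1, hH⟩ := hL
  choose f h hf hd hr h0 hfh using
    fun k => exists_canonical_column hgood hdet hH0 hH1 hH k
  choose r hr0 hr using hr
  set H' : ℂ → Matrix (Fin 2) (Fin 2) ℂ := fun z => Matrix.of fun i k => h k z i
  have hcd : ∀ i k, ContDiffOn ℝ ∞ (fun z => H' z i k)
      (closure (sector α β) ∩ Metric.ball 0 (min (r 0) (r 1))) := by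
    intro i k
    refine (hr k i).mono (inter_subset_inter_right _ (Metric.ball_subset_ball ?_))
    fin_cases k
    · exact min_le_left _ _
    · exact min_le_right _ _
  obtain ⟨φ, hφ, -⟩ := hgood.exists_ray 0
  have hz : (0 : ℂ) ∈ closure (sector α β) :=
    mem_closure_iff_nhdsWithin_neBot.2 ((zero_mem_closure_sector hφ).neBot)
  have hz' : (0 : ℂ) ∈ closure (sector α β) ∩ Metric.ball 0 (min (r 0) (r 1)) :=
    ⟨hz, Metric.mem_ball_self (lt_min (hr0 0) (hr0 1))⟩
  have hH'0 : H' 0 = H 0 := by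
    ext i k
    simp only [H', Matrix.of_apply, h0]
    simp
  -- Nondegeneracy near the vertex follows by continuity from the invertibility of `H 0`.
  have hdetc : ContinuousWithinAt (fun z => (H' z).det)
      (closure (sector α β) ∩ Metric.ball 0 (min (r 0) (r 1))) 0 := by
    simp only [Matrix.det_fin_two]
    have hc : ∀ i k, ContinuousWithinAt (fun z => H' z i k)
      (closure (sector α β) ∩ Metric.ball 0 (min (r 0) (r 1))) 0 :=
      fun i k => (hcd i k).continuousOn 0 hz'
    exact ((hc 0 0).mul (hc 1 1)).sub ((hc 0 1).mul (hc 1 0))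
  have hne := hdetc.tendsto.eventually (eventually_ne_nhds (b := 0)
    (by rw [hH'0]; exact hdet.ne_zero))
  obtain ⟨ε, hε, hεs⟩ := Metric.mem_nhdsWithin_iff.1 hne
  refine ⟨f, hf, H', fun i k => hd k i, ⟨min ε (min (r 0) (r 1)), lt_min hε (lt_min (hr0 0) (hr0 1)),
    fun i k => (hcd i k).mono (inter_subset_inter_right _
      (Metric.ball_subset_ball (min_le_right _ _))), fun z hz => ?_⟩,
    fun x h1 h2 k i => hfh k x h1 h2 i⟩
  exact hεs ⟨Metric.ball_subset_ball (min_le_left _ _) hz.2, hz.1,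
    Metric.ball_subset_ball (min_le_right _ _) hz.2⟩

theorem LinSystem.IsFormalNormalFormAtInfinity.exists_canonicalBasis
    (hL : L.IsFormalNormalFormAtInfinity ev res) {α β : ℝ}
    (hgood : IsGoodSectorAtZero (-ev) (-β) (-α)) :
    ∃ f, L.IsCanonicalBasisAtInfinity ev res α β f := by
  obtain ⟨f, hf⟩ := LinSystem.IsFormalNormalFormAtZero.exists_canonicalBasis hL hgood
  exact ⟨fun k x => f k (-x), by simpa [LinSystem.IsCanonicalBasisAtInfinity] using hf⟩

theorem IsGoodSectorAtInfinity.invert {α β : ℝ} (h : IsGoodSectorAtInfinity ev α β) :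
    IsGoodSectorAtZero (-ev) (-β) (-α) := by
  obtain ⟨θ, ⟨h1, h2⟩, h⟩ := h
  refine ⟨-θ, ⟨by linarith, by linarith⟩, fun φ hφ => ?_⟩
  have := h (-φ) ⟨by linarith [hφ.2], by linarith [hφ.1]⟩
  rw [← neg_eq_iff_eq_neg, ← this]
  have e : ((-ev) 0 - (-ev) 1) / Complex.exp (φ * Complex.I)
      = -((ev 0 - ev 1) * Complex.exp (((-φ : ℝ) : ℂ) * Complex.I)) := by
    rw [Complex.ofReal_neg, neg_mul, Complex.exp_neg]
    simp only [Pi.neg_apply]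
    ring
  rw [e, Complex.neg_re, neg_eq_zero]

end CanonicalColumn

/-! ### Uniqueness of canonical solutions under gauge transformations of mild growth -/

section CanonicalUniqueness

variable {L L' : LinSystem} {ev ev' res res' : Fin 2 → ℂ} {α β φ : ℝ}

theorem continuous_mulVecCLM : Continuous mulVecCLM :=
  LinearMap.continuous_of_finiteDimensional mulVecCLM.toLinearMap

theorem tendsto_mulVecCLM_along_ray {H : ℂ → Matrix (Fin 2) (Fin 2) ℂ} {r : ℝ} (hr : 0 < r)
    (hH : ∀ i k, ContDiffOn ℝ ∞ (fun z => H z i k) (closure (sector α β) ∩ Metric.ball 0 r))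
    (hφ : φ ∈ Ioo α β) :
    Tendsto (fun y : ℝ => mulVecCLM (H (Complex.exp (-(y : ℂ) + φ * Complex.I)))) atTop
      (𝓝 (mulVecCLM (H 0))) := by
  have hz : (0 : ℂ) ∈ closure (sector α β) :=
    mem_closure_iff_nhdsWithin_neBot.2 ((zero_mem_closure_sector hφ).neBot)
  have hle : 𝓝[sector α β] (0 : ℂ) ≤ 𝓝[closure (sector α β) ∩ Metric.ball 0 r] 0 := by
    refine le_inf nhdsWithin_le_nhds (le_principal_iff.2 ?_)
    filter_upwards [self_mem_nhdsWithin, mem_nhdsWithin_of_mem_nhds (Metric.ball_mem_nhds 0 hr)]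
      with z h1 h2 using ⟨subset_closure h1, h2⟩
  refine (continuous_mulVecCLM.tendsto _).comp (tendsto_pi_nhds.2 fun i => tendsto_pi_nhds.2
    fun k => ?_)
  exact (((hH i k).continuousOn 0 ⟨hz, Metric.mem_ball_self hr⟩).tendsto.mono_left hle).comp
    (zero_mem_closure_sector hφ)

theorem isUnit_mulVecCLM {M : Matrix (Fin 2) (Fin 2) ℂ} (h : M.det ≠ 0) :
    IsUnit (mulVecCLM M) :=
  ((Matrix.isUnit_iff_isUnit_det M).2 h.isUnit).map mulVecCLM

theorem tendsto_neg_exp_add_mul_atBot {κ : ℝ} (hκ : 0 < κ) (D : ℝ) :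
    Tendsto (fun y : ℝ => -κ * Real.exp y + D * y) atTop atBot := by
  have h1 : Tendsto (fun y : ℝ => -κ + D * (y ^ 1 * Real.exp (-y))) atTop (𝓝 (-κ + D * 0)) :=
    ((Real.tendsto_pow_mul_exp_neg_atTop_nhds_zero 1).const_mul D).const_add _
  have h2 := Real.tendsto_exp_atTop.atTop_mul_neg (by linarith) h1
  refine h2.congr fun y => ?_
  rw [Real.exp_neg]
  field_simp

theorem isSolution_add_smul {Y Z : ℂ → Fin 2 → ℂ} (hY : L.IsSolution Y) (hZ : L.IsSolution Z)
    (c d : ℂ) : L.IsSolution fun x => c • Y x + d • Z x := by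
  rw [LinSystem.isSolution_iff] at *
  intro x
  refine (((hY x).const_smul c).add ((hZ x).const_smul d)).congr_deriv ?_
  simp

/-- The columns of a canonical basis are, in a good sector, determined up to a constant factor. More
generally, a gauge transformation of moderate growth sends one canonical basis to another. -/
theorem IsGoodSectorAtZero.exists_gauge_bound (hgood : IsGoodSectorAtZero ev α β) :
    ∃ κ : ℝ, 0 < κ ∧ ∀ {L L' : LinSystem} {ev' res res' : Fin 2 → ℂ} {f f' : Fin 2 → ℂ → Fin 2 → ℂ}
      {G : ℂ → (Fin 2 → ℂ) →L[ℂ] (Fin 2 → ℂ)} {C ε : ℝ},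
      L.IsCanonicalBasisAtZero ev res α β f → L'.IsCanonicalBasisAtZero ev' res' α β f' →
      (∀ Y, L.IsSolution Y → L'.IsSolution fun x => G x (Y x)) → 2 * ε < κ →
      (∀ j, ‖ev' j - ev j‖ ≤ ε) →
      (∀ x : ℂ, x.re ≤ 0 → ‖G x‖ ≤ C * Real.exp (ε * Real.exp (-x.re))) →
      ∀ k, ∃ c : ℂ, ∀ x, G x (f k x) = c • f' k x := by
  choose φ hφ _ _ hneg using hgood.exists_ray
  -- The rate, in `1 / |z|`, at which the `k`-th exponential is smaller than the other on the ray `φ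
  -- k`; in `Fin 2` the other index is `1 - k`.
  set m : Fin 2 → ℝ := fun k => -((ev (1 - k) - ev k) / Complex.exp (φ k * Complex.I)).re
  have hm : ∀ k, 0 < m k := fun k => by
    have := hneg k (1 - k) (by fin_cases k <;> simp)
    simp only [m]; linarith
  refine ⟨min (m 0) (m 1), lt_min (hm 0) (hm 1), ?_⟩
  intro L L' ev' res res' f f' G C ε hf hf' hG hε hev hGb k
  obtain ⟨hfs, H, -, ⟨r, hr, hHc, -⟩, hfH⟩ := hf
  obtain ⟨hfs', H', -, ⟨r', hr', hHc', hdet'⟩, hfH'⟩ := hf'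
  have hmk : 2 * ε < m k := by
    refine hε.trans_le ?_
    fin_cases k
    · exact min_le_left _ _
    · exact min_le_right _ _
  set ξ : ℝ → ℂ := fun y => -(y : ℂ) + φ k * Complex.I
  have hξim : ∀ y, (ξ y).im = φ k := fun y => by simp [ξ]
  have hξre : ∀ y, (ξ y).re = -y := fun y => by simp [ξ]
  have hξ1 : ∀ y, α < (ξ y).im := fun y => by rw [hξim]; exact (hφ k).1
  have hξ2 : ∀ y, (ξ y).im < β := fun y => by rw [hξim]; exact (hφ k).2
  have hlim := tendsto_mulVecCLM_along_ray hr hHc (hφ k)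
  have hlim' := tendsto_mulVecCLM_along_ray hr' hHc' (hφ k)
  have hz0 : (0 : ℂ) ∈ closure (sector α β) :=
    mem_closure_iff_nhdsWithin_neBot.2 ((zero_mem_closure_sector (hφ k)).neBot)
  have hunit := isUnit_mulVecCLM (hdet' 0 ⟨hz0, Metric.mem_ball_self hr'⟩)
  have hinv : Tendsto (fun y => Ring.inverse (mulVecCLM (H' (Complex.exp (ξ y))))) atTop
      (𝓝 (Ring.inverse (mulVecCLM (H' 0)))) := by
    obtain ⟨u, hu⟩ := hunit
    have := NormedRing.inverse_continuousAt u
    rw [hu] at this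
    exact this.tendsto.comp hlim'
  have hunits : ∀ᶠ y in atTop, IsUnit (mulVecCLM (H' (Complex.exp (ξ y)))) := by
    have := hlim'.eventually (Units.isOpen.mem_nhds hunit)
    exact this
  -- the solution in the basis `f'`
  have hcol : ∀ y (c : Fin 2 → ℂ), c 0 • f' 0 (ξ y) + c 1 • f' 1 (ξ y)
      = mulVecCLM (H' (Complex.exp (ξ y)))
        fun j => Complex.exp (-(ev' j) * Complex.exp (-ξ y) + res' j * ξ y) * c j := by
    intro y c
    ext i
    simp only [mulVecCLM_apply, Matrix.mulVec, dotProduct, Fin.sum_univ_two, Pi.add_apply,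
      Pi.smul_apply, smul_eq_mul, hfH' _ (hξ1 y) (hξ2 y)]
    ring
  obtain ⟨c, hc⟩ : ∃ c : Fin 2 → ℂ, ∀ x, G x (f k x) = c 0 • f' 0 x + c 1 • f' 1 x := by
    obtain ⟨y, hy⟩ := hunits.exists
    set b := Ring.inverse (mulVecCLM (H' (Complex.exp (ξ y)))) (G (ξ y) (f k (ξ y)))
    refine ⟨fun j => (Complex.exp (-(ev' j) * Complex.exp (-ξ y) + res' j * ξ y))⁻¹ * b j, ?_⟩
    refine congrFun ((hG _ (hfs k)).eq_of_eq (x₀ := ξ y) (isSolution_add_smul (hfs' 0) (hfs' 1) _ _)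
      ?_)
    simp only
    rw [hcol y fun j => (Complex.exp (-(ev' j) * Complex.exp (-ξ y) + res' j * ξ y))⁻¹ * b j]
    have : (fun j => Complex.exp (-(ev' j) * Complex.exp (-ξ y) + res' j * ξ y)
        * ((Complex.exp (-(ev' j) * Complex.exp (-ξ y) + res' j * ξ y))⁻¹ * b j)) = b := by
      ext j
      rw [← mul_assoc, mul_inv_cancel₀ (Complex.exp_ne_zero _), one_mul]
    rw [this, ← mul_apply_eq_comp, Ring.mul_inverse_cancel _ hy, one_apply_eq_self]
  refine ⟨c k, ?_⟩
  -- the other coefficient vanishes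
  set j := 1 - k
  suffices hcj : c j = 0 by
    intro x
    rw [hc x]
    fin_cases k <;> simp [j] at hcj ⊢ <;> simp [hcj]
  set D : ℝ := ‖res k‖ + ‖res' j‖
  set B : ℝ := (‖Ring.inverse (mulVecCLM (H' 0))‖ + 1) * |C| * (‖mulVecCLM (H 0)‖ + 1)
  -- With `exp y = 1 / |z|`: the ratio of the exponentials gains `exp (-m k exp y)`, while `G` and
  -- the change of eigenvalues cost `exp (ε exp y)` each. The residues contribute only `exp (D y)`.
  -- Since `2 ε < m k`, the bound tends to 0.
  have hbound : ∀ᶠ y in atTop, ‖c j‖ ≤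
      B * Real.exp (D * |φ k|) * Real.exp (-(m k - 2 * ε) * Real.exp y + D * y) := by
    filter_upwards [hunits, eventually_ge_atTop 0,
      hlim.norm.eventually_le_const (lt_add_one _), hinv.norm.eventually_le_const (lt_add_one _)]
      with y hy hy0 hn hn'
    set A := mulVecCLM (H' (Complex.exp (ξ y)))
    set w := Complex.exp (-(ev k) * Complex.exp (-ξ y) + res k * ξ y)
    set w' : Fin 2 → ℂ := fun j => Complex.exp (-(ev' j) * Complex.exp (-ξ y) + res' j * ξ y)
    have hfk : f k (ξ y) = w • mulVecCLM (H (Complex.exp (ξ y))) (Pi.single k 1) := by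
      ext i
      rw [hfH _ (hξ1 y) (hξ2 y), mulVecCLM_apply, Matrix.mulVec_single_one]
      simp [w, mul_comm]
    have e1 : (fun j => w' j * c j) = Ring.inverse A (G (ξ y) (f k (ξ y))) := by
      rw [hc, hcol y c, ← mul_apply_eq_comp, Ring.inverse_mul_cancel _ hy, one_apply_eq_self]
    have h1 : ‖w' j‖ * ‖c j‖ ≤ (‖Ring.inverse (mulVecCLM (H' 0))‖ + 1) *
        ((|C| * Real.exp (ε * Real.exp y)) * (‖w‖ * (‖mulVecCLM (H 0)‖ + 1))) := by
      rw [← norm_mul]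
      refine (norm_le_pi_norm (fun j => w' j * c j) j).trans ?_
      rw [e1, hfk]
      refine (ContinuousLinearMap.le_of_opNorm_le _ hn' _).trans ?_
      have hG1 := hGb (ξ y) (by rw [hξre]; linarith)
      rw [hξre, neg_neg] at hG1
      have hG2 : ‖G (ξ y)‖ ≤ |C| * Real.exp (ε * Real.exp y) :=
        hG1.trans (by gcongr; exact le_abs_self C)
      have h3 : ‖w • mulVecCLM (H (Complex.exp (ξ y))) (Pi.single k 1)‖
          ≤ ‖w‖ * (‖mulVecCLM (H 0)‖ + 1) := by
        rw [norm_smul]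
        gcongr
        refine (ContinuousLinearMap.le_of_opNorm_le _ hn _).trans ?_
        rw [Pi.norm_single, norm_one, mul_one]
      gcongr
      exact (ContinuousLinearMap.le_of_opNorm_le _ hG2 _).trans (by gcongr)
    have hw' : 0 < ‖w' j‖ := norm_pos_iff.2 (Complex.exp_ne_zero _)
    have h2 : ‖w‖ / ‖w' j‖ * Real.exp (ε * Real.exp y) ≤
        Real.exp (D * |φ k|) * Real.exp (-(m k - 2 * ε) * Real.exp y + D * y) := by
      rw [← norm_div, ← Complex.exp_sub, Complex.norm_exp, ← Real.exp_add, ← Real.exp_add,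
        Real.exp_le_exp]
      have hexp : Complex.exp (-ξ y) = (Real.exp y : ℂ) / Complex.exp (φ k * Complex.I) := by
        rw [Complex.ofReal_exp, ← Complex.exp_sub]; congr 1; simp only [ξ]; ring
      have e2 : -(ev k) * Complex.exp (-ξ y) + res k * ξ y
          - (-(ev' j) * Complex.exp (-ξ y) + res' j * ξ y)
          = (Real.exp y : ℂ) * ((ev j - ev k) / Complex.exp (φ k * Complex.I))
            + (ev' j - ev j) * Complex.exp (-ξ y) + (res k - res' j) * ξ y := by
        rw [hexp]; ring
      rw [e2, Complex.add_re, Complex.add_re, Complex.re_ofReal_mul]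
      have h3 : ((ev' j - ev j) * Complex.exp (-ξ y)).re ≤ ε * Real.exp y := by
        refine (Complex.re_le_norm _).trans ?_
        rw [norm_mul, Complex.norm_exp, Complex.neg_re, hξre, neg_neg]
        gcongr
        exact hev j
      have h4 : ((res k - res' j) * ξ y).re ≤ D * (y + |φ k|) := by
        refine (Complex.re_le_norm _).trans ?_
        rw [norm_mul]
        refine mul_le_mul (norm_sub_le _ _) ?_ (norm_nonneg _) (by positivity)
        refine (norm_add_le _ _).trans ?_
        simp [abs_of_nonneg hy0]
      have h5 : Real.exp y * ((ev j - ev k) / Complex.exp (φ k * Complex.I)).re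
          = -(m k) * Real.exp y := by simp only [m, j]; ring
      rw [h5]
      linarith
    have h6 : ‖c j‖ ≤ B * (‖w‖ / ‖w' j‖ * Real.exp (ε * Real.exp y)) := by
      have : ‖c j‖ = ‖w' j‖ * ‖c j‖ / ‖w' j‖ := by field_simp
      rw [this, div_le_iff₀ hw']
      refine h1.trans (le_of_eq ?_)
      simp only [B]
      field_simp
    rw [mul_assoc]
    exact h6.trans (mul_le_mul_of_nonneg_left h2 (by positivity))
  have hlim0 : Tendsto (fun y => B * Real.exp (D * |φ k|) *
      Real.exp (-(m k - 2 * ε) * Real.exp y + D * y)) atTop (𝓝 (B * Real.exp (D * |φ k|) * 0)) :=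
    ((Real.tendsto_exp_atBot.comp (tendsto_neg_exp_add_mul_atBot (by linarith) D))).const_mul _
  rw [mul_zero] at hlim0
  exact norm_le_zero_iff.1 (ge_of_tendsto hlim0 hbound)

end CanonicalUniqueness

/-! ### Construction of the formal normal form -/

section FormalNormalForm

variable {L : LinSystem} {ev res : Fin 2 → ℂ}

/-- One step of the recursive construction of the formal normalizing series, in a basis of
eigenvectors of the main term. -/
def formalStep (ev res : Fin 2 → ℂ) (R N : Matrix (Fin 2) (Fin 2) ℂ) (m : ℕ)
    (AB : Matrix (Fin 2) (Fin 2) ℂ × Matrix (Fin 2) (Fin 2) ℂ) :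
    Matrix (Fin 2) (Fin 2) ℂ × Matrix (Fin 2) (Fin 2) ℂ :=
  let E := R * AB.2 - AB.2 * Matrix.diagonal res + N * AB.1 - (m : ℂ) • AB.2
  let u := E 0 1 / (ev 1 - ev 0)
  let v := E 1 0 / (ev 0 - ev 1)
  (AB.2, !![(R 0 1 * v + (N * AB.2) 0 0) / (m + 1), u; v, (R 1 0 * u + (N * AB.2) 1 1) / (m + 1)])

/-- The series normalizing a system whose main term is diagonal. -/
def formalSeries (ev res : Fin 2 → ℂ) (R N : Matrix (Fin 2) (Fin 2) ℂ) :
    ℕ → Matrix (Fin 2) (Fin 2) ℂ × Matrix (Fin 2) (Fin 2) ℂ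
  | 0 => (0, 1)
  | m + 1 => formalStep ev res R N m (formalSeries ev res R N m)

/-- A commutator with `diag ev` has zero diagonal and is invertible off the diagonal. So each
equation determines the off-diagonal entries of the new coefficient, and its diagonal entries are
free; they are chosen to make the diagonal of the next equation vanish. There `R i i` cancels `res
i`, and what remains is division by `m + 1`. The pairs consist of consecutive coefficients, with 0
before the first one. -/
theorem formalSeries_spec (hev : ev 0 ≠ ev 1) {R : Matrix (Fin 2) (Fin 2) ℂ}
    (hR : ∀ i, R i i = res i) (N : Matrix (Fin 2) (Fin 2) ℂ) (m : ℕ) :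
    (formalSeries ev res R N (m + 1)).2 * Matrix.diagonal ev
        - Matrix.diagonal ev * (formalSeries ev res R N (m + 1)).2
      = R * (formalSeries ev res R N m).2 - (formalSeries ev res R N m).2 * Matrix.diagonal res
        + N * (formalSeries ev res R N m).1 - (m : ℂ) • (formalSeries ev res R N m).2 := by
  have h10 : ev 1 - ev 0 ≠ 0 := sub_ne_zero.2 hev.symm
  have h01 : ev 0 - ev 1 ≠ 0 := sub_ne_zero.2 hev
  have hstep : ∀ (m : ℕ) (A B C : Matrix (Fin 2) (Fin 2) ℂ),
      (∀ i, (R * B - B * Matrix.diagonal res + N * A - (m : ℂ) • B) i i = 0) →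
      (B, C) = formalStep ev res R N m (A, B) →
      C * Matrix.diagonal ev - Matrix.diagonal ev * C
        = R * B - B * Matrix.diagonal res + N * A - (m : ℂ) • B ∧
      ∀ i, (R * C - C * Matrix.diagonal res + N * B - ((m + 1 : ℕ) : ℂ) • C) i i = 0 := by
    intro m A B C h0 hC
    have hm : (m : ℂ) + 1 ≠ 0 := Nat.cast_add_one_ne_zero m
    simp only [formalStep, Prod.mk.injEq, true_and] at hC
    set E := R * B - B * Matrix.diagonal res + N * A - (m : ℂ) • B
    clear_value E
    set Q := N * B
    clear_value Q
    subst hC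
    refine ⟨?_, fun i => ?_⟩
    · ext i j
      simp only [Matrix.sub_apply, Matrix.mul_diagonal, Matrix.diagonal_mul]
      fin_cases i <;> fin_cases j <;> simp [h0] <;> field_simp <;> ring
    · simp only [Matrix.sub_apply, Matrix.add_apply, Matrix.smul_apply, Matrix.mul_diagonal]
      rw [Matrix.mul_apply, Fin.sum_univ_two]
      fin_cases i <;> simp [hR] <;> field_simp <;> ring
  have hinv : ∀ m : ℕ, ∀ i, (R * (formalSeries ev res R N m).2
      - (formalSeries ev res R N m).2 * Matrix.diagonal res
      + N * (formalSeries ev res R N m).1 - (m : ℂ) • (formalSeries ev res R N m).2) i i = 0 := by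
    intro m
    induction m with
    | zero => intro i; simp [formalSeries, hR]
    | succ m ih => exact (hstep m _ _ _ ih rfl).2
  exact (hstep m _ _ _ (hinv m) rfl).1

/-- Conjugation to an eigenbasis of the main term reduces to the diagonal case, so the residues are
the diagonal entries of `R` in that basis. -/
theorem LinSystem.isFormalNormalFormAtZero_of_eigenbasis (hev : ev 0 ≠ ev 1)
    {H₀ H₀' : Matrix (Fin 2) (Fin 2) ℂ} (hH : H₀ * H₀' = 1)
    (hK : H₀ * Matrix.diagonal ev = L.K * H₀) (hR : ∀ i, (H₀' * L.R * H₀) i i = res i) :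
    L.IsFormalNormalFormAtZero ev res := by
  set P := formalSeries ev res (H₀' * L.R * H₀) (H₀' * L.N * H₀)
  have hP := formalSeries_spec hev hR (H₀' * L.N * H₀)
  have hcancel : ∀ M X : Matrix (Fin 2) (Fin 2) ℂ, H₀ * (H₀' * M * H₀ * X) = M * (H₀ * X) := by
    intro M X
    rw [← mul_assoc, ← mul_assoc, ← mul_assoc, hH, one_mul, mul_assoc]
  have hKc : ∀ X : Matrix (Fin 2) (Fin 2) ℂ,
      H₀ * (Matrix.diagonal ev * X) = L.K * (H₀ * X) := by
    intro X
    rw [← mul_assoc, hK, mul_assoc]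
  have hP' : ∀ m, H₀ * (P (m + 1)).2 * Matrix.diagonal ev - L.K * (H₀ * (P (m + 1)).2)
      = L.R * (H₀ * (P m).2) - H₀ * (P m).2 * Matrix.diagonal res + L.N * (H₀ * (P m).1)
        - (m : ℂ) • (H₀ * (P m).2) := by
    intro m
    have := congrArg (H₀ * ·) (hP m)
    simp only [mul_sub, mul_add, hcancel, hKc, mul_smul_comm, ← mul_assoc H₀ _ (Matrix.diagonal _)]
      at this
    exact this
  have hP0 : (P 0).2 = 1 := rfl
  have hP01 : (P 0).1 = 0 := rfl
  have hP1 : ∀ m, (P (m + 1)).1 = (P m).2 := fun m => rfl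
  refine ⟨hev, fun m => H₀ * (P m).2, ?_, ?_, ?_, fun m => ?_⟩
  · simp only [hP0, mul_one]
    rw [← Matrix.isUnit_iff_isUnit_det]
    exact IsUnit.of_mul_eq_one _ hH
  · simp only [hP0, mul_one, hK]
  · have := hP' 0
    rw [sub_eq_iff_eq_add] at this
    rw [this, hP01]
    simp only [mul_zero, Nat.cast_zero, zero_smul, sub_zero, add_zero]
    abel
  · have := hP' (m + 1)
    rw [sub_eq_iff_eq_add, hP1] at this
    rw [this]
    push_cast
    abel

end FormalNormalForm

/-! ### Existence of monodromy–Stokes data and their gauge invariance -/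

section MonodromyStokesData

variable {L L' : LinSystem} {ev ev' res res' evI evI' resI resI' : Fin 2 → ℂ} {α β : ℝ}

theorem LinSystem.isSolution_zero : L.IsSolution 0 := fun x => by
  simp

/-- A solution with a zero vanishes identically, whereas a column of a matrix that is invertible
near the vertex does not. -/
theorem LinSystem.IsCanonicalBasisAtZero.ne_zero {f : Fin 2 → ℂ → Fin 2 → ℂ}
    (hf : L.IsCanonicalBasisAtZero ev res α β f) (hgood : IsGoodSectorAtZero ev α β)
    (k : Fin 2) (x : ℂ) : f k x ≠ 0 := by
  intro h
  obtain ⟨φ, hφ, -⟩ := hgood.exists_ray 0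
  obtain ⟨hs, H, -, ⟨r, hr, hHc, hdet⟩, hfH⟩ := hf
  have h0 : f k = 0 := (hs k).eq_of_eq LinSystem.isSolution_zero h
  have hz0 : (0 : ℂ) ∈ closure (sector α β) :=
    mem_closure_iff_nhdsWithin_neBot.2 ((zero_mem_closure_sector hφ).neBot)
  have hunit := isUnit_mulVecCLM (hdet 0 ⟨hz0, Metric.mem_ball_self hr⟩)
  obtain ⟨y, hy⟩ := ((tendsto_mulVecCLM_along_ray hr hHc hφ).eventually
    (Units.isOpen.mem_nhds hunit)).exists
  obtain ⟨u, hu⟩ := hy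
  have h1 : mulVecCLM (H (Complex.exp (-(y : ℂ) + φ * Complex.I))) (Pi.single k 1) = 0 := by
    ext i
    have := hfH (-(y : ℂ) + φ * Complex.I) (by simpa using hφ.1) (by simpa using hφ.2) k i
    rw [h0] at this
    rw [mulVecCLM_apply, Matrix.mulVec_single_one]
    simpa [Complex.exp_ne_zero] using this.symm
  have h2 := congrArg (↑u⁻¹ : (Fin 2 → ℂ) →L[ℂ] (Fin 2 → ℂ)) h1
  rw [← hu, ← mul_apply_eq_comp, Units.inv_mul, one_apply_eq_self, map_zero] at h2
  have := congrFun h2 k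
  simp at this

theorem LinSystem.IsCanonicalBasisAtInfinity.ne_zero {f : Fin 2 → ℂ → Fin 2 → ℂ}
    (hf : L.IsCanonicalBasisAtInfinity ev res α β f) (hgood : IsGoodSectorAtInfinity ev α β)
    (k : Fin 2) (x : ℂ) : f k x ≠ 0 := by
  have := LinSystem.IsCanonicalBasisAtZero.ne_zero hf hgood.invert k (-x)
  rwa [neg_neg] at this

/-- Solutions with given initial data, and the monodromy operator. -/
theorem LinSystem.exists_solution_eq (x₀ : ℂ) (v : Fin 2 → ℂ) : ∃ Y, L.IsSolution Y ∧ Y x₀ = v := by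
  obtain ⟨Φ, Ψ, -, hd, -, hi⟩ := L.exists_fundamental
  refine ⟨fun x => Φ x (Ψ x₀ v), isSolution_iff.2 fun x => ?_, ?_⟩
  · exact ((hd x).clm_apply (hasDerivAt_const x (Ψ x₀ v))).congr_deriv (by simp)
  · simp only
    rw [← mul_apply_eq_comp, hi, one_apply_eq_self]

theorem LinSystem.exists_monodromy (x₀ x₁ : ℂ) :
    ∃ M : (Fin 2 → ℂ) ≃ₗ[ℂ] (Fin 2 → ℂ), ∀ Y, L.IsSolution Y → M (Y x₀) = Y x₁ := by
  obtain ⟨Φ, Ψ, -, hd, hi, hi'⟩ := L.exists_fundamental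
  have h1 : ∀ x v, Φ x (Ψ x v) = v := fun x v => by
    rw [← mul_apply_eq_comp, hi', one_apply_eq_self]
  have h2 : ∀ x v, Ψ x (Φ x v) = v := fun x v => by
    rw [← mul_apply_eq_comp, hi, one_apply_eq_self]
  refine ⟨LinearEquiv.ofLinearMap ((Φ x₁).toLinearMap ∘ₗ (Ψ x₀).toLinearMap)
    ((Φ x₀).toLinearMap ∘ₗ (Ψ x₁).toLinearMap) (by ext; simp [h1, h2]) (by ext; simp [h1, h2]),
    fun Y hY => ?_⟩
  have hZ : L.IsSolution fun x => Φ x (Ψ x₀ (Y x₀)) := isSolution_iff.2 fun x =>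
    ((hd x).clm_apply (hasDerivAt_const x (Ψ x₀ (Y x₀)))).congr_deriv (by simp)
  exact congrFun (hZ.eq_of_eq hY (x₀ := x₀) (h1 _ _)) x₁

theorem LinSystem.exists_monodromyStokesData (h₀ : L.IsFormalNormalFormAtZero ev res)
    (hI : L.IsFormalNormalFormAtInfinity evI resI) {c : StokesConfig}
    (hg₀ : IsGoodSectorAtZero ev c.α₀ c.β₀) (hgI : IsGoodSectorAtInfinity evI c.αInf c.βInf) :
    ∃ e, L.IsMonodromyStokesData ev res evI resI c e := by
  obtain ⟨f, hf⟩ := h₀.exists_canonicalBasis hg₀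
  obtain ⟨g, hg⟩ := hI.exists_canonicalBasis hgI.invert
  obtain ⟨M, hM⟩ := L.exists_monodromy c.base (c.base + 2 * Real.pi * Complex.I)
  exact ⟨⟨fun k => Projectivization.mk ℂ _ (hf.ne_zero hg₀ k c.base),
    fun k => Projectivization.mk ℂ _ (hg.ne_zero hgI k c.base), M⟩, f, g, hf, hg,
    fun k => ⟨_, rfl⟩, fun k => ⟨_, rfl⟩, hM⟩

theorem Projectivization.map_trans_apply (H H' : (Fin 2 → ℂ) ≃ₗ[ℂ] (Fin 2 → ℂ))
    (p : Projectivization ℂ (Fin 2 → ℂ)) :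
    Projectivization.map (H.trans H').toLinearMap (H.trans H').injective p
      = Projectivization.map H'.toLinearMap H'.injective
        (Projectivization.map H.toLinearMap H.injective p) := by
  induction p using Projectivization.ind with
  | h v hv => rfl

theorem MSTuple.Equivalent.trans {d e f : MSTuple} (h : d.Equivalent e) (h' : e.Equivalent f) :
    d.Equivalent f := by
  obtain ⟨H, h1, h2, h3⟩ := h
  obtain ⟨H', h1', h2', h3'⟩ := h'
  refine ⟨H.trans H', fun k => ?_, fun k => ?_, fun v => ?_⟩
  · rw [Projectivization.map_trans_apply, h1, h1']
  · rw [Projectivization.map_trans_apply, h2, h2']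
  · simp [h3, h3']

theorem MSTuple.Equivalent.symm {d e : MSTuple} (h : d.Equivalent e) : e.Equivalent d := by
  obtain ⟨H, h1, h2, h3⟩ := h
  have hid : ∀ p : Projectivization ℂ (Fin 2 → ℂ),
      Projectivization.map H.symm.toLinearMap H.symm.injective
        (Projectivization.map H.toLinearMap H.injective p) = p := by
    intro p
    induction p using Projectivization.ind with
    | h v hv =>
      simp only [Projectivization.map_mk]
      congr 1
      exact H.symm_apply_apply v
  refine ⟨H.symm, fun k => ?_, fun k => ?_, fun v => ?_⟩
  · rw [← h1, hid]
  · rw [← h2, hid]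
  · rw [LinearEquiv.symm_apply_eq, h3, LinearEquiv.apply_symm_apply]

/-- A single-valued gauge transformation with mild growth at the singular points identifies the
monodromy–Stokes data. -/
theorem exists_gauge_equivalent {c : StokesConfig}
    (hg₀ : IsGoodSectorAtZero ev c.α₀ c.β₀) (hgI : IsGoodSectorAtInfinity evI c.αInf c.βInf) :
    ∃ κ : ℝ, 0 < κ ∧ ∀ {L L' : LinSystem} {ev' evI' res res' resI resI' : Fin 2 → ℂ}
      {T : ℂ → (Fin 2 → ℂ) →L[ℂ] (Fin 2 → ℂ)} {ε : ℝ} {d e : MSTuple}, 0 ≤ ε → 2 * ε < κ →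
      (∀ j, ‖ev' j - ev j‖ ≤ ε) → (∀ j, ‖evI' j - evI j‖ ≤ ε) →
      (∀ Y, L.IsSolution Y → L'.IsSolution fun x => T x (Y x)) →
      (∀ x, T (x + 2 * Real.pi * Complex.I) = T x) → (∀ x, Function.Injective (T x)) →
      (∀ x, ‖T x‖ ≤ Real.exp (ε * (Real.exp (-x.re) + Real.exp x.re))) →
      L.IsMonodromyStokesData ev res evI resI c d →
      L'.IsMonodromyStokesData ev' res' evI' resI' c e → d.Equivalent e := by
  obtain ⟨κ, hκ, h₀⟩ := hg₀.exists_gauge_bound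
  obtain ⟨κ', hκ', hI⟩ := hgI.invert.exists_gauge_bound
  refine ⟨min κ κ', lt_min hκ hκ', ?_⟩
  rintro L L' ev' evI' res res' resI resI' T ε d e hε0 hε hev hevI hT hper hinj hb
    ⟨f, g, hf, hg, hfd, hgd, hM⟩ ⟨f', g', hf', hg', hfd', hgd', hM'⟩
  -- Near `z = 0` the growth allowed at infinity is harmless: `exp (ε |z|) ≤ exp ε` for `|z| ≤ 1`,
  -- whence the constant `C`.
  have hfline : ∀ k, ∃ b : ℂ, ∀ x, T x (f k x) = b • f' k x := by
    refine h₀ (C := Real.exp ε) hf hf' hT (hε.trans_le (min_le_left _ _)) hev fun x hx => ?_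
    refine (hb x).trans ?_
    rw [← Real.exp_add, Real.exp_le_exp]
    have : Real.exp x.re ≤ 1 := Real.exp_le_one_iff.2 hx
    nlinarith
  have hgline : ∀ k, ∃ b : ℂ, ∀ x, T (-x) (g k (-x)) = b • g' k (-x) := by
    refine hI (G := fun x => T (-x)) (C := Real.exp ε) hg hg' (fun Y hY => ?_)
      (hε.trans_le (min_le_right _ _)) (fun j => ?_) fun x hx => ?_
    · have h1 := hY.invert
      rw [LinSystem.invert_invert] at h1
      have h2 := (hT _ h1).invert
      simpa using h2
    · have := hevI j
      rw [← norm_neg] at this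
      have e : -(evI' j - evI j) = (-evI') j - (-evI) j := by
        rw [Pi.neg_apply, Pi.neg_apply]; ring
      rwa [e] at this
    · refine (hb (-x)).trans ?_
      rw [← Real.exp_add, Real.exp_le_exp, Complex.neg_re, neg_neg]
      have : Real.exp x.re ≤ 1 := Real.exp_le_one_iff.2 hx
      nlinarith
  have hmap : ∀ {v w : Fin 2 → ℂ} (hv : v ≠ 0) (hw : w ≠ 0) (b : ℂ), T c.base v = b • w →
      Projectivization.map (LinearEquiv.ofInjectiveEndo (T c.base).toLinearMap
        (hinj c.base)).toLinearMap (LinearEquiv.injective _) (Projectivization.mk ℂ v hv)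
        = Projectivization.mk ℂ w hw := by
    intro v w hv hw b h
    rw [Projectivization.map_mk, Projectivization.mk_eq_mk_iff']
    exact ⟨b, h.symm⟩
  refine ⟨LinearEquiv.ofInjectiveEndo (T c.base).toLinearMap (hinj c.base), fun k => ?_,
    fun k => ?_, fun v => ?_⟩
  · obtain ⟨h1, e1⟩ := hfd k
    obtain ⟨h2, e2⟩ := hfd' k
    obtain ⟨b, hb⟩ := hfline k
    rw [e1, e2]
    exact hmap h1 h2 b (hb _)
  · obtain ⟨h1, e1⟩ := hgd k
    obtain ⟨h2, e2⟩ := hgd' k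
    obtain ⟨b, hb⟩ := hgline k
    rw [e1, e2]
    refine hmap h1 h2 b ?_
    simpa using hb (-c.base)
  · obtain ⟨Y, hY, rfl⟩ := L.exists_solution_eq c.base v
    rw [hM Y hY]
    have := hM' _ (hT Y hY)
    -- Single-valuedness of the gauge transformation is what intertwines the two monodromy
    -- operators.
    rw [hper] at this
    exact this.symm

end MonodromyStokesData

/-! ### The Lax pair -/

section Lax

theorem mulVecCLM_eq_sum (M : Matrix (Fin 2) (Fin 2) ℂ) :
    mulVecCLM M = ∑ i, ∑ j, M i j • mulVecCLM (Matrix.single i j 1) := by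
  conv_lhs => rw [Matrix.matrix_eq_sum_single M]
  simp only [map_sum, ← map_smul, Matrix.smul_single, smul_eq_mul, mul_one]

theorem hasDerivAt_mulVecCLM {M : ℂ → Matrix (Fin 2) (Fin 2) ℂ}
    {M' : Matrix (Fin 2) (Fin 2) ℂ} {t : ℂ}
    (h : ∀ i j, HasDerivAt (fun t => M t i j) (M' i j) t) :
    HasDerivAt (fun t => mulVecCLM (M t)) (mulVecCLM M') t := by
  simp only [mulVecCLM_eq_sum (M _), mulVecCLM_eq_sum M']
  exact HasDerivAt.fun_sum fun i _ => HasDerivAt.fun_sum fun j _ => 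
    (h i j).smul_const (mulVecCLM (Matrix.single i j 1))

theorem hasDerivAt_mulVecCLM_real {M : ℝ → Matrix (Fin 2) (Fin 2) ℂ}
    {M' : Matrix (Fin 2) (Fin 2) ℂ} {t : ℝ}
    (h : ∀ i j, HasDerivAt (fun t => M t i j) (M' i j) t) :
    HasDerivAt (fun t => mulVecCLM (M t)) (mulVecCLM M') t := by
  simp only [mulVecCLM_eq_sum (M _), mulVecCLM_eq_sum M']
  exact HasDerivAt.fun_sum fun i _ => HasDerivAt.fun_sum fun j _ => 
    (h i j).smul_const (mulVecCLM (Matrix.single i j 1))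

/-- The operator of the system in the logarithmic coordinate, with `z = exp x`. -/
def torusMatrix (s χ a ℓ z : ℂ) : Matrix (Fin 2) (Fin 2) ℂ :=
  !![-s / 2 * z⁻¹ - (ℓ + χ * a) - s / 2 * z, -s * χ * z⁻¹ - a / 2; a / 2 + s * χ * z, χ * a]

theorem torusSystem_logCoeff (s χ a ℓ : ℝ) (x : ℂ) :
    (torusSystem (s, χ, a, ℓ)).logCoeff x = mulVecCLM (torusMatrix s χ a ℓ (Complex.exp x)) := by
  rw [LinSystem.logCoeff, ← map_smul, ← map_smul, ← map_add, ← map_add]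
  congr 1
  ext i j
  fin_cases i <;> fin_cases j <;> simp [torusSystem, torusMatrix, Complex.exp_neg] <;> ring

/-- The operator of the auxiliary equation of the Lax pair. -/
def laxMatrix (s χ a z : ℂ) : Matrix (Fin 2) (Fin 2) ℂ :=
  !![z⁻¹ / 2 - z / 2, χ * z⁻¹ - a / (2 * s); χ * z - a / (2 * s), 0]

theorem hasDerivAt_laxMatrix (s χ a x : ℂ) :
    HasDerivAt (fun x => mulVecCLM (laxMatrix s χ a (Complex.exp x)))
      (mulVecCLM !![-(Complex.exp x)⁻¹ / 2 - Complex.exp x / 2, -χ * (Complex.exp x)⁻¹;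
        χ * Complex.exp x, 0]) x := by
  have h1 : HasDerivAt (fun x => (Complex.exp x)⁻¹) (-(Complex.exp x)⁻¹) x := by
    simp only [← Complex.exp_neg]
    simpa using (hasDerivAt_neg x).cexp
  have h2 := Complex.hasDerivAt_exp x
  refine hasDerivAt_mulVecCLM fun i j => ?_
  fin_cases i <;> fin_cases j
  · exact ((h1.div_const 2).sub (h2.div_const 2)).congr_deriv (by simp)
  · exact ((h1.const_mul χ).sub_const _).congr_deriv (by simp)
  · exact ((h2.const_mul χ).sub_const _).congr_deriv (by simp)
  · simpa [laxMatrix] using hasDerivAt_const x (0 : ℂ)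

variable {J : Set ℝ} {χ a ℓ : ℝ → ℝ} {s s₀ : ℝ}

theorem IsIsomSolution.pos (h : IsIsomSolution J χ a ℓ) (hs : s ∈ J) : 0 < s :=
  (h.mem_paramSpace s hs).1

/-- The Lax equation. -/
theorem IsIsomSolution.hasDerivAt_logCoeff (h : IsIsomSolution J χ a ℓ) (hs : s ∈ J) (x : ℂ) :
    HasDerivAt (fun s => (torusSystem (s, χ s, a s, ℓ s)).logCoeff x)
      (deriv (fun x => mulVecCLM (laxMatrix s (χ s) (a s) (Complex.exp x))) x
        + mulVecCLM (laxMatrix s (χ s) (a s) (Complex.exp x))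
          * (torusSystem (s, χ s, a s, ℓ s)).logCoeff x
        - (torusSystem (s, χ s, a s, ℓ s)).logCoeff x
          * mulVecCLM (laxMatrix s (χ s) (a s) (Complex.exp x))) s := by
  have hs0 : (s : ℂ) ≠ 0 := Complex.ofReal_ne_zero.2 (h.pos hs).ne'
  have hz := Complex.exp_ne_zero x
  rw [(hasDerivAt_laxMatrix _ _ _ x).deriv]
  simp only [torusSystem_logCoeff, ← map_mul, ← map_add, ← map_sub]
  set z := Complex.exp x
  have d1 : HasDerivAt (fun s : ℝ => (s : ℂ)) 1 s := (hasDerivAt_id s).ofReal_comp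
  have d2 := (h.deriv_χ s hs).ofReal_comp
  have d3 := (h.deriv_a s hs).ofReal_comp
  have d4 := (h.deriv_ℓ s hs).ofReal_comp
  have dχa := d2.mul d3
  have ds2 := d1.neg.div_const 2
  have ds2' := d1.div_const 2
  -- The trace of the equation is `ℓ' = 0`, commutators being traceless. The entry `(1, 1)` is `(χ
  -- a)' = a² / (2 s) - 2 s χ²`, a consequence of (2), and the off-diagonal entries involve `(s χ)'`
  -- and `a'`.
  refine hasDerivAt_mulVecCLM_real fun i j => ?_
  fin_cases i <;> fin_cases j
  · refine (((ds2.mul_const z⁻¹).sub (d4.add dχa)).sub (ds2'.mul_const z)).congr_deriv ?_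
    simp [torusMatrix, laxMatrix]
    field_simp
    ring
  · refine (((d1.neg.mul d2).mul_const z⁻¹).sub (d3.div_const 2)).congr_deriv ?_
    simp [torusMatrix, laxMatrix]
    field_simp
    ring
  · refine ((d3.div_const 2).add ((d1.mul d2).mul_const z)).congr_deriv ?_
    simp [torusMatrix, laxMatrix]
    field_simp
    ring
  · refine dχa.congr_deriv ?_
    simp [torusMatrix, laxMatrix]
    field_simp
    ring

theorem IsIsomSolution.continuousOn (h : IsIsomSolution J χ a ℓ) :
    ContinuousOn χ J ∧ ContinuousOn a J :=
  ⟨fun s hs => (h.deriv_χ s hs).continuousAt.continuousWithinAt,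
    fun s hs => (h.deriv_a s hs).continuousAt.continuousWithinAt⟩

theorem IsIsomSolution.continuousOn_lax (h : IsIsomSolution J χ a ℓ) :
    ContinuousOn (fun p : ℝ × ℂ => mulVecCLM (laxMatrix p.1 (χ p.1) (a p.1) p.2))
      (J ×ˢ {z | z ≠ 0}) := by
  refine continuous_mulVecCLM.comp_continuousOn (continuousOn_pi.2 fun i => continuousOn_pi.2
    fun j => ?_)
  have h1 : ContinuousOn (fun p : ℝ × ℂ => (χ p.1 : ℂ)) (J ×ˢ {z | z ≠ 0}) :=
    Complex.continuous_ofReal.comp_continuousOn (h.continuousOn.1.comp continuousOn_fst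
      fun p hp => hp.1)
  have h2 : ContinuousOn (fun p : ℝ × ℂ => (a p.1 : ℂ)) (J ×ˢ {z | z ≠ 0}) :=
    Complex.continuous_ofReal.comp_continuousOn (h.continuousOn.2.comp continuousOn_fst
      fun p hp => hp.1)
  have h3 : ContinuousOn (fun p : ℝ × ℂ => (a p.1 : ℂ) / (2 * p.1)) (J ×ˢ {z | z ≠ 0}) :=
    h2.div (by fun_prop) fun p hp => mul_ne_zero two_ne_zero
      (Complex.ofReal_ne_zero.2 (h.pos hp.1).ne')
  have h4 : ContinuousOn (fun p : ℝ × ℂ => p.2⁻¹) (J ×ˢ {z | z ≠ 0}) :=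
    continuousOn_snd.inv₀ fun p hp => hp.2
  fin_cases i <;> fin_cases j
  · exact (h4.div_const 2).sub (continuousOn_snd.div_const 2)
  · exact (h1.mul h4).sub h3
  · exact (h1.mul continuousOn_snd).sub h3
  · exact continuousOn_const

/-- The constant terms are absorbed since `‖z‖⁻¹ + ‖z‖ ≥ 1`. Because the poles at both singular
points are simple, the transport grows only like the exponential of a multiple of this sum. -/
theorem norm_mulVecCLM_laxMatrix_le (s χ a : ℂ) {z : ℂ} (hz : z ≠ 0) :
    ‖mulVecCLM (laxMatrix s χ a z)‖ ≤
      (∑ i, ∑ j, ‖mulVecCLM (Matrix.single i j (1 : ℂ))‖) * (1 + ‖χ‖ + ‖a / (2 * s)‖)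
        * (‖z‖⁻¹ + ‖z‖) := by
  have hz0 := norm_pos_iff.2 hz
  have h1 : 1 ≤ ‖z‖⁻¹ + ‖z‖ := by
    rcases le_total 1 ‖z‖ with h | h
    · have : 0 < ‖z‖⁻¹ := by positivity
      linarith
    · have := one_le_inv_iff₀.2 ⟨hz0, h⟩
      linarith
  have hent : ∀ i j, ‖laxMatrix s χ a z i j‖ ≤ (1 + ‖χ‖ + ‖a / (2 * s)‖) * (‖z‖⁻¹ + ‖z‖) := by
    have hχ := norm_nonneg χ
    have ha := norm_nonneg (a / (2 * s))
    have hi : 0 < ‖z‖⁻¹ := by positivity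
    intro i j
    fin_cases i <;> fin_cases j
    · refine (norm_sub_le _ _).trans ?_
      rw [norm_div, norm_div, norm_inv, Complex.norm_ofNat]
      nlinarith
    · refine (norm_sub_le _ _).trans ?_
      rw [norm_mul, norm_inv]
      nlinarith
    · refine (norm_sub_le _ _).trans ?_
      rw [norm_mul]
      nlinarith
    · simp only [laxMatrix]
      simp
      positivity
  rw [mulVecCLM_eq_sum (laxMatrix s χ a z), mul_assoc, Finset.sum_mul]
  refine (norm_sum_le _ _).trans (Finset.sum_le_sum fun i _ => ?_)
  rw [Finset.sum_mul]
  refine (norm_sum_le _ _).trans (Finset.sum_le_sum fun j _ => ?_)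
  rw [norm_smul, mul_comm]
  gcongr
  exact hent i j

theorem smul_lax_eq (δ : ℝ) (D Λ A : (Fin 2 → ℂ) →L[ℂ] (Fin 2 → ℂ)) :
    δ • (D + Λ * A - A * Λ) = (δ : ℂ) • D + ((δ : ℂ) • Λ) * A - A * ((δ : ℂ) • Λ) := by
  ext v i
  simp
  ring

/-- Nearby systems of a solution are related by a single-valued gauge transformation whose growth
at the singular points is mild. -/
theorem IsIsomSolution.exists_gauge (h : IsIsomSolution J χ a ℓ) (hs₀ : s₀ ∈ J) {ε : ℝ}
    (hε : 0 < ε) :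
    ∀ᶠ s in 𝓝 s₀, ∃ T : ℂ → (Fin 2 → ℂ) →L[ℂ] (Fin 2 → ℂ),
      (∀ Y, (torusSystem (s₀, χ s₀, a s₀, ℓ s₀)).IsSolution Y →
        (torusSystem (s, χ s, a s, ℓ s)).IsSolution fun x => T x (Y x)) ∧
      (∀ x, T (x + 2 * Real.pi * Complex.I) = T x) ∧ (∀ x, Function.Injective (T x)) ∧
      ∀ x, ‖T x‖ ≤ Real.exp (ε * (Real.exp (-x.re) + Real.exp x.re)) := by
  obtain ⟨r, hr, hrJ⟩ := Metric.nhds_basis_closedBall.mem_iff.1 (h.isOpen.mem_nhds hs₀)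
  set S : ℝ := ∑ i : Fin 2, ∑ j : Fin 2, ‖mulVecCLM (Matrix.single i j (1 : ℂ))‖
  have hS : 0 ≤ S := Finset.sum_nonneg fun i _ => Finset.sum_nonneg fun j _ => norm_nonneg _
  obtain ⟨B, hB⟩ := (isCompact_closedBall s₀ r).exists_bound_of_continuousOn
    (f := fun s => S * (1 + ‖(χ s : ℂ)‖ + ‖(a s : ℂ) / (2 * s)‖)) (by
      have h1 := h.continuousOn.1.mono hrJ
      have h2 := h.continuousOn.2.mono hrJ
      have h1' := Complex.continuous_ofReal.comp_continuousOn h1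
      have h2' := Complex.continuous_ofReal.comp_continuousOn h2
      exact continuousOn_const.mul ((continuousOn_const.add h1'.norm).add
        (h2'.div (by fun_prop) fun s hs => mul_ne_zero two_ne_zero
          (Complex.ofReal_ne_zero.2 (h.pos (hrJ hs)).ne')).norm))
  have hB0 : 0 ≤ B := (norm_nonneg _).trans (hB s₀ (Metric.mem_closedBall_self hr.le))
  -- The transport over a time `|s - s₀|` has growth exponent at most `|s - s₀| * B`.
  have hnear : ∀ᶠ s in 𝓝 s₀, |s - s₀| * B ≤ ε := by
    have : Tendsto (fun s => |s - s₀| * B) (𝓝 s₀) (𝓝 (|s₀ - s₀| * B)) :=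
      Continuous.tendsto (by fun_prop) _
    rw [sub_self, abs_zero, zero_mul] at this
    exact this.eventually_le_const hε
  filter_upwards [Metric.closedBall_mem_nhds s₀ hr, hnear] with s hs hsε
  set δ : ℝ := s - s₀
  let σ : ℝ → ℝ := fun τ => s₀ + τ * δ
  have hσ : ∀ τ ∈ Icc (0 : ℝ) 1, σ τ ∈ Metric.closedBall s₀ r := by
    intro τ hτ
    rw [mem_closedBall_iff_norm] at hs ⊢
    simp only [σ, add_sub_cancel_left, Real.norm_eq_abs, abs_mul, abs_of_nonneg hτ.1]
    calc τ * |δ| ≤ 1 * |δ| := by gcongr; exact hτ.2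
      _ ≤ r := by rw [one_mul]; exact hs
  have hσd : ∀ τ, HasDerivAt σ δ τ := fun τ =>
    (((hasDerivAt_id τ).mul_const δ).const_add s₀).congr_deriv (one_mul _)
  have hσc : Continuous σ := by fun_prop
  let V : ℝ → ℂ → (Fin 2 → ℂ) →L[ℂ] (Fin 2 → ℂ) := fun τ z =>
    (δ : ℂ) • mulVecCLM (laxMatrix (σ τ) (χ (σ τ)) (a (σ τ)) z)
  have hVc : ContinuousOn (Function.uncurry V) (Icc 0 1 ×ˢ {z | z ≠ 0}) := by
    refine ContinuousOn.const_smul ?_ (δ : ℂ)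
    exact h.continuousOn_lax.comp (f := fun p : ℝ × ℂ => (σ p.1, p.2)) (by fun_prop)
      fun p hp => ⟨hrJ (hσ _ hp.1), hp.2⟩
  -- The transport is chosen as a function of `z` rather than of `x`, which makes it single-valued.
  choose! P Q hP0 hP hQP hPb using fun (z : ℂ) (hz : z ≠ 0) =>
    exists_transport (U := fun τ => V τ z) (hVc.comp (f := fun τ : ℝ => (τ, z)) (by fun_prop)
      fun τ hτ => ⟨hτ, hz⟩)
  have hne := Complex.exp_ne_zero
  have h1 : (1 : ℝ) ∈ Icc (0 : ℝ) 1 := by simp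
  have hT := hasDerivAt_transport_of_flat (U := fun τ x => V τ (Complex.exp x))
    (A := fun τ x => (torusSystem (σ τ, χ (σ τ), a (σ τ), ℓ (σ τ))).logCoeff x)
    (P := fun x => P (Complex.exp x))
    (hVc.comp (f := fun p : ℝ × ℂ => (p.1, Complex.exp p.2)) (by fun_prop)
      fun p hp => ⟨hp.1, hne _⟩)
    (fun τ hτ x => ((hasDerivAt_laxMatrix _ _ _ x).differentiableAt.const_smul (δ : ℂ)))
    (fun x τ hτ => by
      have h2 := ((h.hasDerivAt_logCoeff (hrJ (hσ τ hτ)) x).scomp τ (hσd τ)).hasDerivWithinAt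
        (s := Icc 0 1)
      refine h2.congr_deriv ?_
      have h3 : deriv (fun x => V τ (Complex.exp x)) x = (δ : ℂ) • deriv (fun x => mulVecCLM
          (laxMatrix (σ τ) (χ (σ τ)) (a (σ τ)) (Complex.exp x))) x :=
        ((hasDerivAt_laxMatrix _ _ _ x).differentiableAt.hasDerivAt.const_smul (δ : ℂ)).deriv
      rw [h3]
      exact smul_lax_eq δ _ _ _)
    (fun x => hP0 _ (hne x)) (fun x => hP _ (hne x))
  have hσ0 : σ 0 = s₀ := by simp [σ]
  have hσ1 : σ 1 = s := by simp [σ, δ]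
  refine ⟨fun x => P (Complex.exp x) 1, fun Y hY => ?_, fun x => ?_, fun x => ?_, fun x => ?_⟩
  · rw [LinSystem.isSolution_iff] at hY ⊢
    intro x
    have h2 := (hT x h1).clm_apply (hY x)
    simp only [hσ0, hσ1] at h2
    refine h2.congr_deriv ?_
    simp
  · simp only
    rw [Complex.exp_periodic]
  · refine Function.LeftInverse.injective (g := Q (Complex.exp x) 1) fun v => ?_
    rw [← mul_apply_eq_comp, hQP _ (hne x) 1 h1, one_apply_eq_self]
  · refine (hPb _ (hne x) (ε * (Real.exp (-x.re) + Real.exp x.re)) (fun τ hτ => ?_) 1 h1).trans ?_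
    · have h2 := norm_mulVecCLM_laxMatrix_le (σ τ) (χ (σ τ)) (a (σ τ)) (hne x)
      rw [Complex.norm_exp, ← Real.exp_neg] at h2
      have h3 := (le_abs_self _).trans (hB _ (hσ τ hτ))
      rw [norm_smul, Complex.norm_real, Real.norm_eq_abs]
      calc _ ≤ |δ| * (B * (Real.exp (-x.re) + Real.exp x.re)) := by
            gcongr
            exact h2.trans (by gcongr)
        _ = (|δ| * B) * (Real.exp (-x.re) + Real.exp x.re) := by ring
        _ ≤ _ := by gcongr
    · rw [norm_one, one_mul, mul_one]

end Lax

/-! ### Isomonodromy along solutions -/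

section Isomonodromy

variable {J : Set ℝ} {χ a ℓ : ℝ → ℝ}

/-- The entry `b = ℓ + χ a` makes the diagonal of the residue in this eigenbasis equal to `(-ℓ, 0)`;
the same happens at infinity. -/
theorem torusSystem_normalForm_zero {s χ a ℓ : ℝ} (hs : 0 < s) :
    (torusSystem (s, χ, a, ℓ)).IsFormalNormalFormAtZero ![-(s : ℂ) / 2, 0] ![-(ℓ : ℂ), 0] := by
  have hs0 : (s : ℂ) ≠ 0 := Complex.ofReal_ne_zero.2 hs.ne'
  refine LinSystem.isFormalNormalFormAtZero_of_eigenbasis (H₀ := !![1, -2 * (χ : ℂ); 0, 1])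
    (H₀' := !![1, 2 * (χ : ℂ); 0, 1]) (by simpa using hs0) ?_ ?_ fun i => ?_
  · ext i j
    fin_cases i <;> fin_cases j <;> simp
  · ext i j
    fin_cases i <;> fin_cases j <;> simp [torusSystem, Matrix.mul_apply, Matrix.diagonal]
    all_goals ring
  · fin_cases i <;> simp [torusSystem, Matrix.mul_apply]
    all_goals ring

theorem torusSystem_normalForm_infinity {s χ a ℓ : ℝ} (hs : 0 < s) :
    (torusSystem (s, χ, a, ℓ)).IsFormalNormalFormAtInfinity ![-(s : ℂ) / 2, 0] ![-(ℓ : ℂ), 0] := by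
  have hs0 : (s : ℂ) ≠ 0 := Complex.ofReal_ne_zero.2 hs.ne'
  refine LinSystem.isFormalNormalFormAtZero_of_eigenbasis (H₀ := !![1, 0; -2 * (χ : ℂ), 1])
    (H₀' := !![1, 0; 2 * (χ : ℂ), 1]) (by simpa using hs0) ?_ ?_ fun i => ?_
  · ext i j
    fin_cases i <;> fin_cases j <;> simp
  · ext i j
    fin_cases i <;> fin_cases j <;>
      simp [LinSystem.invert, torusSystem, Matrix.mul_apply, Matrix.diagonal]
    all_goals ring
  · fin_cases i <;> simp [LinSystem.invert, torusSystem, Matrix.mul_apply]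
    all_goals ring

theorem IsIsomSolution.eq_ℓ (h : IsIsomSolution J χ a ℓ) {s s' : ℝ} (hs : s ∈ J) (hs' : s' ∈ J) :
    ℓ s = ℓ s' :=
  h.isOpen.is_const_of_deriv_eq_zero h.isConnected.isPreconnected
    (fun x hx => (h.deriv_ℓ x hx).differentiableAt.differentiableWithinAt)
    (fun x hx => (h.deriv_ℓ x hx).deriv) hs hs'

/-- The family of systems along a solution is isomonodromic. -/
theorem IsIsomSolution.isIsomonodromic (h : IsIsomSolution J χ a ℓ)
    {A : Set (ℝ × ℝ × ℝ × ℝ)} (hA : A = (fun s => (s, χ s, a s, ℓ s)) '' J) :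
    IsIsomonodromic (fun p : A => torusSystem p) := by
  obtain ⟨s₀, hs₀⟩ := h.isConnected.nonempty
  have hrep : ∀ p : A, (p : ℝ × ℝ × ℝ × ℝ).1 ∈ J ∧ (p : ℝ × ℝ × ℝ × ℝ)
      = (p.1.1, χ p.1.1, a p.1.1, ℓ p.1.1) := by
    rintro ⟨p, hp⟩
    rw [hA] at hp
    obtain ⟨s, hs, rfl⟩ := hp
    exact ⟨hs, rfl⟩
  let ev : ℝ → Fin 2 → ℂ := fun s => ![-(s : ℂ) / 2, 0]
  let res : Fin 2 → ℂ := ![-(ℓ s₀ : ℂ), 0]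
  have h0 : ∀ s ∈ J, (torusSystem (s, χ s, a s, ℓ s)).IsFormalNormalFormAtZero (ev s) res := by
    intro s hs
    simp only [res, ← h.eq_ℓ hs hs₀]
    exact torusSystem_normalForm_zero (h.pos hs)
  have hI : ∀ s ∈ J, (torusSystem (s, χ s, a s, ℓ s)).IsFormalNormalFormAtInfinity (ev s) res := by
    intro s hs
    simp only [res, ← h.eq_ℓ hs hs₀]
    exact torusSystem_normalForm_infinity (h.pos hs)
  have hratio : ∀ i j : A, ∃ t : ℝ, 0 < t ∧ ev i.1.1 0 - ev i.1.1 1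
      = t * (ev j.1.1 0 - ev j.1.1 1) := by
    intro i j
    have hi := h.pos (hrep i).1
    have hj := h.pos (hrep j).1
    refine ⟨i.1.1 / j.1.1, div_pos hi hj, ?_⟩
    have : (j.1.1 : ℂ) ≠ 0 := Complex.ofReal_ne_zero.2 hj.ne'
    simp [ev]
    field_simp
  refine ⟨fun p => ev p.1.1, fun p => ev p.1.1, res, res, fun p => ?_, fun p => ?_, hratio, hratio,
    fun c hc0 hcI => ?_⟩
  · change LinSystem.IsFormalNormalFormAtZero (torusSystem p.1) _ _
    rw [(hrep p).2]
    exact h0 _ (hrep p).1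
  · change LinSystem.IsFormalNormalFormAtInfinity (torusSystem p.1) _ _
    rw [(hrep p).2]
    exact hI _ (hrep p).1
  have hg0 : ∀ s ∈ J, IsGoodSectorAtZero (ev s) c.α₀ c.β₀ := fun s hs =>
    hc0 ⟨(s, χ s, a s, ℓ s), hA ▸ mem_image_of_mem _ hs⟩
  have hgI : ∀ s ∈ J, IsGoodSectorAtInfinity (ev s) c.αInf c.βInf := fun s hs =>
    hcI ⟨(s, χ s, a s, ℓ s), hA ▸ mem_image_of_mem _ hs⟩
  let D : ℝ → MSTuple → Prop := fun s e =>
    (torusSystem (s, χ s, a s, ℓ s)).IsMonodromyStokesData (ev s) res (ev s) res c e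
  have hex : ∀ s ∈ J, ∃ e, D s e := fun s hs =>
    LinSystem.exists_monodromyStokesData (h0 s hs) (hI s hs) (hg0 s hs) (hgI s hs)
  have hall : ∀ s ∈ J, ∀ s' ∈ J, ∀ e e', D s e → D s' e' → e.Equivalent e' := by
    intro s hs s' hs'
    -- Equivalence of the data is an equivalence relation between members of the leaf, so it
    -- suffices to check it for nearby parameters. Transitivity uses the existence of data at the
    -- intermediate parameter.
    refine h.isConnected.isPreconnected.induction₂ (fun s s' => ∀ e e', D s e → D s' e' →
      e.Equivalent e') (fun s hs => ?_) (fun s t u hs ht hu hst htu e e' he he' => ?_)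
      (fun s t hs ht hst e e' he he' => (hst e' e he' he).symm) hs hs'
    · obtain ⟨κ, hκ, H⟩ := exists_gauge_equivalent (hg0 s hs) (hgI s hs)
      -- Any `ε` with `2 ε < κ` serves both for the growth of the gauge and for the shift of the
      -- eigenvalues.
      have hε : 0 < κ / 4 := by linarith
      have hev : ∀ᶠ t in 𝓝 s, ∀ j, ‖ev t j - ev s j‖ ≤ κ / 4 := by
        rw [eventually_all]
        intro j
        have hc : Continuous fun t => ‖ev t j - ev s j‖ := by
          fin_cases j
          · simp only [ev]; simp; fun_prop
          · simp only [ev]; simp; fun_prop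
        have := hc.tendsto s
        rw [sub_self, norm_zero] at this
        exact this.eventually_le_const hε
      filter_upwards [mem_nhdsWithin_of_mem_nhds (h.exists_gauge hs hε),
        mem_nhdsWithin_of_mem_nhds hev] with t ⟨T, hT1, hT2, hT3, hT4⟩ ht e e' he he'
      exact H hε.le (by linarith) ht ht hT1 hT2 hT3 hT4 he he'
    · obtain ⟨d, hd⟩ := hex t ht
      exact (hst e d he hd).trans (htu d e' hd he')
  obtain ⟨d, hd⟩ := hex s₀ hs₀
  refine ⟨d, fun p => ?_⟩
  change (∃ e, (torusSystem p.1).IsMonodromyStokesData (ev p.1.1) res (ev p.1.1) res c e) ∧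
    ∀ e, (torusSystem p.1).IsMonodromyStokesData (ev p.1.1) res (ev p.1.1) res c e → _
  rw [(hrep p).2]
  exact ⟨hex _ (hrep p).1, fun e he => hall s₀ hs₀ _ (hrep p).1 d e hd he⟩

end Isomonodromy

/-! ### Maximal solutions and the leaves -/

section IsomCurves

theorem HasDerivAt.fst_prod {E F : Type*} [NormedAddCommGroup E] [NormedSpace ℝ E]
    [NormedAddCommGroup F] [NormedSpace ℝ F] {f : ℝ → E × F} {f' : E × F} {x : ℝ}
    (h : HasDerivAt f f' x) : HasDerivAt (fun x => (f x).1) f'.1 x :=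
  (ContinuousLinearMap.fst ℝ E F).hasFDerivAt.comp_hasDerivAt x h

theorem HasDerivAt.snd_prod {E F : Type*} [NormedAddCommGroup E] [NormedSpace ℝ E]
    [NormedAddCommGroup F] [NormedSpace ℝ F] {f : ℝ → E × F} {f' : E × F} {x : ℝ}
    (h : HasDerivAt f f' x) : HasDerivAt (fun x => (f x).2) f'.2 x :=
  (ContinuousLinearMap.snd ℝ E F).hasFDerivAt.comp_hasDerivAt x h

/-- The vector field on the space of parameters whose integral curves are the graphs of
solutions. -/
def isomField (p : ℝ × ℝ × ℝ × ℝ) : ℝ × ℝ × ℝ × ℝ :=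
  (1, (p.2.2.1 - 2 * p.2.1 * (p.2.2.2 + 2 * p.2.1 * p.2.2.1)) / (2 * p.1),
    -2 * p.1 * p.2.1 + p.2.2.1 / p.1 * (p.2.2.2 + 2 * p.2.1 * p.2.2.1), 0)

/-- The parametrized graph of a solution. -/
structure IsIsomCurve (J : Set ℝ) (γ : ℝ → ℝ × ℝ × ℝ × ℝ) : Prop where
  isOpen : IsOpen J
  isConnected : IsConnected J
  fst_eq : ∀ s ∈ J, (γ s).1 = s
  mem_paramSpace : ∀ s ∈ J, γ s ∈ paramSpace
  hasDerivAt : ∀ s ∈ J, HasDerivAt γ (isomField (γ s)) s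

variable {J J' : Set ℝ} {γ γ' : ℝ → ℝ × ℝ × ℝ × ℝ} {χ a ℓ : ℝ → ℝ} {p : ℝ × ℝ × ℝ × ℝ}

theorem IsIsomSolution.isIsomCurve (h : IsIsomSolution J χ a ℓ) :
    IsIsomCurve J fun s => (s, χ s, a s, ℓ s) where
  isOpen := h.isOpen
  isConnected := h.isConnected
  fst_eq _ _ := rfl
  mem_paramSpace := h.mem_paramSpace
  hasDerivAt s hs := (hasDerivAt_id s).prodMk
    ((h.deriv_χ s hs).prodMk ((h.deriv_a s hs).prodMk (h.deriv_ℓ s hs)))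

theorem IsIsomCurve.isIsomSolution (h : IsIsomCurve J γ) :
    IsIsomSolution J (fun s => (γ s).2.1) (fun s => (γ s).2.2.1) fun s => (γ s).2.2.2 := by
  have h2 : ∀ s ∈ J, HasDerivAt (fun s => (γ s).2) (isomField (γ s)).2 s := fun s hs =>
    (h.hasDerivAt s hs).snd_prod
  have h3 : ∀ s ∈ J, HasDerivAt (fun s => (γ s).2.2) (isomField (γ s)).2.2 s := fun s hs =>
    (h2 s hs).snd_prod
  refine ⟨h.isOpen, h.isConnected, fun s hs => ?_, fun s hs => ?_, fun s hs => ?_, fun s hs => ?_⟩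
  · have := h.mem_paramSpace s hs
    rw [paramSpace, mem_ofPred_eq, h.fst_eq s hs] at this
    exact this
  · refine (h2 s hs).fst_prod.congr_deriv ?_
    simp only [isomField, h.fst_eq s hs]
  · refine (h3 s hs).fst_prod.congr_deriv ?_
    simp only [isomField, h.fst_eq s hs]
  · exact (h3 s hs).snd_prod

theorem IsIsomCurve.continuousOn (h : IsIsomCurve J γ) : ContinuousOn γ J := fun s hs =>
  (h.hasDerivAt s hs).continuousAt.continuousWithinAt

theorem contDiffAt_isomField {n : WithTop ℕ∞} (hp : p.1 ≠ 0) : ContDiffAt ℝ n isomField p := by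
  unfold isomField
  fun_prop (disch := simpa using hp)

theorem isOpen_paramSpace : IsOpen paramSpace :=
  (isOpen_lt continuous_const continuous_fst).inter
    (isOpen_ne.preimage (by fun_prop : Continuous fun p : ℝ × ℝ × ℝ × ℝ => (p.2.2.1, p.2.1)))

/-- Two solutions which coincide at a point coincide on the intersection of their domains. -/
theorem IsIsomCurve.eqOn (h : IsIsomCurve J γ) (h' : IsIsomCurve J' γ') {t : ℝ} (ht : t ∈ J)
    (ht' : t ∈ J') (heq : γ t = γ' t) : EqOn γ γ' (J ∩ J') := by
  have hpre : IsPreconnected (J ∩ J') :=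
    (h.isConnected.isPreconnected.ordConnected.inter
      h'.isConnected.isPreconnected.ordConnected).isPreconnected
  have hop := h.isOpen.inter h'.isOpen
  intro u hu
  -- Coincidence is a locally constant property: uniqueness for the differential equation at points
  -- of agreement, continuity at the others.
  refine (hpre.induction₂ (fun x y => γ x = γ' x ↔ γ y = γ' y) (fun x hx => ?_)
    (fun _ _ _ _ _ _ h1 h2 => h1.trans h2) (fun _ _ _ _ h1 => h1.symm) ⟨ht, ht'⟩ hu).1 heq
  refine eventually_nhdsWithin_of_eventually_nhds ?_
  by_cases hxe : γ x = γ' x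
  · obtain ⟨K, S, hS, hK⟩ := (contDiffAt_isomField (n := 1)
      (h.mem_paramSpace x hx.1).1.ne').exists_lipschitzOnWith
    have h1 : ∀ᶠ y in 𝓝 x, HasDerivAt γ (isomField (γ y)) y ∧ γ y ∈ S := by
      filter_upwards [h.isOpen.mem_nhds hx.1,
        (h.hasDerivAt x hx.1).continuousAt.preimage_mem_nhds hS] with y hy hyS
      exact ⟨h.hasDerivAt y hy, hyS⟩
    have h2 : ∀ᶠ y in 𝓝 x, HasDerivAt γ' (isomField (γ' y)) y ∧ γ' y ∈ S := by
      filter_upwards [h'.isOpen.mem_nhds hx.2,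
        (h'.hasDerivAt x hx.2).continuousAt.preimage_mem_nhds (hxe ▸ hS)] with y hy hyS
      exact ⟨h'.hasDerivAt y hy, hyS⟩
    filter_upwards [ODE_solution_unique_of_eventually (v := fun _ => isomField) (s := fun _ => S)
      (Eventually.of_forall fun _ => hK) h1 h2 hxe] with y hy
    exact ⟨fun _ => hy, fun _ => hxe⟩
  · filter_upwards [((h.hasDerivAt x hx.1).continuousAt.ne_iff_eventually_ne
      (h'.hasDerivAt x hx.2).continuousAt).1 hxe] with y hy
    exact ⟨fun h => absurd h hxe, fun h => absurd h hy⟩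

/-- The local flow of the vector field, starting at the time of the given point. -/
theorem exists_isomFlow (hp : p ∈ paramSpace) :
    ∃ (Φ : ℝ × ℝ × ℝ × ℝ → ℝ × ℝ × ℝ × ℝ) (ρ : ℝ), 0 < ρ ∧ ContinuousAt Φ p ∧
      ∀ c ∈ Metric.ball p.2 ρ, Φ (p.1, c) = (p.1, c) ∧
        IsIsomCurve (Metric.ball p.1 ρ) fun s => Φ (s, c) := by
  obtain ⟨ε, hε, a, r, L, K, hr, hpl⟩ := IsPicardLindelof.of_contDiffAt_one
    (contDiffAt_isomField (n := 1) hp.1.ne')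
  obtain ⟨α, hα, hαc⟩ := (hpl p.1).exists_forall_mem_closedBall_eq_hasDerivWithinAt_continuousOn
  have hr' : (0 : ℝ) < r := hr
  -- The initial time is frozen at `p.1`, so the argument consists of the current time and the
  -- values of `(χ, a, ℓ)` at time `p.1`.
  let Φ : ℝ × ℝ × ℝ × ℝ → ℝ × ℝ × ℝ × ℝ := fun q => α ((p.1, q.2), q.1)
  have hmem : ∀ c ∈ Metric.ball p.2 r, (p.1, c) ∈ Metric.closedBall p r := by
    intro c hc
    rw [← closedBall_prod_same]
    exact ⟨Metric.mem_closedBall_self hr'.le, Metric.ball_subset_closedBall hc⟩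
  have hΦp : Φ p = p := (hα p (Metric.mem_closedBall_self hr'.le)).1
  have hΦc : ContinuousAt Φ p := by
    have h1 : ContinuousAt α (p, p.1) := hαc.continuousAt
      (prod_mem_nhds (Metric.closedBall_mem_nhds p hr')
        (Icc_mem_nhds (by linarith) (by linarith)))
    exact ContinuousAt.comp (f := fun q : ℝ × ℝ × ℝ × ℝ => ((p.1, q.2), q.1)) h1 (by fun_prop)
  have hnear : ∀ᶠ q in 𝓝 p, Φ q ∈ paramSpace :=
    hΦc.eventually_mem (by rw [hΦp]; exact isOpen_paramSpace.mem_nhds hp)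
  obtain ⟨ρ₁, hρ₁, hball⟩ := Metric.eventually_nhds_iff_ball.1 hnear
  set ρ := min ρ₁ (min r ε)
  have hρ : 0 < ρ := lt_min hρ₁ (lt_min hr' hε)
  have hρr : ρ ≤ r := (min_le_right _ _).trans (min_le_left _ _)
  have hρε : ρ ≤ ε := (min_le_right _ _).trans (min_le_right _ _)
  refine ⟨Φ, ρ, hρ, hΦc, fun c hc => ?_⟩
  have hcr := hmem c (Metric.ball_subset_ball hρr hc)
  obtain ⟨h0, hd⟩ := hα _ hcr
  have hderiv : ∀ s ∈ Metric.ball p.1 ρ, HasDerivAt (fun s => Φ (s, c)) (isomField (Φ (s, c))) s := by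
    intro s hs
    rw [Real.ball_eq_Ioo] at hs
    exact (hd s ⟨by linarith [hs.1], by linarith [hs.2]⟩).hasDerivAt
      (Icc_mem_nhds (by linarith [hs.1]) (by linarith [hs.2]))
  have hconn : IsConnected (Metric.ball p.1 ρ) := by
    rw [Real.ball_eq_Ioo]
    exact isConnected_Ioo (by linarith)
  refine ⟨h0, Metric.isOpen_ball, hconn, fun s hs => ?_, fun s hs => ?_, hderiv⟩
  -- The first component of the field is 1, so the first coordinate minus the time is constant.
  · have h1 : ∀ s ∈ Metric.ball p.1 ρ, HasDerivAt (fun s => (Φ (s, c)).1 - s) 0 s := fun s hs =>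
      ((hderiv s hs).fst_prod.sub (hasDerivAt_id s)).congr_deriv (sub_self 1)
    have h2 := Metric.isOpen_ball.is_const_of_deriv_eq_zero hconn.isPreconnected
      (fun s hs => (h1 s hs).differentiableAt.differentiableWithinAt)
      (fun s hs => (h1 s hs).deriv) hs (Metric.mem_ball_self hρ)
    have h3 : (Φ (p.1, c)).1 = p.1 := by
      rw [show Φ (p.1, c) = (p.1, c) from h0]
    simp only [h3, sub_self] at h2
    linarith
  · refine hball _ ?_
    rw [← ball_prod_same]
    exact ⟨Metric.ball_subset_ball (min_le_left _ _) hs, Metric.ball_subset_ball (min_le_left _ _) hc⟩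

/-- Through each point there passes a unique solution with the largest domain. -/
theorem exists_largest_isomCurve (hp : p ∈ paramSpace) :
    ∃ J γ, IsIsomCurve J γ ∧ p.1 ∈ J ∧ γ p.1 = p ∧
      ∀ J' γ', IsIsomCurve J' γ' → p.1 ∈ J' → γ' p.1 = p → J' ⊆ J := by
  let 𝓙 : Set (Set ℝ) := {J | p.1 ∈ J ∧ ∃ γ, IsIsomCurve J γ ∧ γ p.1 = p}
  -- Outside the union of the domains the selected interval and curve are arbitrary defaults.
  have hsel : ∀ t : ℝ, ∃ J γ, t ∈ ⋃₀ 𝓙 → t ∈ J ∧ p.1 ∈ J ∧ IsIsomCurve J γ ∧ γ p.1 = p := by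
    intro t
    by_cases ht : t ∈ ⋃₀ 𝓙
    · obtain ⟨J, ⟨h1, γ, h2, h3⟩, h4⟩ := ht
      exact ⟨J, γ, fun _ => ⟨h4, h1, h2, h3⟩⟩
    · exact ⟨∅, fun _ => p, fun h => absurd h ht⟩
  choose I g hI using hsel
  -- The glued curve is evaluated on the diagonal `g t t`; by uniqueness the choice of the curve at
  -- `t` does not matter.
  have hglue : ∀ J' γ', IsIsomCurve J' γ' → p.1 ∈ J' → γ' p.1 = p →
      EqOn (fun t => g t t) γ' J' := by
    intro J' γ' h hpJ hγ t ht
    obtain ⟨h1, h2, h3, h4⟩ := hI t ⟨J', ⟨hpJ, γ', h, hγ⟩, ht⟩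
    exact h3.eqOn h h2 hpJ (h4.trans hγ.symm) ⟨h1, ht⟩
  obtain ⟨Φ, ρ, hρ, -, hΦ⟩ := exists_isomFlow hp
  obtain ⟨h0, hc0⟩ := hΦ p.2 (Metric.mem_ball_self hρ)
  have hp𝓙 : Metric.ball p.1 ρ ∈ 𝓙 := ⟨Metric.mem_ball_self hρ, _, hc0, h0⟩
  have hpm : p.1 ∈ ⋃₀ 𝓙 := ⟨_, hp𝓙, Metric.mem_ball_self hρ⟩
  have hloc : ∀ t ∈ ⋃₀ 𝓙, (fun t => g t t) =ᶠ[𝓝 t] g t := by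
    intro t ht
    obtain ⟨h1, h2, h3, h4⟩ := hI t ht
    filter_upwards [h3.isOpen.mem_nhds h1] with u hu using hglue _ _ h3 h2 h4 hu
  refine ⟨⋃₀ 𝓙, fun t => g t t, ⟨?_, ⟨⟨_, hpm⟩, ?_⟩, ?_, ?_, ?_⟩, hpm, ?_, ?_⟩
  · exact isOpen_sUnion fun J ⟨_, _, h, _⟩ => h.isOpen
  · exact isPreconnected_sUnion p.1 _ (fun J h => h.1)
      fun J ⟨_, _, h, _⟩ => h.isConnected.isPreconnected
  · intro t ht
    obtain ⟨h1, h2, h3, h4⟩ := hI t ht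
    exact h3.fst_eq t h1
  · intro t ht
    obtain ⟨h1, h2, h3, h4⟩ := hI t ht
    exact h3.mem_paramSpace t h1
  · intro t ht
    obtain ⟨h1, h2, h3, h4⟩ := hI t ht
    exact (h3.hasDerivAt t h1).congr_of_eventuallyEq (hloc t ht)
  · exact (hI p.1 hpm).2.2.2
  · exact fun J' γ' h hpJ hγ => subset_sUnion_of_mem ⟨hpJ, γ', h, hγ⟩

theorem IsIsomCurve.mem_isomLeaves (h : IsIsomCurve J γ) {t : ℝ} (ht : t ∈ J)
    (hmax : ∀ J' γ', IsIsomCurve J' γ' → t ∈ J' → γ' t = γ t → J' ⊆ J) : γ '' J ∈ isomLeaves := by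
  refine ⟨J, _, _, _, ⟨h.isIsomSolution, fun J₁ χ₁ a₁ ℓ₁ h₁ hJ hχ ha hℓ => ?_⟩,
    image_congr fun s hs => Prod.ext (h.fst_eq s hs) rfl⟩
  refine (hmax J₁ _ h₁.isIsomCurve (hJ ht) ?_).antisymm hJ
  exact Prod.ext (h.fst_eq t ht).symm (Prod.ext (hχ ht).symm (Prod.ext (ha ht).symm (hℓ ht).symm))

/-- A leaf contains the graph of every solution which meets it. -/
theorem exists_isomCurve_of_mem_isomLeaves {A : Set (ℝ × ℝ × ℝ × ℝ)} (hA : A ∈ isomLeaves) :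
    ∃ J γ, IsIsomCurve J γ ∧ A = γ '' J ∧
      ∀ J' γ', IsIsomCurve J' γ' → ∀ t ∈ J', γ' t ∈ A → J' ⊆ J ∧ EqOn γ' γ J' := by
  obtain ⟨J, χ, a, ℓ, ⟨h, hmax⟩, rfl⟩ := hA
  have hc := h.isIsomCurve
  refine ⟨J, _, hc, rfl, fun J' γ' h' t ht htA => ?_⟩
  obtain ⟨u, hu, hut⟩ := htA
  have htu : u = t := by
    have := congrArg Prod.fst hut
    rwa [h'.fst_eq t ht] at this
  subst htu
  have hp := h'.mem_paramSpace u ht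
  have hfst := h'.fst_eq u ht
  obtain ⟨Jm, γm, hm, hpm, hγm, hlarge⟩ := exists_largest_isomCurve hp
  rw [hfst] at hpm hγm hlarge
  have h1 := hlarge J _ hc hu hut
  have hagree := hc.eqOn hm hu hpm (hut.trans hγm.symm)
  have h2 : Jm = J := by
    refine hmax Jm _ _ _ hm.isIsomSolution h1 (fun s hs => ?_) (fun s hs => ?_) (fun s hs => ?_)
    · exact congrArg (fun q => q.2.1) (hagree ⟨hs, h1 hs⟩)
    · exact congrArg (fun q => q.2.2.1) (hagree ⟨hs, h1 hs⟩)
    · exact congrArg (fun q => q.2.2.2) (hagree ⟨hs, h1 hs⟩)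
  have h3 : J' ⊆ J := h2 ▸ hlarge J' γ' h' ht rfl
  exact ⟨h3, fun s hs => h'.eqOn hc ht hu hut.symm ⟨hs, h3 hs⟩⟩

theorem isomLeaves_pairwiseDisjoint : isomLeaves.PairwiseDisjoint id := by
  intro A hA B hB hne
  by_contra hnd
  obtain ⟨q, hqA, hqB⟩ := Set.not_disjoint_iff.1 hnd
  obtain ⟨J, γ, h, rfl, hmax⟩ := exists_isomCurve_of_mem_isomLeaves hA
  obtain ⟨J', γ', h', rfl, hmax'⟩ := exists_isomCurve_of_mem_isomLeaves hB
  obtain ⟨t, ht, htq⟩ := hqA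
  obtain ⟨t', ht', htq'⟩ := hqB
  obtain ⟨h1, h2⟩ := hmax J' γ' h' t' ht' ⟨t, ht, htq.trans htq'.symm⟩
  obtain ⟨h3, h4⟩ := hmax' J γ h t ht ⟨t', ht', htq'.trans htq.symm⟩
  refine hne ?_
  have : J = J' := h3.antisymm h1
  subst this
  exact image_congr h4

theorem sUnion_isomLeaves : ⋃₀ isomLeaves = paramSpace := by
  refine Subset.antisymm (sUnion_subset fun A hA => ?_) fun p hp => ?_
  · obtain ⟨J, γ, h, rfl, -⟩ := exists_isomCurve_of_mem_isomLeaves hA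
    rintro _ ⟨s, hs, rfl⟩
    exact h.mem_paramSpace s hs
  · obtain ⟨J, γ, h, hpJ, hγ, hmax⟩ := exists_largest_isomCurve hp
    refine ⟨γ '' J, h.mem_isomLeaves hpJ (by rwa [hγ]), p.1, hpJ, hγ⟩

theorem isConnected_of_mem_isomLeaves {A : Set (ℝ × ℝ × ℝ × ℝ)} (hA : A ∈ isomLeaves) :
    IsConnected A := by
  obtain ⟨J, γ, h, rfl, -⟩ := exists_isomCurve_of_mem_isomLeaves hA
  exact h.isConnected.image _ h.continuousOn

end IsomCurves

/-! ### Analytic dependence on time and initial values -/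

section AnalyticFlow

/-- The indefinite integral as an operator on continuous functions. -/
def volterra : C(unitInterval, ℝ) →L[ℝ] C(unitInterval, ℝ) :=
  LinearMap.mkContinuous
    { toFun := fun f => ⟨fun t => ∫ θ in (0 : ℝ)..t, f (projIcc 0 1 zero_le_one θ), by
        have hc : Continuous fun θ : ℝ => f (projIcc 0 1 zero_le_one θ) :=
          f.continuous.comp continuous_projIcc
        exact (intervalIntegral.continuous_primitive (fun a b => hc.intervalIntegrable a b) 0).comp
          continuous_subtype_val⟩
      map_add' := fun f g => by
        ext t
        exact intervalIntegral.integral_add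
          ((f.continuous.comp continuous_projIcc).intervalIntegrable _ _)
          ((g.continuous.comp continuous_projIcc).intervalIntegrable _ _)
      map_smul' := fun r f => by
        ext t
        exact intervalIntegral.integral_const_mul _ _ }
    1 fun f => by
      rw [one_mul, ContinuousMap.norm_le _ (norm_nonneg f)]
      intro t
      refine (intervalIntegral.norm_integral_le_of_norm_le_const (C := ‖f‖)
        fun θ _ => f.norm_coe_le_norm _).trans ?_
      rw [sub_zero, abs_of_nonneg t.2.1]
      exact mul_le_of_le_one_right (norm_nonneg _) t.2.2

theorem volterra_apply (f : C(unitInterval, ℝ)) (t : unitInterval) :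
    volterra f t = ∫ θ in (0 : ℝ)..t, f (projIcc 0 1 zero_le_one θ) := rfl

theorem smul_volterra_eq {f : C(unitInterval, ℝ)} {g : ℝ → ℝ} {δ : ℝ}
    (hg : ∀ θ : unitInterval, HasDerivAt g (δ * f θ) θ) (t : unitInterval) :
    δ * volterra f t = g t - g 0 := by
  have hc : Continuous fun θ : ℝ => δ * f (projIcc 0 1 zero_le_one θ) :=
    continuous_const.mul (f.continuous.comp continuous_projIcc)
  rw [volterra_apply, ← intervalIntegral.integral_const_mul]
  refine intervalIntegral.integral_eq_sub_of_hasDerivAt (fun θ hθ => ?_)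
    (hc.intervalIntegrable _ _)
  rw [uIcc_of_le t.2.1] at hθ
  have h1 : θ ∈ Icc (0 : ℝ) 1 := ⟨hθ.1, hθ.2.trans t.2.2⟩
  rw [projIcc_of_mem zero_le_one h1]
  exact hg ⟨θ, h1⟩

/-- The time along a segment. -/
def segmentTime (s₀ s : ℝ) : C(unitInterval, ℝ) :=
  s₀ • 1 + (s - s₀) • ⟨Subtype.val, continuous_subtype_val⟩

theorem segmentTime_apply (s₀ s : ℝ) (θ : unitInterval) :
    segmentTime s₀ s θ = s₀ + (s - s₀) * θ := by
  simp [segmentTime]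

/-- The integral equation for the pair `(χ, a)` on the segment from `s₀` to `s`. -/
def isomIntegralMap (s₀ : ℝ)
    (q : (ℝ × ℝ × ℝ × ℝ) × C(unitInterval, ℝ) × C(unitInterval, ℝ)) :
    C(unitInterval, ℝ) × C(unitInterval, ℝ) :=
  (q.2.1 - q.1.2.1 • 1 - (q.1.1 - s₀) • volterra ((1 / 2 : ℝ) •
      (q.2.2 - (2 : ℝ) • (q.2.1 * (q.1.2.2.2 • 1 + (2 : ℝ) • (q.2.1 * q.2.2))))
        * Ring.inverse (segmentTime s₀ q.1.1)),
    q.2.2 - q.1.2.2.1 • 1 - (q.1.1 - s₀) • volterra (-((2 : ℝ) • (segmentTime s₀ q.1.1 * q.2.1))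
      + q.2.2 * Ring.inverse (segmentTime s₀ q.1.1)
        * (q.1.2.2.2 • 1 + (2 : ℝ) • (q.2.1 * q.2.2))))

/-- All operations are polynomial or linear in the Banach algebra `C([0, 1])`, except the inverse of
the time. For `q.1.1 = s₀` the time is the nonzero constant `s₀`, where inversion is analytic. -/
theorem contDiffAt_isomIntegralMap {s₀ : ℝ} (hs₀ : s₀ ≠ 0)
    {q : (ℝ × ℝ × ℝ × ℝ) × C(unitInterval, ℝ) × C(unitInterval, ℝ)} (hq : q.1.1 = s₀) :
    ContDiffAt ℝ ω (isomIntegralMap s₀) q := by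
  have hσ : ContDiffAt ℝ ω (fun q : (ℝ × ℝ × ℝ × ℝ) × C(unitInterval, ℝ) × C(unitInterval, ℝ) =>
      segmentTime s₀ q.1.1) q := by
    unfold segmentTime
    fun_prop
  have hinv : ContDiffAt ℝ ω (fun q : (ℝ × ℝ × ℝ × ℝ) × C(unitInterval, ℝ) × C(unitInterval, ℝ) =>
      Ring.inverse (segmentTime s₀ q.1.1)) q := by
    have hu : IsUnit (segmentTime s₀ q.1.1) := by
      rw [ContinuousMap.isUnit_iff_forall_ne_zero]
      intro θ
      rw [segmentTime_apply, hq, sub_self, zero_mul, add_zero]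
      exact hs₀
    obtain ⟨u, hu⟩ := hu
    have := contDiffAt_ringInverse (n := ω) ℝ u
    rw [hu] at this
    exact this.comp q hσ
  have h1 : ContDiffAt ℝ ω (fun q : (ℝ × ℝ × ℝ × ℝ) × C(unitInterval, ℝ) × C(unitInterval, ℝ) =>
      (1 / 2 : ℝ) • (q.2.2 - (2 : ℝ) • (q.2.1 * (q.1.2.2.2 • 1 + (2 : ℝ) • (q.2.1 * q.2.2))))
        * Ring.inverse (segmentTime s₀ q.1.1)) q := ContDiffAt.mul (by fun_prop) hinv
  have h2 : ContDiffAt ℝ ω (fun q : (ℝ × ℝ × ℝ × ℝ) × C(unitInterval, ℝ) × C(unitInterval, ℝ) =>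
      -((2 : ℝ) • (segmentTime s₀ q.1.1 * q.2.1)) + q.2.2 * Ring.inverse (segmentTime s₀ q.1.1)
        * (q.1.2.2.2 • 1 + (2 : ℝ) • (q.2.1 * q.2.2))) q :=
    ((hσ.mul (by fun_prop)).const_smul (2 : ℝ)).neg.add
      (ContDiffAt.mul (ContDiffAt.mul (by fun_prop) hinv) (by fun_prop))
  have hs : ContDiffAt ℝ ω (fun q : (ℝ × ℝ × ℝ × ℝ) × C(unitInterval, ℝ) × C(unitInterval, ℝ) =>
      q.1.1 - s₀) q := by fun_prop
  exact (ContDiffAt.sub (by fun_prop) (hs.smul (volterra.contDiff.contDiffAt.comp q h1))).prodMk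
    (ContDiffAt.sub (by fun_prop) (hs.smul (volterra.contDiff.contDiffAt.comp q h2)))

/-- The local flow depends analytically on the time and on the initial point. -/
theorem contDiffAt_isomFlow {p : ℝ × ℝ × ℝ × ℝ} (hp : p ∈ paramSpace)
    {Φ : ℝ × ℝ × ℝ × ℝ → ℝ × ℝ × ℝ × ℝ} {ρ : ℝ} (hρ : 0 < ρ) (hcont : ContinuousAt Φ p)
    (hΦ : ∀ c ∈ Metric.ball p.2 ρ, Φ (p.1, c) = (p.1, c) ∧
      IsIsomCurve (Metric.ball p.1 ρ) fun s => Φ (s, c)) : ContDiffAt ℝ ω Φ p := by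
  have hs₀ : p.1 ≠ 0 := hp.1.ne'
  set u : (ℝ × ℝ × ℝ × ℝ) × C(unitInterval, ℝ) × C(unitInterval, ℝ) :=
    (p, p.2.1 • 1, p.2.2.1 • 1)
  have hF := contDiffAt_isomIntegralMap hs₀ (q := u) rfl
  have hFu : isomIntegralMap p.1 u = 0 := by simp [isomIntegralMap, u]
  -- For the segment of zero length the integral terms carry the factor `q.1.1 - s₀ = 0`, so the
  -- partial derivative in the unknown functions is the identity.
  have hinr : fderiv ℝ (isomIntegralMap p.1) u ∘L
      ContinuousLinearMap.inr ℝ (ℝ × ℝ × ℝ × ℝ) (C(unitInterval, ℝ) × C(unitInterval, ℝ))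
      = ContinuousLinearMap.id ℝ _ := by
    have h1 := (hF.differentiableAt (by simp)).hasFDerivAt
    have h2 : HasFDerivAt (fun y => isomIntegralMap p.1 (p, y)) (fderiv ℝ (isomIntegralMap p.1) u ∘L
      ContinuousLinearMap.inr ℝ (ℝ × ℝ × ℝ × ℝ) (C(unitInterval, ℝ) × C(unitInterval, ℝ))) u.2 :=
      HasFDerivAt.comp (g := isomIntegralMap p.1) u.2 h1 (hasFDerivAt_prodMk_right p u.2)
    have h3 : (fun y => isomIntegralMap p.1 (p, y)) = fun y => y - (p.2.1 • 1, p.2.2.1 • 1) := by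
      funext y
      simp only [isomIntegralMap, sub_self, zero_smul, sub_zero]
      rfl
    rw [h3] at h2
    exact h2.unique ((hasFDerivAt_id _).sub_const _)
  have hinv : (fderiv ℝ (isomIntegralMap p.1) u ∘L
      ContinuousLinearMap.inr ℝ (ℝ × ℝ × ℝ × ℝ)
        (C(unitInterval, ℝ) × C(unitInterval, ℝ))).IsInvertible := by
    rw [hinr]
    exact ⟨ContinuousLinearEquiv.refl ℝ _, rfl⟩
  set ψ := hF.implicitFunction (by simp) hinv
  have hψ : ContDiffAt ℝ ω ψ p := hF.contDiffAt_implicitFunction (by simp) hinv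
  have huniq := hF.eventually_apply_eq_iff_implicitFunction (by simp) hinv
  obtain ⟨δ, hδ, huniq⟩ := Metric.eventually_nhds_iff_ball.1 huniq
  have hΦp : Φ p = p := (hΦ p.2 (Metric.mem_ball_self hρ)).1
  -- Uniqueness in the implicit function theorem is local; continuity of `Φ` at `p` keeps the
  -- trajectories uniformly close to the constant functions.
  obtain ⟨δ', hδ', hclose⟩ := Metric.continuousAt_iff.1 hcont (δ / 2) (by positivity)
  rw [hΦp] at hclose
  let ev1 : C(unitInterval, ℝ) →L[ℝ] ℝ := ContinuousMap.evalCLM ℝ (1 : unitInterval)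
  -- The trajectory on the segment solves the integral equation, hence is the implicit function. The
  -- flow is its value at the end of the segment.
  have hmain : Φ =ᶠ[𝓝 p] fun q => (q.1, ev1 (ψ q).1, ev1 (ψ q).2, q.2.2.2) := by
    have hr : 0 < min ρ (min δ δ') := lt_min hρ (lt_min hδ hδ')
    filter_upwards [Metric.ball_mem_nhds p hr] with q hq
    rw [← ball_prod_same] at hq
    obtain ⟨hq1, hq2⟩ := hq
    obtain ⟨h0, hcurve⟩ := hΦ q.2 (Metric.ball_subset_ball (min_le_left _ _) hq2)
    let l : ℝ → ℝ := fun θ => p.1 + (q.1 - p.1) * θ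
    have hl : ∀ θ, HasDerivAt l (q.1 - p.1) θ := fun θ =>
      (((hasDerivAt_id θ).const_mul (q.1 - p.1)).const_add p.1).congr_deriv (mul_one _)
    have hlmem : ∀ θ : unitInterval, l θ ∈ Metric.ball p.1 (min ρ (min δ δ')) := by
      intro θ
      rw [mem_ball_iff_norm] at hq1 ⊢
      refine lt_of_le_of_lt ?_ hq1
      simp only [l, add_sub_cancel_left, norm_mul, Real.norm_eq_abs, abs_of_nonneg θ.2.1]
      exact mul_le_of_le_one_right (abs_nonneg _) θ.2.2
    have hlρ : ∀ θ : unitInterval, l θ ∈ Metric.ball p.1 ρ := fun θ =>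
      Metric.ball_subset_ball (min_le_left _ _) (hlmem θ)
    have hder : ∀ θ : unitInterval, HasDerivAt (fun θ => Φ (l θ, q.2))
        ((q.1 - p.1) • isomField (Φ (l θ, q.2))) (θ : ℝ) := fun θ =>
      (hcurve.hasDerivAt _ (hlρ θ)).scomp (θ : ℝ) (hl θ)
    have hcontΦ : Continuous fun θ : unitInterval => Φ (l θ, q.2) :=
      continuous_iff_continuousAt.2 fun θ =>
        ContinuousAt.comp (f := fun θ : unitInterval => (θ : ℝ)) (hder θ).continuousAt
          continuous_subtype_val.continuousAt
    have hfst : ∀ θ : unitInterval, (Φ (l θ, q.2)).1 = l θ := fun θ => hcurve.fst_eq _ (hlρ θ)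
    have hℓ : ∀ θ : unitInterval, (Φ (l θ, q.2)).2.2.2 = q.2.2.2 := by
      intro θ
      have := hcurve.isIsomSolution.eq_ℓ (hlρ θ) (Metric.mem_ball_self hρ)
      rw [this, h0]
    let X : C(unitInterval, ℝ) := ⟨fun θ => (Φ (l θ, q.2)).2.1, hcontΦ.snd.fst⟩
    let Y : C(unitInterval, ℝ) := ⟨fun θ => (Φ (l θ, q.2)).2.2.1, hcontΦ.snd.snd.fst⟩
    have hX : ∀ θ, X θ = (Φ (l θ, q.2)).2.1 := fun θ => rfl
    have hY : ∀ θ, Y θ = (Φ (l θ, q.2)).2.2.1 := fun θ => rfl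
    have hdist : ∀ θ : unitInterval, dist (Φ (l θ, q.2)) p < δ / 2 := by
      intro θ
      refine hclose ?_
      rw [Prod.dist_eq]
      exact max_lt ((Metric.mem_ball.1 (hlmem θ)).trans_le
        ((min_le_right _ _).trans (min_le_right _ _))) ((Metric.mem_ball.1 hq2).trans_le
        ((min_le_right _ _).trans (min_le_right _ _)))
    have hmem : ((q, X, Y) : (ℝ × ℝ × ℝ × ℝ) × C(unitInterval, ℝ) × C(unitInterval, ℝ))
        ∈ Metric.ball u δ := by
      have hlt : δ / 2 < δ := by linarith
      rw [Metric.mem_ball, Prod.dist_eq, Prod.dist_eq]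
      refine max_lt ?_ (max_lt (lt_of_le_of_lt ?_ hlt) (lt_of_le_of_lt ?_ hlt))
      · rw [Prod.dist_eq]
        exact max_lt ((Metric.mem_ball.1 hq1).trans_le ((min_le_right _ _).trans (min_le_left _ _)))
          ((Metric.mem_ball.1 hq2).trans_le ((min_le_right _ _).trans (min_le_left _ _)))
      · refine (ContinuousMap.dist_le (by positivity)).2 fun θ => ?_
        have h1 := (hdist θ).le
        rw [Prod.dist_eq, Prod.dist_eq, max_le_iff, max_le_iff] at h1
        simpa [u, X] using h1.2.1
      · refine (ContinuousMap.dist_le (by positivity)).2 fun θ => ?_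
        have h1 := (hdist θ).le
        rw [Prod.dist_eq, Prod.dist_eq, Prod.dist_eq, max_le_iff, max_le_iff, max_le_iff] at h1
        simpa [u, Y] using h1.2.2.1
    have hσinv : ∀ θ, Ring.inverse (segmentTime p.1 q.1) θ = (l θ)⁻¹ := by
      intro θ
      have hpos : ∀ θ : unitInterval, segmentTime p.1 q.1 θ ≠ 0 := by
        intro θ
        rw [segmentTime_apply]
        have := (hcurve.mem_paramSpace _ (hlρ θ)).1
        rw [hfst θ] at this
        exact this.ne'
      have h1 := Ring.mul_inverse_cancel _ ((ContinuousMap.isUnit_iff_forall_ne_zero _).2 hpos)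
      have h2 := congrArg (fun f : C(unitInterval, ℝ) => f θ) h1
      simp only [ContinuousMap.mul_apply, ContinuousMap.one_apply] at h2
      have h3 : segmentTime p.1 q.1 θ = l θ := segmentTime_apply _ _ _
      rw [h3] at h2
      exact eq_inv_of_mul_eq_one_right h2
    have hΦ0 : Φ (l 0, q.2) = (p.1, q.2) := by simp only [l, mul_zero, add_zero, h0]
    have hzero : isomIntegralMap p.1 (q, X, Y) = isomIntegralMap p.1 u := by
      rw [hFu]
      refine Prod.ext ?_ ?_
      · ext t
        have hint := smul_volterra_eq (f := (1 / 2 : ℝ) •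
          (Y - (2 : ℝ) • (X * (q.2.2.2 • 1 + (2 : ℝ) • (X * Y))))
            * Ring.inverse (segmentTime p.1 q.1)) (g := fun θ => (Φ (l θ, q.2)).2.1)
          (δ := q.1 - p.1) (fun θ => ?_) t
        · simp only [isomIntegralMap, ContinuousMap.sub_apply, ContinuousMap.smul_apply,
            smul_eq_mul, ContinuousMap.one_apply, mul_one, Prod.fst_zero, ContinuousMap.zero_apply]
          rw [hint, hX, hΦ0]
          simp
        · refine (hder θ).snd_prod.fst_prod.congr_deriv ?_
          simp only [Prod.smul_snd, Prod.smul_fst, isomField, smul_eq_mul, ContinuousMap.mul_apply,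
            ContinuousMap.smul_apply, ContinuousMap.sub_apply, ContinuousMap.add_apply,
            ContinuousMap.one_apply, hσinv, hfst, hℓ, hX, hY, mul_one]
          rw [div_eq_mul_inv, mul_inv]
          ring
      · ext t
        have hint := smul_volterra_eq (f := -((2 : ℝ) • (segmentTime p.1 q.1 * X))
          + Y * Ring.inverse (segmentTime p.1 q.1) * (q.2.2.2 • 1 + (2 : ℝ) • (X * Y)))
          (g := fun θ => (Φ (l θ, q.2)).2.2.1) (δ := q.1 - p.1) (fun θ => ?_) t
        · simp only [isomIntegralMap, ContinuousMap.sub_apply, ContinuousMap.smul_apply,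
            smul_eq_mul, ContinuousMap.one_apply, mul_one, Prod.snd_zero, ContinuousMap.zero_apply]
          rw [hint, hY, hΦ0]
          simp
        · refine (hder θ).snd_prod.snd_prod.fst_prod.congr_deriv ?_
          simp only [Prod.smul_snd, Prod.smul_fst, isomField, smul_eq_mul, ContinuousMap.mul_apply,
            ContinuousMap.smul_apply, ContinuousMap.neg_apply, ContinuousMap.add_apply,
            ContinuousMap.one_apply, hσinv, hfst, hℓ, hX, hY, mul_one, segmentTime_apply]
          rw [div_eq_mul_inv]
          simp only [l]
          ring
    have hψq : ψ q = (X, Y) := (huniq _ hmem).1 hzero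
    have h1 : l ((1 : unitInterval) : ℝ) = q.1 := by simp [l]
    have e1 : ev1 X = (Φ q).2.1 := by
      change X 1 = _
      rw [hX, h1]
    have e2 : ev1 Y = (Φ q).2.2.1 := by
      change Y 1 = _
      rw [hY, h1]
    have e3 := hfst 1
    have e4 := hℓ 1
    rw [h1] at e3 e4
    simp only [hψq, e1, e2]
    exact Prod.ext e3 (Prod.ext rfl (Prod.ext rfl e4))
  refine ContDiffAt.congr_of_eventuallyEq ?_ hmain
  have h1 := ev1.contDiff.contDiffAt.comp p (contDiffAt_fst.comp p hψ)
  have h2 := ev1.contDiff.contDiffAt.comp p (contDiffAt_snd.comp p hψ)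
  exact contDiffAt_fst.prodMk (h1.prodMk (h2.prodMk (by fun_prop)))

end AnalyticFlow

/-! ### Rectifying charts -/

section Foliation

/-- Rectifying coordinates for the foliation. -/
theorem exists_isomChart {p : ℝ × ℝ × ℝ × ℝ} (hp : p ∈ paramSpace) :
    ∃ φ : OpenPartialHomeomorph (ℝ × ℝ × ℝ × ℝ) (ℝ × ℝ × ℝ × ℝ),
      p ∈ φ.source ∧ φ.source ⊆ paramSpace ∧
      AnalyticOnNhd ℝ φ φ.source ∧ AnalyticOnNhd ℝ φ.symm φ.target ∧
      ∀ A ∈ isomLeaves, ∀ q ∈ A ∩ φ.source,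
        connectedComponentIn (A ∩ φ.source) q = {q₁ ∈ φ.source | (φ q₁).2 = (φ q).2} := by
  obtain ⟨Φ, ρ, hρ, hcont, hΦ⟩ := exists_isomFlow hp
  have hω := contDiffAt_isomFlow hp hρ hcont hΦ
  have hΦp : Φ p = p := (hΦ p.2 (Metric.mem_ball_self hρ)).1
  have hD := (hω.differentiableAt (by simp)).hasFDerivAt
  set D := fderiv ℝ Φ p
  have hD1 : ∀ v, (D v).1 = v.1 := by
    have h1 : HasFDerivAt (fun q => (Φ q).1)
        (ContinuousLinearMap.fst ℝ ℝ (ℝ × ℝ × ℝ) ∘L D) p :=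
      (ContinuousLinearMap.fst ℝ ℝ (ℝ × ℝ × ℝ)).hasFDerivAt.comp p hD
    have h2 : (fun q => (Φ q).1) =ᶠ[𝓝 p] fun q => q.1 := by
      filter_upwards [Metric.ball_mem_nhds p hρ] with q hq
      rw [← ball_prod_same] at hq
      exact (hΦ q.2 hq.2).2.fst_eq _ hq.1
    have h3 := (h1.congr_of_eventuallyEq h2.symm).unique
      (ContinuousLinearMap.fst ℝ ℝ (ℝ × ℝ × ℝ)).hasFDerivAt
    exact fun v => congrArg (fun T => T v) h3
  have hD2 : ∀ v, D (0, v) = (0, v) := by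
    have h1 : HasFDerivAt (fun c => Φ (p.1, c)) (D ∘L ContinuousLinearMap.inr ℝ ℝ (ℝ × ℝ × ℝ))
        p.2 := HasFDerivAt.comp (g := Φ) p.2 hD (hasFDerivAt_prodMk_right p.1 p.2)
    have h2 : (fun c => Φ (p.1, c)) =ᶠ[𝓝 p.2] fun c => (p.1, c) := by
      filter_upwards [Metric.ball_mem_nhds p.2 hρ] with c hc using (hΦ c hc).1
    have h3 := (h1.congr_of_eventuallyEq h2.symm).unique (hasFDerivAt_prodMk_right p.1 p.2)
    exact fun v => congrArg (fun T => T v) h3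
  -- The differential of the flow at `p` is block triangular: it preserves the time component and is
  -- the identity on the slice of fixed time.
  have hDinj : Function.Injective D.toLinearMap := by
    rw [injective_iff_map_eq_zero]
    rintro ⟨t, v⟩ hw
    have hw : D (t, v) = 0 := hw
    have ht : t = 0 := by
      have := hD1 (t, v)
      rw [hw] at this
      exact this.symm
    rw [ht, hD2] at hw
    rw [ht]
    exact hw
  set D' : (ℝ × ℝ × ℝ × ℝ) ≃L[ℝ] (ℝ × ℝ × ℝ × ℝ) :=
    (LinearEquiv.ofInjectiveEndo D.toLinearMap hDinj).toContinuousLinearEquiv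
  have hD' : HasFDerivAt Φ (D' : (ℝ × ℝ × ℝ × ℝ) →L[ℝ] (ℝ × ℝ × ℝ × ℝ)) p := hD
  -- The chart is the inverse of the flow: a point goes to its time and to the values of its
  -- solution at time `p.1`.
  set e := hω.toOpenPartialHomeomorph Φ hD' (by simp)
  have he : ∀ q, e q = Φ q := fun q => rfl
  have hpe : p ∈ e.source := hω.mem_toOpenPartialHomeomorph_source hD' (by simp)
  have hsymm : ContDiffAt ℝ ω e.symm p := by
    have := hω.to_localInverse hD' (by simp)
    rwa [hΦp] at this
  have hgood : ∀ᶠ q in 𝓝 p, q ∈ e.source ∧ ContDiffAt ℝ ω Φ q ∧ ContDiffAt ℝ ω e.symm (Φ q) := by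
    have h1 := hsymm.eventually (by simp)
    rw [← hΦp] at h1
    filter_upwards [e.open_source.mem_nhds hpe, hω.eventually (by simp), hcont.eventually h1]
      with q h1 h2 h3 using ⟨h1, h2, h3⟩
  obtain ⟨r₁, hr₁, hball⟩ := Metric.eventually_nhds_iff_ball.1 hgood
  set r := min r₁ ρ
  have hr : 0 < r := lt_min hr₁ hρ
  have hN : ∀ q ∈ Metric.ball p r, q ∈ e.source ∧ ContDiffAt ℝ ω Φ q ∧
      ContDiffAt ℝ ω e.symm (Φ q) := fun q hq =>
    hball q (Metric.ball_subset_ball (min_le_left _ _) hq)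
  have hNρ : ∀ q ∈ Metric.ball p r, q.1 ∈ Metric.ball p.1 ρ ∧ q.2 ∈ Metric.ball p.2 ρ := by
    intro q hq
    rw [← ball_prod_same] at hq
    exact ⟨Metric.ball_subset_ball (min_le_right _ _) hq.1,
      Metric.ball_subset_ball (min_le_right _ _) hq.2⟩
  set ψ := e.restrOpen (Metric.ball p r) Metric.isOpen_ball
  have hψs : ψ.source = Metric.ball p r := by
    rw [OpenPartialHomeomorph.restrOpen_source]
    exact inter_eq_right.2 fun q hq => (hN q hq).1
  have hψ : ∀ q, ψ q = Φ q := fun q => rfl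
  have hsrc : ∀ y ∈ ψ.symm.source, ψ.symm y ∈ Metric.ball p r ∧ Φ (ψ.symm y) = y := by
    intro y hy
    refine ⟨?_, ψ.right_inv hy⟩
    rw [← hψs]
    exact ψ.map_target hy
  have hsrc' : ∀ x ∈ Metric.ball p r, Φ x ∈ ψ.symm.source ∧ ψ.symm (Φ x) = x := by
    intro x hx
    rw [← hψs] at hx
    exact ⟨ψ.map_source hx, ψ.left_inv hx⟩
  have hpr := Metric.mem_ball_self (x := p) hr
  refine ⟨ψ.symm, ?_, ?_, ?_, ?_, ?_⟩
  · have := (hsrc' p hpr).1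
    rwa [hΦp] at this
  · intro y hy
    obtain ⟨h1, h2⟩ := hsrc y hy
    rw [← h2]
    exact (hΦ _ (hNρ _ h1).2).2.mem_paramSpace _ (hNρ _ h1).1
  · intro y hy
    obtain ⟨h1, h2⟩ := hsrc y hy
    have := (hN _ h1).2.2
    rw [h2] at this
    exact this.analyticAt
  · intro x hx
    have hx' : x ∈ Metric.ball p r := hψs ▸ hx
    exact (hN x hx').2.1.analyticAt
  · rintro A hA q ⟨hqA, hqs⟩
    obtain ⟨hx, hxq⟩ := hsrc q hqs
    set x := ψ.symm q
    obtain ⟨J, γ, h, rfl, hleaf⟩ := exists_isomCurve_of_mem_isomLeaves hA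
    have hmeet : ∀ x ∈ Metric.ball p r, Φ x ∈ γ '' J → Metric.ball p.1 ρ ⊆ J ∧
        EqOn (fun s => Φ (s, x.2)) γ (Metric.ball p.1 ρ) := fun x hx hxA =>
      hleaf _ _ (hΦ x.2 (hNρ x hx).2).2 x.1 (hNρ x hx).1 hxA
    have hslice : ∀ x ∈ Metric.ball p r, ∀ s ∈ Metric.ball p.1 r, (s, x.2) ∈ Metric.ball p r := by
      intro x hx s hs
      rw [← ball_prod_same] at hx ⊢
      exact ⟨hs, hx.2⟩
    have hxA : Φ x ∈ γ '' J := hxq ▸ hqA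
    obtain ⟨hJ, hγ⟩ := hmeet x hx hxA
    -- A leaf is a graph over `s`, so it has only one value at time `p.1`. Two slices in the same
    -- leaf therefore coincide, and the whole intersection, not only a component, is one slice.
    have heq : γ '' J ∩ ψ.symm.source = {q₁ ∈ ψ.symm.source | (ψ.symm q₁).2 = x.2} := by
      ext y
      refine ⟨fun ⟨hyA, hys⟩ => ⟨hys, ?_⟩, fun ⟨hys, hy2⟩ => ⟨?_, hys⟩⟩
      · obtain ⟨hz, hzy⟩ := hsrc y hys
        have h1 := (hmeet _ hz (by rwa [hzy])).2 (Metric.mem_ball_self hρ)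
        have h2 := hγ (Metric.mem_ball_self hρ)
        simp only [(hΦ _ (hNρ _ hz).2).1] at h1
        simp only [(hΦ _ (hNρ _ hx).2).1] at h2
        exact (Prod.mk.inj (h1.trans h2.symm)).2
      · obtain ⟨hz, hzy⟩ := hsrc y hys
        have h1 := hγ (hNρ _ hz).1
        simp only at h1
        rw [← hy2] at h1
        exact ⟨_, hJ (hNρ _ hz).1, h1.symm.trans hzy⟩
    have himage : {q₁ ∈ ψ.symm.source | (ψ.symm q₁).2 = x.2}
        = (fun s => Φ (s, x.2)) '' Metric.ball p.1 r := by
      ext y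
      constructor
      · rintro ⟨hys, hy2⟩
        obtain ⟨hz, hzy⟩ := hsrc y hys
        refine ⟨(ψ.symm y).1, ?_, ?_⟩
        · rw [← ball_prod_same] at hz
          exact hz.1
        · simp only [← hy2]
          exact hzy
      · rintro ⟨s, hs, rfl⟩
        obtain ⟨h1, h2⟩ := hsrc' _ (hslice x hx s hs)
        exact ⟨h1, by simp only [h2]⟩
    have hpre : IsPreconnected (γ '' J ∩ ψ.symm.source) := by
      rw [heq, himage]
      refine IsPreconnected.image ?_ _ ?_
      · rw [Real.ball_eq_Ioo]
        exact isPreconnected_Ioo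
      · exact (hΦ _ (hNρ _ hx).2).2.continuousOn.mono
          (Metric.ball_subset_ball (min_le_right _ _))
    rw [hpre.connectedComponentIn ⟨hqA, hqs⟩, heq]

theorem isAnalyticFoliationByCurves_isomLeaves :
    IsAnalyticFoliationByCurves (ℝ × ℝ × ℝ) paramSpace isomLeaves :=
  ⟨isOpen_paramSpace, sUnion_isomLeaves, fun _ hA => isConnected_of_mem_isomLeaves hA,
    isomLeaves_pairwiseDisjoint, fun _ hp => exists_isomChart hp⟩

end Foliation

/-! ### Injectivity of the parametrization and the Painlevé equation -/

section Painleve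

theorem injOn_torusSystem : InjOn torusSystem paramSpace := by
  rintro ⟨s, χ, a, ℓ⟩ hp ⟨s', χ', a', ℓ'⟩ - h
  have hs0 : s ≠ 0 := hp.1.ne'
  have h1 := congrArg (fun L => L.K 0 0) h
  have h2 := congrArg (fun L => L.K 0 1) h
  have h3 := congrArg (fun L => L.R 1 0) h
  have h4 := congrArg (fun L => L.R 0 0) h
  simp only [torusSystem, Matrix.smul_apply, Matrix.of_apply, Matrix.cons_val_zero,
    Matrix.cons_val_one, Matrix.cons_val', Matrix.cons_val_fin_one, smul_eq_mul] at h1 h2 h3 h4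
  norm_cast at h2
  have es : s = s' := by
    have : (s : ℂ) = s' := by linear_combination (-2) * h1
    exact_mod_cast this
  have ea : a = a' := by
    have : (a : ℂ) = a' := by linear_combination 2 * h3
    exact_mod_cast this
  subst es ea
  have eχ : χ = χ' := mul_left_cancel₀ (neg_ne_zero.2 hs0) h2
  subst eχ
  have eℓ : ℓ = ℓ' := by
    have : (ℓ : ℂ) = ℓ' := by linear_combination -h4
    exact_mod_cast this
  rw [eℓ]

variable {J : Set ℝ} {χ a ℓ : ℝ → ℝ} {s : ℝ}

/-- At a zero of `χ` the condition `(a, χ) ≠ (0, 0)` gives `χ' = a / (2 s) ≠ 0`. -/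
theorem IsIsomSolution.eventually_χ_ne_zero (h : IsIsomSolution J χ a ℓ) (hs : s ∈ J) :
    ∀ᶠ x in 𝓝[≠] s, χ x ≠ 0 := by
  by_cases hχ : χ s = 0
  · have ha : a s ≠ 0 := fun ha => (h.mem_paramSpace s hs).2 (by simp [ha, hχ])
    refine (h.deriv_χ s hs).eventually_ne ?_
    rw [hχ]
    have := h.pos hs
    simp [ha, this.ne']
  · exact eventually_nhdsWithin_of_eventually_nhds
      ((h.deriv_χ s hs).continuousAt.eventually_ne hχ)

theorem IsIsomCurve.contDiffOn {γ : ℝ → ℝ × ℝ × ℝ × ℝ} (h : IsIsomCurve J γ) (n : ℕ) :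
    ContDiffOn ℝ n γ J := by
  induction n with
  | zero => exact contDiffOn_zero.2 h.continuousOn
  | succ n ih =>
    push_cast
    rw [contDiffOn_succ_iff_deriv_of_isOpen h.isOpen]
    refine ⟨fun s hs => (h.hasDerivAt s hs).differentiableAt.differentiableWithinAt, by simp, ?_⟩
    refine ContDiffOn.congr (f := fun s => isomField (γ s)) (fun s hs => ?_)
      fun s hs => (h.hasDerivAt s hs).deriv
    exact (contDiffAt_isomField (h.mem_paramSpace s hs).1.ne').comp_contDiffWithinAt s (ih s hs)

/-- A Riccati equation for `w`, not closed because of `a²`. Where `w ≠ 0`, the relation `2 s χ = a /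
w` expresses the derivative of `a²` through `a²`, `w` and `s`; eliminating `a²` by this same
equation leads to Painlevé III. -/
theorem IsIsomSolution.hasDerivAt_painleve (h : IsIsomSolution J χ a ℓ) (hs : s ∈ J)
    (hχ : χ s ≠ 0) :
    HasDerivAt (fun x => a x / (2 * x * χ x)) (-1 - (a s / (2 * s * χ s)) ^ 2
      + (2 * ℓ s - 1) * (a s / (2 * s * χ s)) / s + 2 * a s ^ 2 / s ^ 2) s := by
  have hs0 := (h.pos hs).ne'
  refine ((h.deriv_a s hs).div (((hasDerivAt_id s).const_mul 2).mul (h.deriv_χ s hs))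
    (mul_ne_zero (mul_ne_zero two_ne_zero hs0) hχ)).congr_deriv ?_
  simp only [id, Pi.mul_apply]
  field_simp
  ring

theorem IsIsomSolution.satisfiesPainleveIIIAt (h : IsIsomSolution J χ a ℓ) (hs : s ∈ J)
    (hχ : χ s ≠ 0) : SatisfiesPainleveIIIAt (ℓ s) (fun x => a x / (2 * x * χ x)) s := by
  have hs0 := (h.pos hs).ne'
  have hnear : ∀ᶠ x in 𝓝 s, x ∈ J ∧ χ x ≠ 0 :=
    Filter.Eventually.and (h.isOpen.mem_nhds hs) ((h.deriv_χ s hs).continuousAt.eventually_ne hχ)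
  have hd1 := h.hasDerivAt_painleve hs hχ
  have hderiv : deriv (fun x => a x / (2 * x * χ x)) =ᶠ[𝓝 s] fun x =>
      -1 - (a x / (2 * x * χ x)) ^ 2 + (2 * ℓ s - 1) * (a x / (2 * x * χ x)) / x
        + 2 * a x ^ 2 / x ^ 2 := by
    filter_upwards [hnear] with x hx
    rw [(h.hasDerivAt_painleve hx.1 hx.2).deriv, h.eq_ℓ hx.1 hs]
  have hd2 := ((((hd1.pow 2).const_sub (-1)).add
    ((hd1.const_mul (2 * ℓ s - 1)).div (hasDerivAt_id s) hs0)).add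
      ((((h.deriv_a s hs).pow 2).const_mul 2).div (hasDerivAt_pow 2 s) (pow_ne_zero 2 hs0)))
  have hdd := hderiv.deriv_eq.trans hd2.deriv
  -- The equation multiplied by `w` is proved first: it holds at the zeros of `w` too, and elsewhere
  -- division by `w` gives the other form.
  have hmul : a s / (2 * s * χ s) * deriv (deriv fun x => a x / (2 * x * χ x)) s
      = deriv (fun x => a x / (2 * x * χ x)) s ^ 2
        - a s / (2 * s * χ s) * deriv (fun x => a x / (2 * x * χ x)) s / s
        - 2 * ℓ s * ((a s / (2 * s * χ s)) ^ 3 / s)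
        + (2 * ℓ s - 2) * (a s / (2 * s * χ s) / s) + (a s / (2 * s * χ s)) ^ 4 - 1 := by
    rw [hdd, hd1.deriv]
    simp only [id, Pi.pow_apply, Nat.cast_ofNat, Nat.reduceSub, pow_one]
    field_simp
    ring
  refine ⟨?_, fun hw => ?_, hmul⟩
  · have hγ : ContDiffAt ℝ 2 (fun s => (s, χ s, a s, ℓ s)) s :=
      (h.isIsomCurve.contDiffOn 2).contDiffAt (h.isOpen.mem_nhds hs)
    have h1 : ContDiffAt ℝ 2 χ s := contDiffAt_fst.comp s (contDiffAt_snd.comp s hγ)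
    have h2 : ContDiffAt ℝ 2 a s :=
      contDiffAt_fst.comp s (contDiffAt_snd.comp s (contDiffAt_snd.comp s hγ))
    exact h2.div ((contDiffAt_const.mul contDiffAt_id).mul h1)
      (mul_ne_zero (mul_ne_zero two_ne_zero hs0) hχ)
  · set w := a s / (2 * s * χ s)
    rw [← mul_right_inj' hw, hmul]
    field_simp

end Painleve

end

theorem theorem6p7 :
    -- `(s, χ, a, ℓ)` are coordinates on the family of linear systems
    InjOn torusSystem paramSpace ∧
    -- the solutions of the differential system form an analytic foliation of the family
    IsAnalyticFoliationByCurves (ℝ × ℝ × ℝ) paramSpace isomLeaves ∧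
    -- its leaves are isomonodromic families
    (∀ A ∈ isomLeaves, IsIsomonodromic (fun p : A => torusSystem p)) ∧
    -- the Painlevé III equation along solutions, away from the (isolated) zeros of `χ`
    (∀ (J : Set ℝ) (χ a ℓ : ℝ → ℝ), IsIsomSolution J χ a ℓ →
      (∀ s ∈ J, ∀ᶠ x in 𝓝[≠] s, χ x ≠ 0) ∧
      ∀ s ∈ J, χ s ≠ 0 →
        SatisfiesPainleveIIIAt (ℓ s) (fun x => a x / (2 * x * χ x)) s) := by
  refine ⟨injOn_torusSystem, isAnalyticFoliationByCurves_isomLeaves, ?_, fun J χ a ℓ h =>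
    ⟨fun s hs => h.eventually_χ_ne_zero hs, fun s hs hχ => h.satisfiesPainleveIIIAt hs hχ⟩⟩
  rintro A ⟨J, χ, a, ℓ, ⟨h, -⟩, hA⟩
  exact h.isIsomonodromic hA
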